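/- Let $N,k\ge 1$ be integers. For $x,x_0\in\mathbb{R}^N$, $y\in\mathbb{R}^k$ and $t>0$ let $$K(x,x_0,y;t)=\frac{1}{(2\pi)^{\frac{N+2k}{2}}}\int_{\mathbb{R}^k}\Big(\frac{|\xi|}{\sinh(|\xi|t)}\Big)^{\frac N2}e^{\,i\xi\cdot y-\frac{|\xi|}{2}\left((|x|^2+|x_0|^2)\coth(|\xi|t)-2x\cdot x_0\,\mathrm{csch}(|\xi|t)\right)}\,d\xi$$ be the heat kernel of the Grushin operator $\Delta_{\mathcal G}=\frac12(\Delta_x+|x|^2\Delta_y)$ on $\mathbb{R}^{N+k}=\mathbb{R}^N_x\times\mathbb{R}^k_y$, and let $S_{\mathcal G}(0)\varphi=\varphi$ and, for $t>0$, $$S_{\mathcal G}(t)\varphi(x,y)=\int_{\mathbb{R}^{N+k}}K(x,w,y-z;t)\,\varphi(w,z)\,d(w,z).$$ Let $\rho>1$, $1\le p<\infty$ and $p>\frac{N+2k}{2}(\rho-1)$, and put $\alpha=\frac{(N+2k)(\rho-1)}{2\rho p}$. Write $L^q=L^q(\mathbb{R}^{N+k})$ (real-valued functions). For $T>0$, an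 $L^p$-mild solution on $[0,T]$ of $$u_t=\Delta_{\mathcal G}u+|u|^{\rho-1}u,\qquad u(0)=u_0,$$ is a continuous $u:[0,T]\to L^p$ such that, for all $t\in[0,T]$, $$u(t)=S_{\mathcal G}(t)u_0+\int_0^tS_{\mathcal G}(t-s)|u(s)|^{\rho-1}u(s)\,ds,$$ the integral being a convergent Bochner integral in $L^p$. Let $X_\alpha=X_\alpha(T)$ be the set of functions $u$ that are continuous from $(0,T]$ to $L^{\rho p}$ with $\|u\|_{X_\alpha}=\sup_{t\in(0,T]}t^\alpha\|u(t)\|_{L^{\rho p}}<\infty$. (a) For every $M$ there are $T>0$ and $C$, depending only on $M$, $N$, $k$, $\rho$, $p$, such that for every $u_0\in L^p$ with $\|u_0\|_{L^p}\le M$ there is exactly one $L^p$-mild solution on $[0,T]$ with datum $u_0$ in $C([0,T];L^p)\cap X_\alpha(T)$ (in particular, every $u_0\in L^p$ has such a $T$), and such that, if $u,v\in C([0,T];L^p)\cap X_\alpha(T)$ are $L^p$-mild solutions on $[0,T]$ with data $u_0,v_0$ of norm at most $M$, then $$\|u(t)-v(t)\|_{L^p}\le C\|u_0-v_0\|_{L^p}\qquad\text{for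 all }t\in[0,T].$$ (b) For every $T>0$ and every $R$ there is $C$, depending only on $T$, $R$, $N$, $k$, $\rho$, $p$, such that, if $u,v\in C([0,T];L^p)\cap X_\alpha(T)$ are $L^p$-mild solutions on $[0,T]$ with data $u_0,v_0\in L^p$ and $\|u\|_{X_\alpha},\|v\|_{X_\alpha}\le R$, then $$\|u(t)-v(t)\|_{L^p}\le C\|u_0-v_0\|_{L^p}\qquad\text{for all }t\in[0,T].$$ -/

import Mathlib

open MeasureTheory Set Filter Topology
open scoped ENNReal

namespace Grushin

/-- The space `ℝ^{N+k} = ℝ^N × ℝ^k`, each factor Euclidean, with Lebesgue (product) measure. -/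
abbrev Space (N k : ℕ) : Type := EuclideanSpace ℝ (Fin N) × EuclideanSpace ℝ (Fin k)

/-- The integral formula for the heat kernel of the Grushin operator
`Δ_G = (Δ_x + |x|² Δ_y) / 2`, as a complex number:
`(2π)^{-(N+2k)/2} ∫_{ℝ^k} (|ξ| / sinh(|ξ|t))^{N/2}
  exp(i ξ·y - (|ξ|/2) ((|x|² + |x₀|²) coth(|ξ|t) - 2 x·x₀ csch(|ξ|t))) dξ`. -/
noncomputable def complexKernel {N k : ℕ} (x x₀ : EuclideanSpace ℝ (Fin N))
    (y : EuclideanSpace ℝ (Fin k)) (t : ℝ) : ℂ :=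
  ((1 / (2 * Real.pi) ^ (((N : ℝ) + 2 * k) / 2) : ℝ) : ℂ) *
    ∫ ξ : EuclideanSpace ℝ (Fin k),
      (((‖ξ‖ / Real.sinh (‖ξ‖ * t)) ^ ((N : ℝ) / 2) : ℝ) : ℂ) *
        Complex.exp (Complex.I * ((inner ℝ ξ y : ℝ) : ℂ) -
          ((‖ξ‖ / 2 * ((‖x‖ ^ 2 + ‖x₀‖ ^ 2) * (Real.cosh (‖ξ‖ * t) / Real.sinh (‖ξ‖ * t)) -
            2 * inner ℝ x x₀ * (1 / Real.sinh (‖ξ‖ * t))) : ℝ) : ℂ))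

/-- The heat kernel `K(x, x₀, y; t)` of the Grushin operator, as a real number
(the complex formula takes real values, see `coe_kernel`). -/
noncomputable def kernel {N k : ℕ} (x x₀ : EuclideanSpace ℝ (Fin N))
    (y : EuclideanSpace ℝ (Fin k)) (t : ℝ) : ℝ :=
  (complexKernel x x₀ y t).re

theorem coe_kernel {N k : ℕ} (x x₀ : EuclideanSpace ℝ (Fin N))
    (y : EuclideanSpace ℝ (Fin k)) (t : ℝ) :
    ((kernel x x₀ y t : ℝ) : ℂ) = complexKernel x x₀ y t := by
  apply Complex.conj_eq_iff_re.mp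
  unfold complexKernel
  rw [map_mul, Complex.conj_ofReal, ← integral_conj, ← integral_neg_eq_self]
  congr 2
  funext ξ
  rw [map_mul, Complex.conj_ofReal, ← Complex.exp_conj, map_sub, map_mul, Complex.conj_ofReal,
    Complex.conj_ofReal, Complex.conj_I, norm_neg, inner_neg_left]
  push_cast
  ring_nf

/-- The heat semigroup: `S(t)φ(x,y) = ∫ K(x, w, y - z; t) φ(w, z) d(w, z)` for `t > 0`,
and `S(0)φ = φ`. -/
noncomputable def semigroup {N k : ℕ} (t : ℝ) (φ : Space N k → ℝ) : Space N k → ℝ :=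
  fun a => if 0 < t then ∫ b : Space N k, kernel a.1 b.1 (a.2 - b.2) t * φ b else φ a

/-- `g` is (a representative of) `S(t)φ`, `t > 0`: for almost every point the integral that
defines `S(t)φ` converges absolutely, and `g` is almost everywhere equal to it. -/
def IsSemigroupValue {N k : ℕ} (t : ℝ) (φ g : Space N k → ℝ) : Prop :=
  (∀ᵐ a : Space N k, Integrable fun b : Space N k => kernel a.1 b.1 (a.2 - b.2) t * φ b) ∧
    g =ᵐ[volume] semigroup t φ

/-- The nonlinearity `|φ|^{ρ-1} φ`. -/
noncomputable def nonlinearity {N k : ℕ} (ρ : ℝ) (φ : Space N k → ℝ) : Space N k → ℝ :=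
  fun a => |φ a| ^ (ρ - 1) * φ a

/-- `u : [0,T] → L^p` is an `L^p`-mild solution of `u_t = Δ_G u + |u|^{ρ-1} u`, `u(0) = u₀`:
it is continuous and
`u(t) = S(t) u₀ + ∫_0^t S(t-s) |u(s)|^{ρ-1} u(s) ds` for every `t ∈ [0,T]`,
where the integral is a (convergent) Bochner integral in `L^p`. Only the values of `u` on `[0,T]`
matter. -/
structure IsMildSolution {N k : ℕ} {p : ℝ≥0∞} [Fact (1 ≤ p)] (ρ T : ℝ)
    (u₀ : Lp ℝ p (volume : Measure (Space N k)))
    (u : ℝ → Lp ℝ p (volume : Measure (Space N k))) : Prop where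
  continuousOn : ContinuousOn u (Icc 0 T)
  duhamel : ∀ t ∈ Icc 0 T, ∃ G : ℝ → Lp ℝ p (volume : Measure (Space N k)),
    (∀ᵐ s : ℝ, s ∈ Ioo 0 t → IsSemigroupValue (t - s) (nonlinearity ρ (u s)) (G s)) ∧
    IntervalIntegrable G volume 0 t ∧
    u t =ᵐ[volume] fun a => semigroup t u₀ a + (∫ s in (0 : ℝ)..t, G s) a

/-- The exponent `α = (N + 2k)(ρ - 1) / (2ρp)`. -/
noncomputable def alpha (N k : ℕ) (ρ : ℝ) (p : ℝ≥0∞) : ℝ :=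
  ((N : ℝ) + 2 * k) * (ρ - 1) / (2 * ρ * p.toReal)

/-- `‖u‖_{X_α} = sup_{t ∈ (0,T]} t^α ‖u(t)‖_{L^{ρp}}`, with values in `[0,∞]`. -/
noncomputable def xNorm {N k : ℕ} {p : ℝ≥0∞} (ρ T : ℝ)
    (u : ℝ → Lp ℝ p (volume : Measure (Space N k))) : ℝ≥0∞ :=
  ⨆ t ∈ Ioc 0 T,
    ENNReal.ofReal (t ^ alpha N k ρ p) * eLpNorm (u t) (ENNReal.ofReal ρ * p) volume

/-- `u ∈ X_α`: `‖u‖_{X_α} < ∞` and `u` is continuous from `(0,T]` to `L^{ρp}`. -/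
structure MemX {N k : ℕ} {p : ℝ≥0∞} (ρ T : ℝ)
    (u : ℝ → Lp ℝ p (volume : Measure (Space N k))) : Prop where
  xNorm_lt_top : xNorm ρ T u < ∞
  continuous : ∀ t₀ ∈ Ioc 0 T,
    Tendsto (fun t => eLpNorm (u t - u t₀ : Lp ℝ p (volume : Measure (Space N k)))
      (ENNReal.ofReal ρ * p) volume) (𝓝[Ioc 0 T] t₀) (𝓝 0)

/-- `u` is an `L^p`-mild solution on `[0,T]` with datum `u₀`, in `C([0,T]; L^p) ∩ X_α`. -/
def IsSolution {N k : ℕ} {p : ℝ≥0∞} [Fact (1 ≤ p)] (ρ T : ℝ)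
    (u₀ : Lp ℝ p (volume : Measure (Space N k)))
    (u : ℝ → Lp ℝ p (volume : Measure (Space N k))) : Prop :=
  IsMildSolution ρ T u₀ u ∧ MemX ρ T u

end Grushin

/-! The theorem rests on two facts about `S(t)`: it is a strongly continuous semigroup of
contractions on `L^p`, and it maps `L^p` to `L^{ρp}` with norm at most `C t^{-α}`. After that the
argument is the classical fixed point scheme for a power nonlinearity, and `p > (N+2k)(ρ-1)/2` says
exactly that `αρ < 1`, so that the singularity `s^{-αρ}` of `|u(s)|^{ρ-1}u(s)` in `L^p` is
integrable.

The linear facts follow from three properties of the kernel: it is nonnegative, both of its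
marginals are `1`, and it is at most `A t^{-(N+2k)/2}`. Jensen's inequality then gives the
contraction, and interpolation with the pointwise bound gives `L^p → L^q`
(`Bistochastic.eLpNorm_le`). Nonnegativity is the delicate one. The kernel is the cosine transform
of a function of `|ξ|` whose exponent, by half-angle formulas (`mehler_exponent`), is a nonnegative
combination of `s coth s` and `s tanh s` with `s = t|ξ|/2`. Euler's product for `sinh` and the
partial fractions of `coth` and `tanh` exhibit this function as a limit of products of positive
definite functions: powers of `1/(1+|ξ|²/c)`, which are mixtures of Gaussians, and exponentials of
positive multiples of such functions. Positive definiteness is expressed as a multiplier property,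
`PosMult`, which is visibly stable under products and limits. The total mass is found by inserting a
Gaussian cutoff in `y`, exchanging integrals, integrating the Mehler factor explicitly in the space
variable and removing the cutoff. The same computation shows that the mass concentrates as `t → 0`.
Strong continuity follows on `C_c` from pointwise convergence and Scheffé's lemma, then on `L^p` by
density.

For the nonlinear part, `EvolutionSystem` isolates what is needed. Existence is a contraction in the
weighted space of curves in `L^{ρp}`, on a time that depends only on the size of the datum.
Lipschitz dependence on an arbitrary interval comes from the weight `e^{-λt}` with `λ` large
(`exists_lipschitz_Y`), in place of a singular Gronwall inequality. It gives (b) and, with equal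
data, uniqueness. For (a), uniqueness identifies every solution with the constructed one, whose
`X_α` norm is controlled, so (b) applies. -/

namespace Grushin

/-! ### Positive definite functions, as multipliers preserving nonnegative cosine transforms -/

section PositiveMultiplier

variable {V : Type*} [NormedAddCommGroup V] [InnerProductSpace ℝ V] [FiniteDimensional ℝ V]
  [MeasurableSpace V] [BorelSpace V]

/-- The cosine transform of `h` is nonnegative. -/
def CosPos (h : V → ℝ) : Prop := ∀ y, 0 ≤ ∫ ξ, h ξ * Real.cos (inner ℝ ξ y)

/-- Multiplication by `φ` preserves integrable functions with nonnegative cosine transform. -/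
structure PosMult (φ : V → ℝ) : Prop where
  measurable : Measurable φ
  bounded : ∃ C, ∀ ξ, |φ ξ| ≤ C
  pos : ∀ h : V → ℝ, Integrable h → CosPos h → CosPos fun ξ => φ ξ * h ξ

omit [FiniteDimensional ℝ V] [MeasurableSpace V] [BorelSpace V] in
theorem continuous_cos_inner (y : V) : Continuous fun ξ : V => Real.cos (inner ℝ ξ y) := by
  fun_prop

theorem integrable_mul_cos {h : V → ℝ} (hh : Integrable h) (y : V) :
    Integrable fun ξ => h ξ * Real.cos (inner ℝ ξ y) :=
  hh.mul_bdd (c := 1) (continuous_cos_inner y).aestronglyMeasurable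
    (ae_of_all _ fun ξ => by simpa using Real.abs_cos_le_one _)

theorem PosMult.integrable_mul {φ h : V → ℝ} (hφ : PosMult φ) (hh : Integrable h) :
    Integrable fun ξ => φ ξ * h ξ := by
  obtain ⟨C, hC⟩ := hφ.bounded
  exact hh.bdd_mul (c := C) hφ.measurable.aestronglyMeasurable
    (ae_of_all _ fun ξ => by simpa using hC ξ)

theorem PosMult.mul {φ ψ : V → ℝ} (hφ : PosMult φ) (hψ : PosMult ψ) :
    PosMult fun ξ => φ ξ * ψ ξ := by
  obtain ⟨C, hC⟩ := hφ.bounded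
  obtain ⟨D, hD⟩ := hψ.bounded
  refine ⟨hφ.measurable.mul hψ.measurable, ⟨C * D, fun ξ => ?_⟩, fun h hh hp => ?_⟩
  · rw [abs_mul]
    exact mul_le_mul (hC ξ) (hD ξ) (abs_nonneg _) ((abs_nonneg _).trans (hC ξ))
  · simpa only [mul_assoc] using hφ.pos _ (hψ.integrable_mul hh) (hψ.pos _ hh hp)

theorem PosMult.const {c : ℝ} (hc : 0 ≤ c) : PosMult fun _ : V => c := by
  refine ⟨measurable_const, ⟨|c|, fun _ => le_rfl⟩, fun h hh hp y => ?_⟩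
  simp only [mul_assoc, integral_const_mul]
  exact mul_nonneg hc (hp y)

theorem PosMult.add {φ ψ : V → ℝ} (hφ : PosMult φ) (hψ : PosMult ψ) :
    PosMult fun ξ => φ ξ + ψ ξ := by
  obtain ⟨C, hC⟩ := hφ.bounded
  obtain ⟨D, hD⟩ := hψ.bounded
  refine ⟨hφ.measurable.add hψ.measurable, ⟨C + D, fun ξ => ?_⟩, fun h hh hp y => ?_⟩
  · exact (abs_add_le _ _).trans (add_le_add (hC ξ) (hD ξ))
  · simp only [add_mul]
    rw [integral_add (integrable_mul_cos (hφ.integrable_mul hh) y)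
      (integrable_mul_cos (hψ.integrable_mul hh) y)]
    exact add_nonneg (hφ.pos h hh hp y) (hψ.pos h hh hp y)

theorem PosMult.prod {ι : Type*} (s : Finset ι) {φ : ι → V → ℝ} (h : ∀ i, PosMult (φ i)) :
    PosMult fun ξ => ∏ i ∈ s, φ i ξ := by
  classical
  induction s using Finset.induction_on with
  | empty => simpa using PosMult.const (V := V) zero_le_one
  | insert i s hi ih => simpa [Finset.prod_insert hi] using (h i).mul ih

theorem PosMult.pow {φ : V → ℝ} (h : PosMult φ) (n : ℕ) : PosMult fun ξ => φ ξ ^ n := by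
  simpa using PosMult.prod (Finset.range n) fun _ => h

theorem PosMult.sum {ι : Type*} (s : Finset ι) {φ : ι → V → ℝ} (h : ∀ i, PosMult (φ i)) :
    PosMult fun ξ => ∑ i ∈ s, φ i ξ := by
  classical
  induction s using Finset.induction_on with
  | empty => simpa using PosMult.const (V := V) le_rfl
  | insert i s hi ih => simpa [Finset.sum_insert hi] using (h i).add ih

/-- Dominated convergence with majorant `C |f|`. Convergence almost everywhere is all that can be
asked: the expansions used below fail at `ξ = 0`, where `0 / sinh 0` is `0`. -/
theorem PosMult.of_tendsto {φ : ℕ → V → ℝ} {ψ : V → ℝ} (h : ∀ n, PosMult (φ n)) {C : ℝ}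
    (hC : ∀ n ξ, |φ n ξ| ≤ C) (hψ : Measurable ψ) (hψC : ∃ D, ∀ ξ, |ψ ξ| ≤ D)
    (hlim : ∀ᵐ ξ, Tendsto (fun n => φ n ξ) atTop (𝓝 (ψ ξ))) : PosMult ψ := by
  refine ⟨hψ, hψC, fun f hf hp y => ?_⟩
  have : Tendsto (fun n => ∫ ξ, φ n ξ * f ξ * Real.cos (inner ℝ ξ y)) atTop
      (𝓝 (∫ ξ, ψ ξ * f ξ * Real.cos (inner ℝ ξ y))) := by
    refine tendsto_integral_of_dominated_convergence (fun ξ => C * |f ξ|)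
      (fun n => (integrable_mul_cos ((h n).integrable_mul hf) y).aestronglyMeasurable)
      (hf.abs.const_mul C) (fun n => ae_of_all _ fun ξ => ?_) ?_
    · rw [Real.norm_eq_abs, abs_mul, abs_mul, ← mul_one (C * |f ξ|)]
      have := hC n ξ
      gcongr
      · exact mul_nonneg ((abs_nonneg _).trans this) (abs_nonneg _)
      · exact Real.abs_cos_le_one _
    · filter_upwards [hlim] with ξ hξ
      exact (hξ.mul_const _).mul_const _
  exact ge_of_tendsto' this fun n => (h n).pos f hf hp y

/-- The power series of `exp` has nonnegative coefficients, and its partial sums are bounded by `exp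
C` when `|φ| ≤ C`. -/
theorem PosMult.exp {φ : V → ℝ} (h : PosMult φ) : PosMult fun ξ => Real.exp (φ ξ) := by
  obtain ⟨C, hC⟩ := h.bounded
  refine PosMult.of_tendsto (φ := fun n ξ => ∑ i ∈ Finset.range n, φ ξ ^ i * (1 / (i.factorial : ℝ)))
    (C := Real.exp C) (fun n => PosMult.sum _ fun i => (h.pow i).mul (PosMult.const (by positivity)))
    (fun n ξ => ?_) h.measurable.exp ⟨Real.exp C, fun ξ => ?_⟩ (ae_of_all _ fun ξ => ?_)
  · refine (Finset.abs_sum_le_sum_abs _ _).trans (le_trans ?_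
      (Real.sum_le_exp_of_nonneg ((abs_nonneg _).trans (hC ξ)) n))
    refine Finset.sum_le_sum fun i _ => ?_
    rw [abs_mul, abs_pow, abs_of_nonneg (by positivity : 0 ≤ 1 / (i.factorial : ℝ)), mul_one_div]
    gcongr
    exact hC ξ
  · rw [abs_of_nonneg (Real.exp_nonneg _)]
    exact Real.exp_le_exp.2 ((le_abs_self _).trans (hC ξ))
  · have := (NormedSpace.exp_series_hasSum_exp' (𝕂 := ℝ) (φ ξ)).tendsto_sum_nat
    rw [← Real.exp_eq_exp_ℝ] at this
    simpa [mul_comm] using this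

/-- By the product-to-sum formula, multiplying by this cosine averages the translates by `z` and
`-z` of the cosine transform. -/
theorem PosMult.cos (z : V) : PosMult fun ξ => Real.cos (inner ℝ ξ z) := by
  refine ⟨(continuous_cos_inner z).measurable, ⟨1, fun ξ => Real.abs_cos_le_one _⟩,
    fun h hh hp y => ?_⟩
  have : ∀ ξ, Real.cos (inner ℝ ξ z) * h ξ * Real.cos (inner ℝ ξ y) =
      (1 / 2) * (h ξ * Real.cos (inner ℝ ξ (y + z)) + h ξ * Real.cos (inner ℝ ξ (y - z))) := by
    intro ξ
    rw [inner_add_right, inner_sub_right, Real.cos_add, Real.cos_sub]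
    ring
  simp only [this]
  rw [integral_const_mul, integral_add (integrable_mul_cos hh _) (integrable_mul_cos hh _)]
  exact mul_nonneg (by norm_num) (add_nonneg (hp _) (hp _))

/-- Fubini: the cosine transform of the mixture is the `g`-weighted integral of nonnegative
transforms. -/
theorem PosMult.mixture {α : Type*} [MeasurableSpace α] {μ : Measure α} [SFinite μ] {g : α → ℝ}
    (hg : Measurable g) (hg0 : ∀ᵐ s ∂μ, 0 ≤ g s) (hgi : Integrable g μ) {φ : α → V → ℝ}
    (hφm : Measurable (Function.uncurry φ)) (hφ1 : ∀ s ξ, |φ s ξ| ≤ 1) (hφ : ∀ᵐ s ∂μ, PosMult (φ s)) :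
    PosMult fun ξ => ∫ s, g s * φ s ξ ∂μ := by
  have hm : Measurable fun x : V × α => g x.2 * φ x.2 x.1 :=
    (hg.comp measurable_snd).mul (hφm.comp (measurable_snd.prodMk measurable_fst))
  refine ⟨(hm.stronglyMeasurable.integral_prod_right (ν := μ)).measurable,
    ⟨∫ s, |g s| ∂μ, fun ξ => ?_⟩, fun h hh hp y => ?_⟩
  · rw [← Real.norm_eq_abs]
    refine norm_integral_le_of_norm_le hgi.abs (ae_of_all _ fun s => ?_)
    rw [Real.norm_eq_abs, abs_mul]
    exact mul_le_of_le_one_right (abs_nonneg _) (hφ1 s ξ)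
  · have hint : Integrable (Function.uncurry fun ξ s =>
        g s * (φ s ξ * h ξ * Real.cos (inner ℝ ξ y))) ((volume : Measure V).prod μ) := by
      have h1 : Integrable (fun x : V × α => (φ x.2 x.1 * Real.cos (inner ℝ x.1 y)) *
          (h x.1 * g x.2)) ((volume : Measure V).prod μ) := by
        refine (hh.mul_prod hgi).bdd_mul (c := 1) ?_ (ae_of_all _ fun x => ?_)
        · exact ((hφm.comp (measurable_snd.prodMk measurable_fst)).mul
            ((continuous_cos_inner y).measurable.comp measurable_fst)).aestronglyMeasurable
        · rw [Real.norm_eq_abs, abs_mul]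
          exact mul_le_one₀ (hφ1 _ _) (abs_nonneg _) (Real.abs_cos_le_one _)
      convert! h1 using 2 with x
      simp only [Function.uncurry]
      ring
    have : (∫ ξ, (∫ s, g s * φ s ξ ∂μ) * h ξ * Real.cos (inner ℝ ξ y)) =
        ∫ s, g s * (∫ ξ, φ s ξ * h ξ * Real.cos (inner ℝ ξ y)) ∂μ := by
      simp only [← integral_const_mul]
      rw [← integral_integral_swap hint]
      congr 1 with ξ
      rw [← integral_mul_const, ← integral_mul_const]
      congr 1 with s
      ring
    rw [this]
    refine integral_nonneg_of_ae ?_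
    filter_upwards [hg0, hφ] with s hs hs'
    exact mul_nonneg hs (hs'.pos h hh hp y)

theorem integral_exp_mul_cos {b : ℝ} (hb : 0 < b) (ξ : V) :
    ∫ v : V, Real.exp (-b * ‖v‖ ^ 2) * Real.cos (inner ℝ ξ v) =
      (Real.pi / b) ^ (Module.finrank ℝ V / 2 : ℝ) * Real.exp (-(‖ξ‖ ^ 2 / (4 * b))) := by
  have hb' : 0 < (b : ℂ).re := hb
  have h1 := GaussianFourier.integral_cexp_neg_mul_sq_norm_add hb' Complex.I ξ
  have h2 := GaussianFourier.integrable_cexp_neg_mul_sq_norm_add hb' Complex.I ξ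
  have h3 := congrArg Complex.re h1
  rw [← RCLike.re_eq_complex_re, ← integral_re h2] at h3
  convert h3 using 1
  · congr 1 with v
    rw [RCLike.re_eq_complex_re, Complex.exp_re]
    congr 1
    · congr 1; simp [← Complex.ofReal_pow]
    · congr 1; simp [← Complex.ofReal_pow]
  · have : ((Real.pi : ℂ) / b) ^ ((Module.finrank ℝ V : ℂ) / 2) *
        Complex.exp (Complex.I ^ 2 * (‖ξ‖ : ℂ) ^ 2 / (4 * (b : ℂ))) =
        (((Real.pi / b) ^ (Module.finrank ℝ V / 2 : ℝ) * Real.exp (-(‖ξ‖ ^ 2 / (4 * b))) : ℝ) : ℂ) := by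
      push_cast
      rw [Complex.ofReal_cpow (by positivity)]
      push_cast
      congr 2
      rw [Complex.I_sq]; ring
    rw [this, RCLike.re_eq_complex_re, Complex.ofReal_re]

theorem integrable_exp_neg_mul_sq_norm {b : ℝ} (hb : 0 < b) :
    Integrable fun v : V => Real.exp (-b * ‖v‖ ^ 2) := by
  have := (GaussianFourier.integrable_cexp_neg_mul_sq_norm_add (V := V)
    (show 0 < (b : ℂ).re from hb) 0 0).norm
  refine this.congr (ae_of_all _ fun v => ?_)
  simp [Complex.norm_exp, ← Complex.ofReal_pow]

theorem PosMult.gaussian {s : ℝ} (hs : 0 < s) : PosMult fun ξ : V => Real.exp (-s * ‖ξ‖ ^ 2) := by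
  -- The dual Gaussian: the cosine transform of `exp (-‖v‖² / (4s))` is a multiple of `exp (-s
  -- ‖ξ‖²)`, so the latter is a mixture of cosines.
  have hb : 0 < 1 / (4 * s) := by positivity
  have h := PosMult.mixture (V := V) (μ := (volume : Measure V))
    (g := fun v : V => Real.exp (-(1 / (4 * s)) * ‖v‖ ^ 2)) (by fun_prop)
    (ae_of_all _ fun v => (Real.exp_pos _).le) (integrable_exp_neg_mul_sq_norm hb)
    (φ := fun v ξ => Real.cos (inner ℝ ξ v))
    (by unfold Function.uncurry; fun_prop)
    (fun s ξ => Real.abs_cos_le_one _) (ae_of_all _ fun v => PosMult.cos v)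
  have hc : 0 < (Real.pi / (1 / (4 * s))) ^ (Module.finrank ℝ V / 2 : ℝ) := by positivity
  have h2 := (PosMult.const (V := V) (inv_nonneg.2 hc.le)).mul h
  convert h2 using 2 with ξ
  rw [integral_exp_mul_cos hb, inv_mul_cancel_left₀ hc.ne']
  congr 1
  field_simp

/-- The Gamma integral writes `(1 + a)^{-β}` as `Γ(β)⁻¹ ∫ s^{β-1} e^{-s} e^{-sa} ds`. With `a =
‖ξ‖²/c` this is a mixture of Gaussians. -/
theorem PosMult.rational {c β : ℝ} (hc : 0 < c) (hβ : 0 < β) :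
    PosMult fun ξ : V => (1 / (1 + ‖ξ‖ ^ 2 / c)) ^ β := by
  have hgi : IntegrableOn (fun s : ℝ => s ^ (β - 1) * Real.exp (-(1 * s))) (Ioi 0) := by
    have := Real.GammaIntegral_convergent hβ
    simpa [mul_comm] using this
  have h := PosMult.mixture (V := V) (μ := volume.restrict (Ioi (0 : ℝ)))
    (g := fun s : ℝ => s ^ (β - 1) * Real.exp (-(1 * s))) (by fun_prop)
    ((ae_restrict_iff' measurableSet_Ioi).2 (ae_of_all _ fun s (hs : 0 < s) => by positivity))
    -- The absolute value changes nothing on `(0,∞)`; it makes the bound by `1` hold for every real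
    -- `s`, as `PosMult.mixture` demands.
    hgi (φ := fun s ξ => Real.exp (-(|s| / c) * ‖ξ‖ ^ 2))
    (by unfold Function.uncurry; fun_prop)
    (fun s ξ => by
      rw [abs_of_nonneg (Real.exp_nonneg _), Real.exp_le_one_iff, neg_mul, Left.neg_nonpos_iff]
      positivity)
    ((ae_restrict_iff' measurableSet_Ioi).2 (ae_of_all _ fun s (hs : 0 < s) =>
      PosMult.gaussian (by positivity)))
  have hG := Real.Gamma_pos_of_pos hβ
  have h2 := (PosMult.const (V := V) (inv_nonneg.2 hG.le)).mul h
  convert h2 using 2 with ξ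
  rw [eq_inv_mul_iff_mul_eq₀ hG.ne', mul_comm, ← Real.integral_rpow_mul_exp_neg_mul_Ioi hβ
    (by positivity : 0 < 1 + ‖ξ‖ ^ 2 / c)]
  refine setIntegral_congr_fun measurableSet_Ioi fun s (hs : 0 < s) => ?_
  simp only [mul_assoc, ← Real.exp_add]
  rw [abs_of_pos hs]
  ring_nf

end PositiveMultiplier

/-! ### Euler's product for `sinh` and the partial fractions of `coth` and `tanh` -/

section PartialFractions

/-- Euler's product for the sine at the imaginary point `iz/π`. -/
theorem tendsto_prod_sinh (z : ℝ) :
    Tendsto (fun n : ℕ => z * ∏ j ∈ Finset.range n, (1 + z ^ 2 / (Real.pi ^ 2 * ((j : ℝ) + 1) ^ 2)))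
      atTop (𝓝 (Real.sinh z)) := by
  have hpi : (Real.pi : ℂ) ≠ 0 := by exact_mod_cast Real.pi_ne_zero
  have h := (Complex.continuous_im.tendsto _).comp
    (Complex.tendsto_euler_sin_prod (z / Real.pi * Complex.I))
  have e1 : (Real.pi : ℂ) * (z / Real.pi * Complex.I) = z * Complex.I := by field_simp
  rw [e1, Complex.sin_mul_I, Complex.mul_I_im, ← Complex.ofReal_sinh, Complex.ofReal_re] at h
  refine h.congr fun n => ?_
  have : ∀ j : ℕ, (1 : ℂ) - (z / Real.pi * Complex.I) ^ 2 / ((j : ℂ) + 1) ^ 2 =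
      ((1 + z ^ 2 / (Real.pi ^ 2 * ((j : ℝ) + 1) ^ 2) : ℝ) : ℂ) := by
    intro j
    push_cast
    rw [mul_pow, Complex.I_sq, div_pow, mul_neg_one, neg_div, sub_neg_eq_add, div_div]
  simp only [Function.comp, this]
  rw [← Complex.ofReal_prod, mul_right_comm, Complex.mul_I_im, ← Complex.ofReal_mul,
    Complex.ofReal_re]

/-- The Mittag-Leffler expansion of `π cot(πx)`, multiplied by `x`, at `x = iz/π`. This point is not
an integer because its imaginary part is positive. -/
theorem tendsto_sum_coth {z : ℝ} (hz : 0 < z) :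
    Tendsto (fun n : ℕ => ∑ j ∈ Finset.range n, 2 * z ^ 2 / (z ^ 2 + Real.pi ^ 2 * ((j : ℝ) + 1) ^ 2))
      atTop (𝓝 (z * Real.cosh z / Real.sinh z - 1)) := by
  have hpi : (Real.pi : ℂ) ≠ 0 := by exact_mod_cast Real.pi_ne_zero
  have hz' : (z : ℂ) ≠ 0 := by exact_mod_cast hz.ne'
  have hs : (Real.sinh z : ℂ) ≠ 0 := by exact_mod_cast (Real.sinh_pos_iff.2 hz).ne'
  have hmem : (((z / Real.pi : ℝ) : ℂ) * Complex.I : ℂ) ∈ Complex.integerComplement := by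
    rintro ⟨n, hn⟩
    have := congrArg Complex.im hn
    rw [Complex.mul_I_im, Complex.ofReal_re, Complex.intCast_im] at this
    have h2 : 0 < z / Real.pi := by positivity
    exact h2.ne this
  have h := (Complex.continuous_re.tendsto _).comp
    ((tendsto_logDeriv_euler_cot_sub hmem).const_mul (((z / Real.pi : ℝ) : ℂ) * Complex.I))
  have e1 : (Real.pi : ℂ) * (((z / Real.pi : ℝ) : ℂ) * Complex.I) = z * Complex.I := by
    push_cast; field_simp
  have e2 : (((z / Real.pi : ℝ) : ℂ) * Complex.I : ℂ) * (Real.pi * Complex.cot (Real.pi *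
      (((z / Real.pi : ℝ) : ℂ) * Complex.I)) - 1 / (((z / Real.pi : ℝ) : ℂ) * Complex.I)) =
      ((z * Real.cosh z / Real.sinh z - 1 : ℝ) : ℂ) := by
    rw [e1, Complex.cot, Complex.cos_mul_I, Complex.sin_mul_I, ← Complex.ofReal_sinh,
      ← Complex.ofReal_cosh]
    push_cast at hs ⊢
    field_simp
  rw [e2, Complex.ofReal_re] at h
  refine h.congr fun n => ?_
  have : ∀ j : ℕ, (((z / Real.pi : ℝ) : ℂ) * Complex.I : ℂ) *
      (1 / (((z / Real.pi : ℝ) : ℂ) * Complex.I - (j + 1)) + 1 / (((z / Real.pi : ℝ) : ℂ) * Complex.I + (j + 1))) =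
      ((2 * z ^ 2 / (z ^ 2 + Real.pi ^ 2 * ((j : ℝ) + 1) ^ 2) : ℝ) : ℂ) := by
    intro j
    have hj : (0 : ℝ) < z ^ 2 + Real.pi ^ 2 * ((j : ℝ) + 1) ^ 2 := by positivity
    have h1 : (((z / Real.pi : ℝ) : ℂ) * Complex.I : ℂ) - (j + 1) ≠ 0 := by
      intro h0
      apply hmem
      exact ⟨j + 1, by rw [Int.cast_add, Int.cast_natCast, Int.cast_one]; exact (sub_eq_zero.1 h0).symm⟩
    have h2 : (((z / Real.pi : ℝ) : ℂ) * Complex.I : ℂ) + (j + 1) ≠ 0 := by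
      intro h0
      apply hmem
      exact ⟨-(j + 1), by rw [Int.cast_neg, Int.cast_add, Int.cast_natCast, Int.cast_one]; exact (eq_neg_of_add_eq_zero_left h0).symm⟩
    have hj' : ((z ^ 2 + Real.pi ^ 2 * ((j : ℝ) + 1) ^ 2 : ℝ) : ℂ) ≠ 0 := by exact_mod_cast hj.ne'
    have hsq : (((z / Real.pi : ℝ) : ℂ) * Complex.I) ^ 2 = -(z ^ 2 / Real.pi ^ 2) := by
      rw [mul_pow, Complex.I_sq]; push_cast; ring
    generalize ((z / Real.pi : ℝ) : ℂ) * Complex.I = x at *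
    have h3 : x * (1 / (x - (j + 1)) + 1 / (x + (j + 1))) = 2 * x ^ 2 / (x ^ 2 - (j + 1) ^ 2) := by
      have : x ^ 2 - ((j : ℂ) + 1) ^ 2 = (x - (j + 1)) * (x + (j + 1)) := by ring
      rw [this]
      field_simp
      ring
    rw [h3, hsq]
    push_cast at hj' ⊢
    have h4 : -((z : ℂ) ^ 2 / (Real.pi : ℂ) ^ 2) - ((j : ℂ) + 1) ^ 2 =
        -(z ^ 2 + Real.pi ^ 2 * ((j : ℂ) + 1) ^ 2) / Real.pi ^ 2 := by
      field_simp; ring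
    rw [h4]
    field_simp
  simp only [Function.comp, Finset.mul_sum]
  rw [Complex.re_sum]
  refine Finset.sum_congr rfl fun j _ => ?_
  rw [this, Complex.ofReal_re]

/-- From `z tanh z = 2z coth 2z - z coth z`: among the first `2n` terms of the series at `2z`, every
second one is a term of the series at `z`, and the remaining `n` are the terms claimed. -/
theorem tendsto_sum_tanh {z : ℝ} (hz : 0 < z) :
    Tendsto (fun n : ℕ => ∑ j ∈ Finset.range n,
      2 * z ^ 2 / (z ^ 2 + Real.pi ^ 2 * (2 * (j : ℝ) + 1) ^ 2 / 4))
      atTop (𝓝 (z * Real.sinh z / Real.cosh z)) := by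
  have h := ((tendsto_sum_coth (by positivity : 0 < 2 * z)).comp
    (tendsto_id.const_mul_atTop' (zero_lt_two : (0 : ℕ) < 2))).sub (tendsto_sum_coth hz)
  have hs := (Real.sinh_pos_iff.2 hz).ne'
  have hc := (Real.cosh_pos z).ne'
  have e : 2 * z * Real.cosh (2 * z) / Real.sinh (2 * z) - 1 - (z * Real.cosh z / Real.sinh z - 1) =
      z * Real.sinh z / Real.cosh z := by
    rw [Real.cosh_two_mul, Real.sinh_two_mul]
    field_simp
    ring
  rw [e] at h
  refine h.congr fun n => ?_
  simp only [Function.comp, id]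
  induction n with
  | zero => simp
  | succ n ih =>
    rw [Finset.sum_range_succ _ n, Finset.sum_range_succ _ n, ← ih,
      show 2 * (n + 1) = 2 * n + 1 + 1 by ring, Finset.sum_range_succ, Finset.sum_range_succ]
    have h1 : (0 : ℝ) < z ^ 2 + Real.pi ^ 2 * ((n : ℝ) + 1) ^ 2 := by positivity
    have h2 : (0 : ℝ) < z ^ 2 + Real.pi ^ 2 * (2 * (n : ℝ) + 1) ^ 2 / 4 := by positivity
    have e1 : 2 * (2 * z) ^ 2 / ((2 * z) ^ 2 + Real.pi ^ 2 * (((2 * n + 1 : ℕ) : ℝ) + 1) ^ 2) =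
        2 * z ^ 2 / (z ^ 2 + Real.pi ^ 2 * ((n : ℝ) + 1) ^ 2) := by
      rw [div_eq_div_iff (by positivity) h1.ne']
      push_cast; ring
    have e2 : 2 * (2 * z) ^ 2 / ((2 * z) ^ 2 + Real.pi ^ 2 * (((2 * n : ℕ) : ℝ) + 1) ^ 2) =
        2 * z ^ 2 / (z ^ 2 + Real.pi ^ 2 * (2 * (n : ℝ) + 1) ^ 2 / 4) := by
      rw [div_eq_div_iff (by positivity) h2.ne']
      push_cast; ring
    rw [e1, e2]
    ring

end PartialFractions

/-! ### Positive definiteness of the hyperbolic factors -/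

section HyperbolicMultiplier

variable {V : Type*} [NormedAddCommGroup V] [InnerProductSpace ℝ V] [FiniteDimensional ℝ V]
  [MeasurableSpace V] [BorelSpace V]

/-- Since `2s²/(s²+c) = 2 - 2/(1+s²/c)`, the function is `e^{-2b}` times the exponential of a
nonnegative multiple of a positive definite function. The minus sign in the exponent is absorbed in
the constant. -/
theorem PosMult.exp_neg_ratio {b τ c : ℝ} (hb : 0 ≤ b) (hτ : 0 < τ) (hc : 0 < c) :
    PosMult fun ξ : V => Real.exp (-b * (2 * (τ * ‖ξ‖) ^ 2 / ((τ * ‖ξ‖) ^ 2 + c))) := by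
  have h := ((PosMult.const (V := V) (by positivity : 0 ≤ 2 * b)).mul
    (PosMult.rational (V := V) (c := c / τ ^ 2) (β := 1) (by positivity) one_pos)).exp
  have h2 := (PosMult.const (V := V) (Real.exp_pos (-(2 * b))).le).mul h
  convert h2 using 2 with ξ
  rw [← Real.exp_add, Real.rpow_one]
  congr 1
  have : 0 < (τ * ‖ξ‖) ^ 2 + c := by positivity
  have : 0 < c + τ ^ 2 * ‖ξ‖ ^ 2 := by positivity
  field_simp
  ring

/-- Exponentiating the partial fraction series gives an infinite product of the functions of
`PosMult.exp_neg_ratio`; `a` is the constant term, `1` for `coth` and `0` for `tanh`. The expansion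
may fail at `ξ = 0`, a null set because `V` is nontrivial. -/
theorem PosMult.exp_neg_tsum {b τ a : ℝ} (hb : 0 ≤ b) (hτ : 0 < τ) {c : ℕ → ℝ} (hc : ∀ n, 0 < c n)
    {F : ℝ → ℝ} (hF : Measurable F) (hF0 : ∀ z, 0 ≤ z → 0 ≤ F z) [Nontrivial V]
    (hlim : ∀ z, 0 < z → Tendsto (fun n : ℕ => ∑ j ∈ Finset.range n,
      2 * z ^ 2 / (z ^ 2 + c j)) atTop (𝓝 (F z - a))) :
    PosMult fun ξ : V => Real.exp (-b * F (τ * ‖ξ‖)) := by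
  have hpos : ∀ (n : ℕ) (z : ℝ), 0 ≤ ∑ j ∈ Finset.range n, 2 * z ^ 2 / (z ^ 2 + c j) :=
    fun n z => Finset.sum_nonneg fun j _ => div_nonneg (by positivity)
      (add_nonneg (sq_nonneg _) (hc j).le)
  refine PosMult.of_tendsto (φ := fun n ξ => Real.exp (-b * a) * ∏ j ∈ Finset.range n,
      Real.exp (-b * (2 * (τ * ‖ξ‖) ^ 2 / ((τ * ‖ξ‖) ^ 2 + c j)))) (C := Real.exp (-b * a))
    (fun n => (PosMult.const (Real.exp_pos _).le).mul (PosMult.prod _ fun j =>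
      PosMult.exp_neg_ratio hb hτ (hc j))) (fun n ξ => ?_)
    (Real.measurable_exp.comp ((hF.comp (measurable_norm.const_mul τ)).const_mul _))
    ⟨1, fun ξ => ?_⟩ ?_
  · rw [← Real.exp_sum, ← Finset.mul_sum, abs_of_nonneg (by positivity)]
    refine mul_le_of_le_one_right (Real.exp_pos _).le (Real.exp_le_one_iff.2 ?_)
    nlinarith [hpos n (τ * ‖ξ‖)]
  · rw [abs_of_nonneg (Real.exp_pos _).le, Real.exp_le_one_iff]
    nlinarith [hF0 (τ * ‖ξ‖) (by positivity)]
  · filter_upwards [Measure.ae_ne volume (0 : V)] with ξ hξ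
    have hz : 0 < τ * ‖ξ‖ := mul_pos hτ (norm_pos_iff.2 hξ)
    have h1 := (Real.continuous_exp.tendsto _).comp (((hlim _ hz).const_mul (-b)).const_add (-b * a))
    rw [show -b * a + -b * (F (τ * ‖ξ‖) - a) = -b * F (τ * ‖ξ‖) by ring] at h1
    refine h1.congr fun n => ?_
    simp only [Function.comp]
    rw [← Real.exp_sum, ← Finset.mul_sum, ← Real.exp_add]

theorem mul_sinh_nonneg (z : ℝ) : 0 ≤ z * Real.sinh z := by
  rcases le_total 0 z with h | h
  · exact mul_nonneg h (Real.sinh_nonneg_iff.2 h)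
  · exact mul_nonneg_of_nonpos_of_nonpos h (Real.sinh_nonpos_iff.2 h)

theorem PosMult.exp_neg_coth [Nontrivial V] {b τ : ℝ} (hb : 0 ≤ b) (hτ : 0 < τ) :
    PosMult fun ξ : V => Real.exp (-b * (τ * ‖ξ‖ * Real.cosh (τ * ‖ξ‖) / Real.sinh (τ * ‖ξ‖))) :=
  PosMult.exp_neg_tsum (F := fun z => z * Real.cosh z / Real.sinh z) (a := 1)
    (c := fun j => Real.pi ^ 2 * ((j : ℝ) + 1) ^ 2) hb hτ
    (fun n => by positivity) (by fun_prop)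
    (fun z hz => div_nonneg (mul_nonneg hz (Real.cosh_pos _).le) (Real.sinh_nonneg_iff.2 hz))
    fun z hz => tendsto_sum_coth hz

theorem PosMult.exp_neg_tanh [Nontrivial V] {b τ : ℝ} (hb : 0 ≤ b) (hτ : 0 < τ) :
    PosMult fun ξ : V => Real.exp (-b * (τ * ‖ξ‖ * Real.sinh (τ * ‖ξ‖) / Real.cosh (τ * ‖ξ‖))) :=
  PosMult.exp_neg_tsum (F := fun z => z * Real.sinh z / Real.cosh z) (a := 0)
    (c := fun j => Real.pi ^ 2 * (2 * (j : ℝ) + 1) ^ 2 / 4) hb hτ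
    (fun n => by positivity) (by fun_prop)
    (fun z _ => div_nonneg (mul_sinh_nonneg z) (Real.cosh_pos _).le)
    fun z hz => by simpa using tendsto_sum_tanh hz

/-- Double angle formula, with `sinh (z/2) ≥ z/2` and `cosh (z/2) ≥ exp (z/2) / 2`. It retains both
the linear behaviour at `0` and some exponential growth. -/
theorem exp_half_le_sinh {z : ℝ} (hz : 0 ≤ z) : z * Real.exp (z / 2) / 2 ≤ Real.sinh z := by
  have h1 : z / 2 ≤ Real.sinh (z / 2) := Real.self_le_sinh_iff.2 (by positivity)
  have h2 : Real.exp (z / 2) / 2 ≤ Real.cosh (z / 2) := by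
    rw [Real.cosh_eq]; linarith [Real.exp_pos (-(z / 2))]
  have h3 : Real.sinh z = 2 * Real.sinh (z / 2) * Real.cosh (z / 2) := by
    rw [← Real.sinh_two_mul]; ring_nf
  have h4 : z / 2 * (Real.exp (z / 2) / 2) ≤ Real.sinh (z / 2) * Real.cosh (z / 2) :=
    mul_le_mul h1 h2 (by positivity) ((by positivity : 0 ≤ z / 2).trans h1)
  rw [h3]; linarith

theorem div_sinh_le_one {z : ℝ} (hz : 0 ≤ z) : z / Real.sinh z ≤ 1 :=
  div_le_one_of_le₀ (Real.self_le_sinh_iff.2 hz) (Real.sinh_nonneg_iff.2 hz)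

theorem div_sinh_nonneg {z : ℝ} (hz : 0 ≤ z) : 0 ≤ z / Real.sinh z :=
  div_nonneg hz (Real.sinh_nonneg_iff.2 hz)

/-- Euler's product raised to the power `-β`: each factor is a function of `PosMult.rational`. -/
theorem PosMult.div_sinh [Nontrivial V] {β τ : ℝ} (hβ : 0 < β) (hτ : 0 < τ) :
    PosMult fun ξ : V => (τ * ‖ξ‖ / Real.sinh (τ * ‖ξ‖)) ^ β := by
  refine PosMult.of_tendsto (φ := fun n ξ => ∏ j ∈ Finset.range n,
      (1 / (1 + ‖ξ‖ ^ 2 / (Real.pi ^ 2 * ((j : ℝ) + 1) ^ 2 / τ ^ 2))) ^ β) (C := 1)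
    (fun n => PosMult.prod _ fun j => PosMult.rational (by positivity) hβ) (fun n ξ => ?_)
    (by fun_prop) ⟨1, fun ξ => ?_⟩ ?_
  · rw [Finset.abs_prod]
    refine Finset.prod_le_one (fun j _ => abs_nonneg _) fun j _ => ?_
    rw [abs_of_nonneg (by positivity)]
    refine Real.rpow_le_one (by positivity) ?_ hβ.le
    refine div_le_one_of_le₀ ?_ (by positivity)
    have : 0 ≤ ‖ξ‖ ^ 2 / (Real.pi ^ 2 * ((j : ℝ) + 1) ^ 2 / τ ^ 2) := by positivity
    linarith
  · have h0 : 0 ≤ τ * ‖ξ‖ := by positivity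
    rw [abs_of_nonneg (Real.rpow_nonneg (div_sinh_nonneg h0) _)]
    exact Real.rpow_le_one (div_sinh_nonneg h0) (div_sinh_le_one h0) hβ.le
  · filter_upwards [Measure.ae_ne volume (0 : V)] with ξ hξ
    have hz : 0 < τ * ‖ξ‖ := mul_pos hτ (norm_pos_iff.2 hξ)
    have h1 := (tendsto_const_nhds (x := τ * ‖ξ‖)).div (tendsto_prod_sinh (τ * ‖ξ‖))
      (Real.sinh_pos_iff.2 hz).ne'
    have h2 := h1.rpow_const (p := β) (Or.inr hβ.le)
    refine h2.congr fun n => ?_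
    rw [Real.finsetProd_rpow _ _ fun j _ => by positivity, Pi.div_apply]
    congr 1
    rw [div_mul_eq_div_div, div_self hz.ne', one_div, ← Finset.prod_inv_distrib]
    refine Finset.prod_congr rfl fun j _ => ?_
    rw [one_div, mul_pow]
    congr 2
    have : (0 : ℝ) < (j : ℝ) + 1 := by positivity
    field_simp

end HyperbolicMultiplier

/-! ### Integrability of `exp (-a ‖v‖)` -/

section ExponentialDecay

variable {V : Type*} [NormedAddCommGroup V] [InnerProductSpace ℝ V] [FiniteDimensional ℝ V]
  [MeasurableSpace V] [BorelSpace V]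

theorem integrable_exp_neg_mul_norm {a : ℝ} (ha : 0 < a) :
    Integrable fun v : V => Real.exp (-(a * ‖v‖)) := by
  set n : ℕ := Module.finrank ℝ V + 1
  have h := integrable_one_add_norm (E := V) (μ := volume) (r := n) (by simp [n])
  refine (h.const_mul (Real.exp a * n.factorial / a ^ n)).mono' (by fun_prop)
    (ae_of_all _ fun v => ?_)
  have h1 := Real.pow_div_factorial_le_exp (a * (1 + ‖v‖)) (by positivity) n
  have h2 : 0 < 1 + ‖v‖ := by positivity
  rw [Real.norm_eq_abs, abs_of_nonneg (Real.exp_pos _).le, Real.rpow_neg h2.le, Real.rpow_natCast,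
    Real.exp_neg, inv_le_comm₀ (Real.exp_pos _) (by positivity)]
  rw [mul_add, mul_one, Real.exp_add, div_le_iff₀ (by positivity)] at h1
  rw [mul_inv, inv_inv, inv_div, div_mul_eq_mul_div, div_le_iff₀ (by positivity)]
  rw [← mul_pow, mul_add, mul_one]
  linarith

end ExponentialDecay

/-! ### The Mehler factor: half-angle form, bounds and integral -/

section Mehler

variable {N : ℕ}

/-- The factor of the integrand of the kernel that depends on `ξ` only through `l = |ξ|`. -/
noncomputable def mehler (x w : EuclideanSpace ℝ (Fin N)) (t l : ℝ) : ℝ :=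
  (l / Real.sinh (l * t)) ^ ((N : ℝ) / 2) *
    Real.exp (-(l / 2 * ((‖x‖ ^ 2 + ‖w‖ ^ 2) * (Real.cosh (l * t) / Real.sinh (l * t)) -
      2 * inner ℝ x w * (1 / Real.sinh (l * t)))))

theorem mehler_symm (x w : EuclideanSpace ℝ (Fin N)) (t l : ℝ) : mehler x w t l = mehler w x t l := by
  unfold mehler
  rw [real_inner_comm, add_comm (‖x‖ ^ 2)]

theorem measurable_mehler : Measurable fun q : EuclideanSpace ℝ (Fin N) × EuclideanSpace ℝ (Fin N) × ℝ × ℝ =>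
    mehler q.1 q.2.1 q.2.2.1 q.2.2.2 := by
  unfold mehler
  fun_prop

/-- `z coth z - 1` is a limit of sums of nonnegative terms. -/
theorem sinh_le_mul_cosh {z : ℝ} (hz : 0 < z) : Real.sinh z ≤ z * Real.cosh z := by
  have h := ge_of_tendsto' (tendsto_sum_coth hz) (b := 0) fun n => Finset.sum_nonneg fun j _ => by positivity
  rwa [sub_nonneg, one_le_div (Real.sinh_pos_iff.2 hz)] at h

/-- With `s = tl/2`, `coth 2s` and `csch 2s` are half the sum and half the difference of `coth s`
and `tanh s`. This removes the term in `x·w`, which has no sign, and leaves two nonnegative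
coefficients; positive definiteness and the upper bounds below depend on it. -/
theorem mehler_exponent (x w : EuclideanSpace ℝ (Fin N)) {t l : ℝ} (hl : 0 < l) (ht : 0 < t) :
    l / 2 * ((‖x‖ ^ 2 + ‖w‖ ^ 2) * (Real.cosh (l * t) / Real.sinh (l * t)) -
      2 * inner ℝ x w * (1 / Real.sinh (l * t))) =
    ‖x - w‖ ^ 2 / (2 * t) * (t / 2 * l * Real.cosh (t / 2 * l) / Real.sinh (t / 2 * l)) +
    ‖x + w‖ ^ 2 / (2 * t) * (t / 2 * l * Real.sinh (t / 2 * l) / Real.cosh (t / 2 * l)) := by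
  have e : l * t = 2 * (t / 2 * l) := by ring
  rw [e, Real.sinh_two_mul, Real.cosh_two_mul, norm_sub_sq_real, norm_add_sq_real]
  set s := t / 2 * l
  have hs : 0 < s := by positivity
  have h1 : 0 < Real.sinh s := Real.sinh_pos_iff.2 hs
  have h2 := Real.cosh_pos s
  have h3 := Real.cosh_sq s
  have hls : l = 2 * s / t := by simp only [s]; field_simp
  rw [hls]
  field_simp
  linear_combination (2 * inner ℝ x w) * h3

theorem mehler_nonneg (x w : EuclideanSpace ℝ (Fin N)) {t l : ℝ} (hl : 0 ≤ l) (ht : 0 < t) :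
    0 ≤ mehler x w t l :=
  mul_nonneg (Real.rpow_nonneg (div_nonneg hl (Real.sinh_nonneg_iff.2 (by positivity))) _)
    (Real.exp_pos _).le

/-- The bound is the limit `l → 0`, which is the Euclidean heat kernel up to a constant. It uses `l
/ sinh (lt) ≤ 1/t` and `s coth s ≥ 1`, and drops the `tanh` term. -/
theorem mehler_le_heat (hN : 1 ≤ N) (x w : EuclideanSpace ℝ (Fin N)) {t l : ℝ} (hl : 0 ≤ l) (ht : 0 < t) :
    mehler x w t l ≤ t⁻¹ ^ ((N : ℝ) / 2) * Real.exp (-(‖x - w‖ ^ 2 / (2 * t))) := by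
  have hN' : (0 : ℝ) < N / 2 := by have : (0 : ℝ) < N := by exact_mod_cast hN
                                   positivity
  -- At `l = 0` the quotient `l / sinh (lt)` is `0 / 0 = 0`, so `mehler` is `0` there and not its
  -- limit.
  rcases hl.eq_or_lt with rfl | hl
  · unfold mehler
    simp only [zero_mul, Real.sinh_zero, div_zero]
    rw [Real.zero_rpow hN'.ne', zero_mul]
    positivity
  · unfold mehler
    rw [mehler_exponent x w hl ht]
    have hs : 0 < t / 2 * l := by positivity
    have h0 : 0 < Real.sinh (l * t) := Real.sinh_pos_iff.2 (by positivity)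
    have hb : l / Real.sinh (l * t) ≤ t⁻¹ := by
      rw [div_le_iff₀ h0, inv_mul_eq_div, le_div_iff₀ ht]
      exact Real.self_le_sinh_iff.2 (by positivity)
    have h1 : 1 ≤ t / 2 * l * Real.cosh (t / 2 * l) / Real.sinh (t / 2 * l) := by
      rw [one_le_div (Real.sinh_pos_iff.2 hs)]
      exact sinh_le_mul_cosh hs
    have h2 : 0 ≤ t / 2 * l * Real.sinh (t / 2 * l) / Real.cosh (t / 2 * l) :=
      div_nonneg (mul_sinh_nonneg _) (Real.cosh_pos _).le
    have h3 : ‖x - w‖ ^ 2 / (2 * t) * 1 ≤ ‖x - w‖ ^ 2 / (2 * t) *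
        (t / 2 * l * Real.cosh (t / 2 * l) / Real.sinh (t / 2 * l)) := by gcongr
    have h4 : 0 ≤ ‖x + w‖ ^ 2 / (2 * t) *
      (t / 2 * l * Real.sinh (t / 2 * l) / Real.cosh (t / 2 * l)) := by positivity
    gcongr
    linarith

/-- Here the exponential factor is bounded by `1` and the decay in `l` comes from `sinh` alone. The
bound is uniform in `x` and `w`. -/
theorem mehler_le_exp (hN : 1 ≤ N) (x w : EuclideanSpace ℝ (Fin N)) {t l : ℝ} (hl : 0 ≤ l) (ht : 0 < t) :
    mehler x w t l ≤ (2 / t) ^ ((N : ℝ) / 2) * Real.exp (-((N : ℝ) / 4 * t * l)) := by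
  have hN' : (0 : ℝ) < N / 2 := by have : (0 : ℝ) < N := by exact_mod_cast hN
                                   positivity
  rcases hl.eq_or_lt with rfl | hl
  · unfold mehler
    simp only [zero_mul, Real.sinh_zero, div_zero]
    rw [Real.zero_rpow hN'.ne', zero_mul]
    positivity
  · unfold mehler
    rw [mehler_exponent x w hl ht]
    have hs : 0 < t / 2 * l := by positivity
    have h0 : 0 < Real.sinh (l * t) := Real.sinh_pos_iff.2 (by positivity)
    have h1 : 0 ≤ t / 2 * l * Real.cosh (t / 2 * l) / Real.sinh (t / 2 * l) :=
      div_nonneg (mul_nonneg hs.le (Real.cosh_pos _).le) (Real.sinh_pos_iff.2 hs).le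
    have h2 : 0 ≤ t / 2 * l * Real.sinh (t / 2 * l) / Real.cosh (t / 2 * l) :=
      div_nonneg (mul_sinh_nonneg _) (Real.cosh_pos _).le
    have hb : l / Real.sinh (l * t) ≤ 2 / t * Real.exp (-(l * t / 2)) := by
      rw [div_le_iff₀ h0, Real.exp_neg]
      have := exp_half_le_sinh (by positivity : 0 ≤ l * t)
      calc l = 2 / t * (Real.exp (l * t / 2))⁻¹ * (l * t * Real.exp (l * t / 2) / 2) := by
            field_simp
        _ ≤ _ := by gcongr
    calc (l / Real.sinh (l * t)) ^ ((N : ℝ) / 2) * Real.exp _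
        ≤ (2 / t * Real.exp (-(l * t / 2))) ^ ((N : ℝ) / 2) * 1 := by
          gcongr
          rw [Real.exp_le_one_iff, Left.neg_nonpos_iff]
          positivity
      _ = _ := by
          rw [mul_one, Real.mul_rpow (by positivity) (by positivity), ← Real.exp_mul]
          congr 2
          ring

theorem integral_exp_mul_inner {V : Type*} [NormedAddCommGroup V] [InnerProductSpace ℝ V]
    [FiniteDimensional ℝ V] [MeasurableSpace V] [BorelSpace V] {b : ℝ} (hb : 0 < b) (x : V) :
    Integrable (fun v : V => Real.exp (-b * ‖v‖ ^ 2 + inner ℝ x v)) ∧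
    ∫ v : V, Real.exp (-b * ‖v‖ ^ 2 + inner ℝ x v) =
      (Real.pi / b) ^ (Module.finrank ℝ V / 2 : ℝ) * Real.exp (‖x‖ ^ 2 / (4 * b)) := by
  have hb' : 0 < (b : ℂ).re := hb
  have h1 := GaussianFourier.integral_cexp_neg_mul_sq_norm_add hb' 1 x
  have h2 := GaussianFourier.integrable_cexp_neg_mul_sq_norm_add hb' 1 x
  have e : ∀ v : V, Complex.exp (-(b : ℂ) * (‖v‖ : ℂ) ^ 2 + 1 * ((inner ℝ x v : ℝ) : ℂ)) =
      ((Real.exp (-b * ‖v‖ ^ 2 + inner ℝ x v) : ℝ) : ℂ) := by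
    intro v; push_cast; rw [one_mul]
  simp only [e] at h1 h2
  refine ⟨h2.re, ?_⟩
  rw [integral_complex_ofReal] at h1
  rw [← Complex.ofReal_inj, h1]
  push_cast
  rw [Complex.ofReal_cpow (by positivity)]
  push_cast
  simp

/-- The square is completed in `w`; what remains of the exponent in `‖x‖²` is `coth - 1/(sinh cosh)
= tanh`. -/
theorem integral_mehler (x : EuclideanSpace ℝ (Fin N)) {t l : ℝ} (hl : 0 < l) (ht : 0 < t) :
    Integrable (fun w => mehler x w t l) ∧ ∫ w, mehler x w t l = (2 * Real.pi) ^ ((N : ℝ) / 2) *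
      ((1 / Real.cosh (l * t)) ^ ((N : ℝ) / 2) *
        Real.exp (-(l / 2 * (Real.sinh (l * t) / Real.cosh (l * t)) * ‖x‖ ^ 2))) := by
  have h0 : 0 < Real.sinh (l * t) := Real.sinh_pos_iff.2 (by positivity)
  have h1 := Real.cosh_pos (l * t)
  have h3 := Real.cosh_sq (l * t)
  set S := Real.sinh (l * t)
  set C := Real.cosh (l * t)
  have hb : 0 < l / 2 * (C / S) := by positivity
  obtain ⟨hi, he⟩ := integral_exp_mul_inner hb ((l / S) • x)
  have e : ∀ w, mehler x w t l = (l / S) ^ ((N : ℝ) / 2) * Real.exp (-(l / 2 * (C / S) * ‖x‖ ^ 2)) *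
      Real.exp (-(l / 2 * (C / S)) * ‖w‖ ^ 2 + inner ℝ ((l / S) • x) w) := by
    intro w
    rw [mul_assoc, ← Real.exp_add, inner_smul_left]
    unfold mehler
    congr 2
    simp only [conj_trivial]
    ring
  simp only [e]
  refine ⟨hi.const_mul _, ?_⟩
  rw [integral_const_mul, he, norm_smul, finrank_euclideanSpace_fin, mul_mul_mul_comm,
    ← Real.exp_add, ← Real.mul_rpow (by positivity) (by positivity),
    ← mul_assoc ((2 * Real.pi) ^ ((N : ℝ) / 2)), ← Real.mul_rpow (by positivity) (by positivity)]
  congr 2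
  · field_simp
  · rw [mul_pow, Real.norm_eq_abs, sq_abs]
    have : C ^ 2 = S ^ 2 + 1 := h3
    field_simp
    rw [this]
    ring

end Mehler

/-! ### The kernel: positivity, pointwise bound, continuity in time -/

section Kernel

variable {N k : ℕ}

theorem integrable_mehler (hN : 1 ≤ N) (x w : EuclideanSpace ℝ (Fin N)) {t : ℝ} (ht : 0 < t) :
    Integrable fun ξ : EuclideanSpace ℝ (Fin k) => mehler x w t ‖ξ‖ := by
  have hN' : (0 : ℝ) < N := by exact_mod_cast hN
  refine ((integrable_exp_neg_mul_norm (V := EuclideanSpace ℝ (Fin k))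
    (by positivity : 0 < (N : ℝ) / 4 * t)).const_mul ((2 / t) ^ ((N : ℝ) / 2))).mono' ?_
    (ae_of_all _ fun ξ => ?_)
  · exact (measurable_mehler.comp (by fun_prop : Measurable fun ξ : EuclideanSpace ℝ (Fin k) =>
      (x, w, t, ‖ξ‖))).aestronglyMeasurable
  · rw [Real.norm_eq_abs, abs_of_nonneg (mehler_nonneg x w (norm_nonneg _) ht)]
    exact mehler_le_exp hN x w (norm_nonneg _) ht

theorem kernel_eq (hN : 1 ≤ N) (x w : EuclideanSpace ℝ (Fin N)) (y : EuclideanSpace ℝ (Fin k))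
    {t : ℝ} (ht : 0 < t) :
    kernel x w y t = 1 / (2 * Real.pi) ^ (((N : ℝ) + 2 * k) / 2) *
      ∫ ξ : EuclideanSpace ℝ (Fin k), mehler x w t ‖ξ‖ * Real.cos (inner ℝ ξ y) := by
  unfold kernel complexKernel
  rw [Complex.re_ofReal_mul]
  congr 1
  have e : ∀ ξ : EuclideanSpace ℝ (Fin k),
      (((‖ξ‖ / Real.sinh (‖ξ‖ * t)) ^ ((N : ℝ) / 2) : ℝ) : ℂ) *
        Complex.exp (Complex.I * ((inner ℝ ξ y : ℝ) : ℂ) -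
          ((‖ξ‖ / 2 * ((‖x‖ ^ 2 + ‖w‖ ^ 2) * (Real.cosh (‖ξ‖ * t) / Real.sinh (‖ξ‖ * t)) -
            2 * inner ℝ x w * (1 / Real.sinh (‖ξ‖ * t))) : ℝ) : ℂ)) =
      (mehler x w t ‖ξ‖ : ℂ) * Complex.exp (((inner ℝ ξ y : ℝ) : ℂ) * Complex.I) := by
    intro ξ
    rw [sub_eq_neg_add, Complex.exp_add, ← mul_assoc, mul_comm Complex.I]
    unfold mehler
    push_cast
    rfl
  simp only [e]
  have hi : Integrable fun ξ : EuclideanSpace ℝ (Fin k) =>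
      (mehler x w t ‖ξ‖ : ℂ) * Complex.exp (((inner ℝ ξ y : ℝ) : ℂ) * Complex.I) := by
    refine (integrable_mehler (k := k) hN x w ht).ofReal.mul_bdd (c := 1) (by fun_prop)
      (ae_of_all _ fun ξ => ?_)
    rw [Complex.norm_exp_ofReal_mul_I]
  have := integral_re hi
  simp only [RCLike.re_eq_complex_re] at this
  rw [← this]
  congr 1 with ξ
  rw [Complex.re_ofReal_mul, Complex.exp_ofReal_mul_I_re]

theorem kernel_symm (hN : 1 ≤ N) (x w : EuclideanSpace ℝ (Fin N)) (y : EuclideanSpace ℝ (Fin k))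
    {t : ℝ} (ht : 0 < t) : kernel x w y t = kernel w x (-y) t := by
  rw [kernel_eq hN _ _ _ ht, kernel_eq hN _ _ _ ht]
  simp only [mehler_symm x w, inner_neg_right, Real.cos_neg]

/-- By `mehler_exponent`, the function is `t^{-N/2}` times a power of `z / sinh z` at `z = t‖ξ‖` and
the exponentials of `-‖x-w‖²/(2t) · s coth s` and `-‖x+w‖²/(2t) · s tanh s`, all positive definite.
-/
theorem posMult_mehler (hN : 1 ≤ N) (hk : 1 ≤ k) (x w : EuclideanSpace ℝ (Fin N)) {t : ℝ} (ht : 0 < t) :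
    PosMult fun ξ : EuclideanSpace ℝ (Fin k) => mehler x w t ‖ξ‖ := by
  have hN' : (0 : ℝ) < N := by exact_mod_cast hN
  have : Nonempty (Fin k) := ⟨⟨0, hk⟩⟩
  have h := (PosMult.const (V := EuclideanSpace ℝ (Fin k))
    (by positivity : 0 ≤ t⁻¹ ^ ((N : ℝ) / 2))).mul
    ((PosMult.div_sinh (V := EuclideanSpace ℝ (Fin k)) (by positivity : 0 < (N : ℝ) / 2) ht).mul
    ((PosMult.exp_neg_coth (V := EuclideanSpace ℝ (Fin k))
      (by positivity : 0 ≤ ‖x - w‖ ^ 2 / (2 * t)) (half_pos ht)).mul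
    (PosMult.exp_neg_tanh (V := EuclideanSpace ℝ (Fin k))
      (by positivity : 0 ≤ ‖x + w‖ ^ 2 / (2 * t)) (half_pos ht))))
  convert h using 2 with ξ
  -- At `ξ = 0` both sides contain `0 ^ (N/2)`, which vanishes since `N ≥ 1`.
  rcases eq_or_ne ξ 0 with rfl | hξ
  · have : (N : ℝ) / 2 ≠ 0 := by positivity
    simp [mehler, this]
  · have hl := norm_pos_iff.2 hξ
    have h0 : 0 < Real.sinh (‖ξ‖ * t) := Real.sinh_pos_iff.2 (by positivity)
    rw [← mul_assoc, ← Real.exp_add, mehler, mehler_exponent x w hl ht, mul_comm t ‖ξ‖,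
      ← Real.mul_rpow (by positivity) (by positivity)]
    congr 2
    · field_simp
    · ring

/-- The kernel is the multiplier applied to the constant `1`, which is not integrable. The constant
is therefore replaced by wide Gaussians, whose cosine transforms are positive, and the limit is
taken. -/
theorem kernel_nonneg (hN : 1 ≤ N) (hk : 1 ≤ k) (x w : EuclideanSpace ℝ (Fin N))
    (y : EuclideanSpace ℝ (Fin k)) {t : ℝ} (ht : 0 < t) : 0 ≤ kernel x w y t := by
  rw [kernel_eq hN x w y ht]
  refine mul_nonneg (by positivity) ?_
  have hi := integrable_mehler (k := k) hN x w ht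
  have hc : ∀ s : ℝ, 0 < s → 0 ≤ ∫ ξ : EuclideanSpace ℝ (Fin k),
      mehler x w t ‖ξ‖ * Real.exp (-s * ‖ξ‖ ^ 2) * Real.cos (inner ℝ ξ y) := by
    intro s hs
    refine (posMult_mehler hN hk x w ht).pos (fun ξ => Real.exp (-s * ‖ξ‖ ^ 2))
      (integrable_exp_neg_mul_sq_norm hs) (fun z => ?_) y
    have := integral_exp_mul_cos hs z
    simp only [real_inner_comm z] at this ⊢
    rw [this]
    positivity
  have hlim : Tendsto (fun n : ℕ => ∫ ξ : EuclideanSpace ℝ (Fin k), mehler x w t ‖ξ‖ *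
      Real.exp (-(1 / ((n : ℝ) + 1)) * ‖ξ‖ ^ 2) * Real.cos (inner ℝ ξ y)) atTop
      (𝓝 (∫ ξ : EuclideanSpace ℝ (Fin k), mehler x w t ‖ξ‖ * Real.cos (inner ℝ ξ y))) := by
    refine tendsto_integral_of_dominated_convergence (fun ξ => mehler x w t ‖ξ‖)
      (fun n => ?_) hi (fun n => ae_of_all _ fun ξ => ?_) (ae_of_all _ fun ξ => ?_)
    · exact (hi.aestronglyMeasurable.mul (by fun_prop)).mul (by fun_prop)
    · have h0 := mehler_nonneg x w (norm_nonneg ξ) ht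
      rw [norm_mul, norm_mul, Real.norm_of_nonneg h0, Real.norm_of_nonneg (Real.exp_pos _).le,
        mul_assoc]
      refine mul_le_of_le_one_right h0 (mul_le_one₀ ?_ (norm_nonneg _) (Real.abs_cos_le_one _))
      rw [Real.exp_le_one_iff, neg_mul, Left.neg_nonpos_iff]
      positivity
    · have h1 : Tendsto (fun n : ℕ => Real.exp (-(1 / ((n : ℝ) + 1)) * ‖ξ‖ ^ 2)) atTop (𝓝 1) := by
        have := (((tendsto_one_div_add_atTop_nhds_zero_nat (𝕜 := ℝ)).neg).mul_const (‖ξ‖ ^ 2)).rexp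
        simpa using this
      simpa using (h1.const_mul (mehler x w t ‖ξ‖)).mul_const (Real.cos (inner ℝ ξ y))
  exact ge_of_tendsto' hlim fun n => hc _ (by positivity)

/-- The factor `t^{-N/2}` comes from `mehler_le_exp`, and `t^{-k}` from the substitution that
removes `t` from `exp (-(N/4) t ‖ξ‖)`. -/
theorem exists_kernel_le (N k : ℕ) (hN : 1 ≤ N) : ∃ A : ℝ, 0 < A ∧ ∀ (x w : EuclideanSpace ℝ (Fin N))
    (y : EuclideanSpace ℝ (Fin k)) (t : ℝ), 0 < t →
    kernel x w y t ≤ A * t ^ (-(((N : ℝ) + 2 * k) / 2)) := by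
  have hN' : (0 : ℝ) < N := by exact_mod_cast hN
  have hI : 0 ≤ ∫ ξ : EuclideanSpace ℝ (Fin k), Real.exp (-((N : ℝ) / 4 * ‖ξ‖)) :=
    integral_nonneg fun _ => (Real.exp_pos _).le
  -- Adding `1` makes the constant positive without a discussion of the integral.
  refine ⟨1 / (2 * Real.pi) ^ (((N : ℝ) + 2 * k) / 2) * (2 ^ ((N : ℝ) / 2) *
    ((∫ ξ : EuclideanSpace ℝ (Fin k), Real.exp (-((N : ℝ) / 4 * ‖ξ‖))) + 1)), by positivity,
    fun x w y t ht => ?_⟩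
  rw [kernel_eq hN x w y ht, mul_assoc]
  refine mul_le_mul_of_nonneg_left ?_ (by positivity)
  have hi := integrable_mehler (k := k) hN x w ht
  have he := (integrable_exp_neg_mul_norm (V := EuclideanSpace ℝ (Fin k))
    (by positivity : 0 < (N : ℝ) / 4 * t)).const_mul ((2 / t) ^ ((N : ℝ) / 2))
  have hs : ∫ ξ : EuclideanSpace ℝ (Fin k), Real.exp (-((N : ℝ) / 4 * t * ‖ξ‖)) =
      (t ^ k)⁻¹ * ∫ ξ : EuclideanSpace ℝ (Fin k), Real.exp (-((N : ℝ) / 4 * ‖ξ‖)) := by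
    have := Measure.integral_comp_smul_of_nonneg (volume : Measure (EuclideanSpace ℝ (Fin k)))
      (fun ξ => Real.exp (-((N : ℝ) / 4 * ‖ξ‖))) t (hR := ht.le)
    rw [finrank_euclideanSpace_fin, smul_eq_mul] at this
    rw [← this]
    congr 1 with ξ
    rw [norm_smul, Real.norm_of_nonneg ht.le, mul_assoc]
  calc ∫ ξ : EuclideanSpace ℝ (Fin k), mehler x w t ‖ξ‖ * Real.cos (inner ℝ ξ y)
      ≤ ∫ ξ : EuclideanSpace ℝ (Fin k), (2 / t) ^ ((N : ℝ) / 2) * Real.exp (-((N : ℝ) / 4 * t * ‖ξ‖)) := by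
        refine integral_mono (integrable_mul_cos hi y) he fun ξ => ?_
        have h0 := mehler_nonneg x w (norm_nonneg ξ) ht
        exact (mul_le_of_le_one_right h0 (Real.cos_le_one _)).trans
          (mehler_le_exp hN x w (norm_nonneg _) ht)
    _ = 2 ^ ((N : ℝ) / 2) * (∫ ξ : EuclideanSpace ℝ (Fin k), Real.exp (-((N : ℝ) / 4 * ‖ξ‖))) *
        t ^ (-(((N : ℝ) + 2 * k) / 2)) := by
        rw [integral_const_mul, hs, Real.div_rpow (by norm_num) ht.le,
          show -(((N : ℝ) + 2 * k) / 2) = -((N : ℝ) / 2) + -(k : ℝ) by ring, Real.rpow_add ht,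
          Real.rpow_neg ht.le, Real.rpow_neg ht.le, Real.rpow_natCast]
        ring
    _ ≤ _ := by gcongr; linarith

theorem measurable_kernel (hN : 1 ≤ N) {t : ℝ} (ht : 0 < t) :
    Measurable fun q : EuclideanSpace ℝ (Fin N) × EuclideanSpace ℝ (Fin N) × EuclideanSpace ℝ (Fin k) =>
      kernel q.1 q.2.1 q.2.2 t := by
  simp only [kernel_eq hN _ _ _ ht]
  refine Measurable.const_mul ?_ _
  have hm : Measurable fun q : (EuclideanSpace ℝ (Fin N) × EuclideanSpace ℝ (Fin N) ×
      EuclideanSpace ℝ (Fin k)) × EuclideanSpace ℝ (Fin k) =>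
      mehler q.1.1 q.1.2.1 t ‖q.2‖ * Real.cos (inner ℝ q.2 q.1.2.2) := by
    refine Measurable.mul ?_ (by fun_prop)
    exact measurable_mehler.comp (by fun_prop : Measurable fun q : (EuclideanSpace ℝ (Fin N) ×
      EuclideanSpace ℝ (Fin N) × EuclideanSpace ℝ (Fin k)) × EuclideanSpace ℝ (Fin k) =>
      (q.1.1, q.1.2.1, t, ‖q.2‖))
  exact hm.stronglyMeasurable.integral_prod_right.measurable

theorem tendsto_kernel (hN : 1 ≤ N) (x w : EuclideanSpace ℝ (Fin N)) (y : EuclideanSpace ℝ (Fin k))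
    {t₀ : ℝ} (ht₀ : 0 < t₀) : Tendsto (fun t => kernel x w y t) (𝓝 t₀) (𝓝 (kernel x w y t₀)) := by
  have hN' : (0 : ℝ) < N := by exact_mod_cast hN
  have hev : ∀ᶠ t in 𝓝 t₀, t₀ / 2 < t := lt_mem_nhds (by linarith)
  rw [kernel_eq hN x w y ht₀]
  have : Tendsto (fun t => 1 / (2 * Real.pi) ^ (((N : ℝ) + 2 * k) / 2) *
      ∫ ξ : EuclideanSpace ℝ (Fin k), mehler x w t ‖ξ‖ * Real.cos (inner ℝ ξ y)) (𝓝 t₀)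
      (𝓝 (1 / (2 * Real.pi) ^ (((N : ℝ) + 2 * k) / 2) *
      ∫ ξ : EuclideanSpace ℝ (Fin k), mehler x w t₀ ‖ξ‖ * Real.cos (inner ℝ ξ y))) := by
    refine Tendsto.const_mul _ ?_
    refine tendsto_integral_filter_of_dominated_convergence
      (fun ξ : EuclideanSpace ℝ (Fin k) => (2 / (t₀ / 2)) ^ ((N : ℝ) / 2) *
        Real.exp (-((N : ℝ) / 4 * (t₀ / 2) * ‖ξ‖))) ?_ ?_
      ((integrable_exp_neg_mul_norm (by positivity)).const_mul _) (ae_of_all _ fun ξ => ?_)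
    · filter_upwards [hev] with t ht
      exact (integrable_mul_cos (integrable_mehler (k := k) hN x w (by linarith)) y).aestronglyMeasurable
    · filter_upwards [hev] with t ht
      refine ae_of_all _ fun ξ => ?_
      have ht' : 0 < t := by linarith
      have h0 := mehler_nonneg x w (norm_nonneg ξ) ht'
      rw [norm_mul, Real.norm_of_nonneg h0]
      refine (mul_le_of_le_one_right h0 (Real.abs_cos_le_one _)).trans
          ((mehler_le_exp hN x w (norm_nonneg _) ht').trans ?_)
      gcongr
    · refine Tendsto.mul_const _ ?_
      rcases eq_or_ne ξ 0 with rfl | hξ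
      · have : (N : ℝ) / 2 ≠ 0 := by positivity
        simp [mehler]
      · have hl := norm_pos_iff.2 hξ
        have h0 : Real.sinh (‖ξ‖ * t₀) ≠ 0 := (Real.sinh_pos_iff.2 (by positivity)).ne'
        have : ContinuousAt (fun t => mehler x w t ‖ξ‖) t₀ := by
          unfold mehler
          refine ContinuousAt.mul (ContinuousAt.rpow_const ?_ (Or.inr (by positivity))) ?_
          · fun_prop (disch := assumption)
          · fun_prop (disch := assumption)
        exact this
  refine this.congr' ?_
  filter_upwards [hev] with t ht
  rw [kernel_eq hN x w y (by linarith)]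

end Kernel

/-! ### Total mass of the kernel through a Gaussian cutoff -/

section Mass

variable {N k : ℕ}

theorem integrable_kernel_mul_exp (hN : 1 ≤ N) (hk : 1 ≤ k) (x w : EuclideanSpace ℝ (Fin N)) {t b : ℝ}
    (ht : 0 < t) (hb : 0 < b) :
    Integrable fun y : EuclideanSpace ℝ (Fin k) => kernel x w y t * Real.exp (-b * ‖y‖ ^ 2) := by
  obtain ⟨A, hA, hle⟩ := exists_kernel_le N k hN
  refine (integrable_exp_neg_mul_sq_norm hb).bdd_mul (c := A * t ^ (-(((N : ℝ) + 2 * k) / 2))) ?_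
    (ae_of_all _ fun y => ?_)
  · exact ((measurable_kernel hN ht).comp (by fun_prop : Measurable
      fun y : EuclideanSpace ℝ (Fin k) => (x, w, y))).aestronglyMeasurable
  · rw [Real.norm_of_nonneg (kernel_nonneg hN hk x w y ht)]
    exact hle x w y t ht

/-- The cutoff makes Fubini available before the kernel is known to be integrable in `y`. It is
transformed into a Gaussian in `ξ` of width `s`, and `ξ = sη` turns this into the standard Gaussian
weight, so that `s` appears only in the argument of `mehler`. -/
theorem integral_kernel_mul_exp (hN : 1 ≤ N) (x w : EuclideanSpace ℝ (Fin N)) {t s : ℝ}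
    (ht : 0 < t) (hs : 0 < s) :
    ∫ y : EuclideanSpace ℝ (Fin k), kernel x w y t * Real.exp (-(s ^ 2 / 2) * ‖y‖ ^ 2) =
      ∫ η : EuclideanSpace ℝ (Fin k), (2 * Real.pi) ^ (-((N : ℝ) / 2)) *
        (2 * Real.pi) ^ (-((k : ℝ) / 2)) * (mehler x w t (s * ‖η‖) * Real.exp (-(1 / 2) * ‖η‖ ^ 2)) := by
  have hb : 0 < s ^ 2 / 2 := by positivity
  have hi := integrable_mehler (k := k) hN x w ht
  have hint : Integrable (Function.uncurry fun (y ξ : EuclideanSpace ℝ (Fin k)) =>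
      mehler x w t ‖ξ‖ * Real.cos (inner ℝ ξ y) * Real.exp (-(s ^ 2 / 2) * ‖y‖ ^ 2))
      (volume.prod volume) := by
    have h1 := ((integrable_exp_neg_mul_sq_norm (V := EuclideanSpace ℝ (Fin k)) hb).mul_prod hi).bdd_mul
      (f := fun q : EuclideanSpace ℝ (Fin k) × EuclideanSpace ℝ (Fin k) => Real.cos (inner ℝ q.2 q.1))
      (c := 1) (by fun_prop) (ae_of_all _ fun q => Real.abs_cos_le_one _)
    refine h1.congr (ae_of_all _ fun q => ?_)
    simp only [Function.uncurry]
    ring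
  have e1 : ∀ y : EuclideanSpace ℝ (Fin k), kernel x w y t * Real.exp (-(s ^ 2 / 2) * ‖y‖ ^ 2) =
      1 / (2 * Real.pi) ^ (((N : ℝ) + 2 * k) / 2) * ∫ ξ : EuclideanSpace ℝ (Fin k),
        mehler x w t ‖ξ‖ * Real.cos (inner ℝ ξ y) * Real.exp (-(s ^ 2 / 2) * ‖y‖ ^ 2) := by
    intro y
    rw [integral_mul_const, kernel_eq hN x w y ht, mul_assoc]
  have e2 : ∀ ξ : EuclideanSpace ℝ (Fin k), ∫ y : EuclideanSpace ℝ (Fin k),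
      mehler x w t ‖ξ‖ * Real.cos (inner ℝ ξ y) * Real.exp (-(s ^ 2 / 2) * ‖y‖ ^ 2) =
      (Real.pi / (s ^ 2 / 2)) ^ ((k : ℝ) / 2) *
        (mehler x w t ‖ξ‖ * Real.exp (-(‖ξ‖ ^ 2 / (4 * (s ^ 2 / 2))))) := by
    intro ξ
    have := integral_exp_mul_cos hb ξ
    rw [finrank_euclideanSpace_fin] at this
    rw [mul_left_comm, ← this, ← integral_const_mul]
    congr 1 with y
    ring
  simp only [e1]
  rw [integral_const_mul, integral_integral_swap hint]
  simp only [e2]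
  have e3 := Measure.integral_comp_smul_of_nonneg (volume : Measure (EuclideanSpace ℝ (Fin k)))
    (fun ξ => mehler x w t ‖ξ‖ * Real.exp (-(‖ξ‖ ^ 2 / (4 * (s ^ 2 / 2))))) s (hR := hs.le)
  rw [finrank_euclideanSpace_fin, smul_eq_mul, eq_inv_mul_iff_mul_eq₀ (by positivity)] at e3
  rw [integral_const_mul, ← e3, integral_const_mul, ← mul_assoc, ← mul_assoc]
  congr 1
  · have hp : (0 : ℝ) < 2 * Real.pi := by positivity
    have h1 : Real.pi / (s ^ 2 / 2) = 2 * Real.pi / s ^ 2 := by field_simp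
    have h2 : (s ^ 2) ^ ((k : ℝ) / 2) = s ^ k := by
      rw [← Real.rpow_natCast s 2, ← Real.rpow_mul hs.le, ← Real.rpow_natCast]
      congr 1; push_cast; ring
    rw [h1, Real.div_rpow hp.le (by positivity), h2, mul_assoc, div_mul_cancel₀ _ (by positivity),
      one_div, ← Real.rpow_neg hp.le, ← Real.rpow_add hp, ← Real.rpow_add hp]
    congr 1
    ring
  · congr 1 with η
    rw [norm_smul, Real.norm_of_nonneg hs.le]
    congr 2
    field_simp
    ring

/-- `∫ mehler x w t l dw`, normalized by its value in the limit `l → 0`. -/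
noncomputable def mass (x : EuclideanSpace ℝ (Fin N)) (t l : ℝ) : ℝ :=
  (1 / Real.cosh (l * t)) ^ ((N : ℝ) / 2) *
    Real.exp (-(l / 2 * (Real.sinh (l * t) / Real.cosh (l * t)) * ‖x‖ ^ 2))

theorem mass_nonneg (x : EuclideanSpace ℝ (Fin N)) (t l : ℝ) : 0 ≤ mass x t l := by
  have := Real.cosh_pos (l * t)
  unfold mass; positivity

theorem mass_le_one (x : EuclideanSpace ℝ (Fin N)) {t l : ℝ} (ht : 0 ≤ t) (hl : 0 ≤ l) :
    mass x t l ≤ 1 := by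
  have h0 := Real.cosh_pos (l * t)
  have h1 : 0 ≤ Real.sinh (l * t) := Real.sinh_nonneg_iff.2 (by positivity)
  refine mul_le_one₀ (Real.rpow_le_one (by positivity) ?_ (by positivity)) (Real.exp_pos _).le ?_
  · exact div_le_one_of_le₀ (Real.one_le_cosh _) h0.le
  · rw [Real.exp_le_one_iff, Left.neg_nonpos_iff]
    positivity

theorem continuous_mass (x : EuclideanSpace ℝ (Fin N)) : Continuous fun q : ℝ × ℝ => mass x q.1 q.2 := by
  unfold mass
  have h : ∀ q : ℝ × ℝ, Real.cosh (q.2 * q.1) ≠ 0 := fun q => (Real.cosh_pos _).ne'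
  refine Continuous.mul (Continuous.rpow_const ?_ fun _ => Or.inr (by positivity)) ?_
  · fun_prop (disch := exact h)
  · fun_prop (disch := exact h)

theorem lintegral_kernel_mul_exp (hN : 1 ≤ N) (hk : 1 ≤ k) (x w : EuclideanSpace ℝ (Fin N)) {t s : ℝ}
    (ht : 0 < t) (hs : 0 < s) :
    ∫⁻ y : EuclideanSpace ℝ (Fin k), ENNReal.ofReal (kernel x w y t * Real.exp (-(s ^ 2 / 2) * ‖y‖ ^ 2)) =
      ∫⁻ η : EuclideanSpace ℝ (Fin k), ENNReal.ofReal ((2 * Real.pi) ^ (-((N : ℝ) / 2)) *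
        (2 * Real.pi) ^ (-((k : ℝ) / 2)) *
          (mehler x w t (s * ‖η‖) * Real.exp (-(1 / 2) * ‖η‖ ^ 2))) := by
  have hm : Measurable fun η : EuclideanSpace ℝ (Fin k) => mehler x w t (s * ‖η‖) :=
    measurable_mehler.comp (by fun_prop : Measurable fun η : EuclideanSpace ℝ (Fin k) =>
      (x, w, t, s * ‖η‖))
  rw [← ofReal_integral_eq_lintegral_ofReal (integrable_kernel_mul_exp hN hk x w ht (by positivity))
    (ae_of_all _ fun y => mul_nonneg (kernel_nonneg hN hk x w y ht) (Real.exp_pos _).le),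
    ← ofReal_integral_eq_lintegral_ofReal ?_ (ae_of_all _ fun η => ?_),
    integral_kernel_mul_exp hN x w ht hs]
  · refine Integrable.const_mul ?_ _
    refine (integrable_exp_neg_mul_sq_norm (by norm_num)).bdd_mul
      (c := t⁻¹ ^ ((N : ℝ) / 2) * Real.exp (-(‖x - w‖ ^ 2 / (2 * t)))) hm.aestronglyMeasurable
      (ae_of_all _ fun η => ?_)
    rw [Real.norm_of_nonneg (mehler_nonneg x w (by positivity) ht)]
    exact mehler_le_heat hN x w (by positivity) ht
  · have := mehler_nonneg x w (by positivity : 0 ≤ s * ‖η‖) ht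
    simp only [Pi.zero_apply]
    positivity

/-- The density of the standard Gaussian measure. -/
noncomputable def gauss (η : EuclideanSpace ℝ (Fin k)) : ℝ≥0∞ :=
  ENNReal.ofReal ((2 * Real.pi) ^ (-((k : ℝ) / 2)) * Real.exp (-(1 / 2) * ‖η‖ ^ 2))

theorem measurable_gauss : Measurable (gauss (k := k)) := by
  unfold gauss; fun_prop

theorem lintegral_gauss : ∫⁻ η : EuclideanSpace ℝ (Fin k), gauss η = 1 := by
  unfold gauss
  rw [← ofReal_integral_eq_lintegral_ofReal
    ((integrable_exp_neg_mul_sq_norm (by norm_num)).const_mul _) (ae_of_all _ fun η => by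
      simp only [Pi.zero_apply]; positivity), integral_const_mul,
    GaussianFourier.integral_rexp_neg_mul_sq_norm (by norm_num), finrank_euclideanSpace_fin,
    Real.rpow_neg (by positivity), show Real.pi / (1 / 2) = 2 * Real.pi by ring,
    inv_mul_cancel₀ (by positivity), ENNReal.ofReal_one]

/-- After Tonelli, `integral_mehler` computes the inner integral for every `η ≠ 0`, and its factor
`(2π)^{N/2}` cancels the one in the kernel. -/
theorem lintegral_lintegral_kernel_mul_exp (hN : 1 ≤ N) (hk : 1 ≤ k) (x : EuclideanSpace ℝ (Fin N))
    {t s : ℝ} (ht : 0 < t) (hs : 0 < s) :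
    ∫⁻ w : EuclideanSpace ℝ (Fin N), ∫⁻ y : EuclideanSpace ℝ (Fin k),
      ENNReal.ofReal (kernel x w y t * Real.exp (-(s ^ 2 / 2) * ‖y‖ ^ 2)) =
      ∫⁻ η : EuclideanSpace ℝ (Fin k), ENNReal.ofReal (mass x t (s * ‖η‖)) *
gauss η := by
  have : Nonempty (Fin k) := ⟨⟨0, hk⟩⟩
  simp only [lintegral_kernel_mul_exp hN hk x _ ht hs]
  have hm : Measurable fun q : EuclideanSpace ℝ (Fin N) × EuclideanSpace ℝ (Fin k) =>
      mehler x q.1 t (s * ‖q.2‖) :=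
    measurable_mehler.comp (by fun_prop : Measurable fun q : EuclideanSpace ℝ (Fin N) ×
      EuclideanSpace ℝ (Fin k) => (x, q.1, t, s * ‖q.2‖))
  rw [lintegral_lintegral_swap]
  · refine lintegral_congr_ae ?_
    filter_upwards [Measure.ae_ne volume (0 : EuclideanSpace ℝ (Fin k))] with η hη
    obtain ⟨h1, h2⟩ := integral_mehler x (mul_pos hs (norm_pos_iff.2 hη)) ht
    have e : ∀ w, (2 * Real.pi) ^ (-((N : ℝ) / 2)) * (2 * Real.pi) ^ (-((k : ℝ) / 2)) *
        (mehler x w t (s * ‖η‖) * Real.exp (-(1 / 2) * ‖η‖ ^ 2)) =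
        (2 * Real.pi) ^ (-((N : ℝ) / 2)) * (2 * Real.pi) ^ (-((k : ℝ) / 2)) *
          Real.exp (-(1 / 2) * ‖η‖ ^ 2) * mehler x w t (s * ‖η‖) := fun w => by ring
    simp only [e]
    rw [gauss, ← ofReal_integral_eq_lintegral_ofReal (h1.const_mul _) (ae_of_all _ fun w => ?_),
      integral_const_mul, h2, ← ENNReal.ofReal_mul (mass_nonneg _ _ _), Real.rpow_neg (by positivity)]
    · congr 1
      unfold mass
      have : (2 * Real.pi) ^ ((N : ℝ) / 2) ≠ 0 := by positivity
      field_simp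
    · have := mehler_nonneg x w (by positivity : 0 ≤ s * ‖η‖) ht
      simp only [Pi.zero_apply]
      positivity
  · refine (Measurable.ennreal_ofReal ?_).aemeasurable
    exact (hm.mul (by fun_prop)).const_mul _

/-- Dominated convergence against a probability density, since `mass` is at most `1` and equals `1`
when either argument is `0`. The case `s → 0` gives the total mass of the kernel, the case `t → 0`
with `s = 1` its concentration in `y`. -/
theorem tendsto_lintegral_mass {ι : Type*} {l : Filter ι} [l.IsCountablyGenerated]
    (x : EuclideanSpace ℝ (Fin N)) {t s : ι → ℝ} (ht : ∀ᶠ i in l, 0 ≤ t i) (hs : ∀ᶠ i in l, 0 ≤ s i)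
    {t₀ s₀ : ℝ} (hlt : Tendsto t l (𝓝 t₀)) (hls : Tendsto s l (𝓝 s₀)) (h0 : t₀ = 0 ∨ s₀ = 0) :
    Tendsto (fun i => ∫⁻ η : EuclideanSpace ℝ (Fin k), ENNReal.ofReal (mass x (t i) (s i * ‖η‖)) *
gauss η) l (𝓝 1) := by
  rw [← lintegral_gauss (k := k)]
  refine tendsto_lintegral_filter_of_dominated_convergence
    gauss
    (Eventually.of_forall fun i => ?_) ?_ ?_ (ae_of_all _ fun η => ?_)
  · have h1 : Measurable fun η : EuclideanSpace ℝ (Fin k) => mass x (t i) (s i * ‖η‖) := by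
      have h2 : Measurable fun η : EuclideanSpace ℝ (Fin k) => (t i, s i * ‖η‖) := by fun_prop
      have h3 := (continuous_mass x).measurable.comp h2
      exact h3
    exact h1.ennreal_ofReal.mul measurable_gauss
  · filter_upwards [ht, hs] with i hti hsi
    refine ae_of_all _ fun η => mul_le_of_le_one_left' ?_
    rw [ENNReal.ofReal_le_one]
    exact mass_le_one x hti (by positivity)
  · rw [lintegral_gauss]; exact ENNReal.one_ne_top
  · have h1 : Tendsto (fun i => mass x (t i) (s i * ‖η‖)) l (𝓝 1) := by
      have h2 : mass x t₀ (s₀ * ‖η‖) = 1 := by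
        rcases h0 with rfl | rfl <;> simp [mass]
      rw [← h2]
      have h3 := ((continuous_mass x).tendsto (t₀, s₀ * ‖η‖)).comp
        (hlt.prodMk_nhds (hls.mul_const ‖η‖))
      exact h3
    have h2 := ENNReal.Tendsto.mul_const (b := gauss η) (ENNReal.tendsto_ofReal h1) (Or.inr ENNReal.ofReal_ne_top)
    simpa using h2

theorem monotone_exp_weight {E : Type*} [NormedAddCommGroup E] (y : E) :
    Monotone fun n : ℕ => Real.exp (-((1 / ((n : ℝ) + 1)) ^ 2 / 2) * ‖y‖ ^ 2) := by
  intro m n hmn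
  simp only
  have : (m : ℝ) ≤ n := by exact_mod_cast hmn
  gcongr

theorem tendsto_exp_weight {E : Type*} [NormedAddCommGroup E] (y : E) :
    Tendsto (fun n : ℕ => Real.exp (-((1 / ((n : ℝ) + 1)) ^ 2 / 2) * ‖y‖ ^ 2)) atTop (𝓝 1) := by
  have := (((((tendsto_one_div_add_atTop_nhds_zero_nat (𝕜 := ℝ)).pow 2).div_const 2).neg).mul_const
    (‖y‖ ^ 2)).rexp
  simpa using this

/-- The marginal of the kernel in `y` is dominated by the heat kernel of `Δ/2` on `ℝ^N`: the cutoff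
increases to `1`, and `mehler_le_heat` holds uniformly along it. -/
theorem lintegral_kernel_le (hN : 1 ≤ N) (hk : 1 ≤ k) (x w : EuclideanSpace ℝ (Fin N)) {t : ℝ}
    (ht : 0 < t) :
    ∫⁻ y : EuclideanSpace ℝ (Fin k), ENNReal.ofReal (kernel x w y t) ≤
      ENNReal.ofReal ((2 * Real.pi * t) ^ (-((N : ℝ) / 2)) * Real.exp (-(1 / (2 * t)) * ‖w - x‖ ^ 2)) := by
  have hlim := lintegral_tendsto_of_tendsto_of_monotone (μ := (volume : Measure (EuclideanSpace ℝ (Fin k))))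
    (f := fun n y => ENNReal.ofReal (kernel x w y t * Real.exp (-((1 / ((n : ℝ) + 1)) ^ 2 / 2) * ‖y‖ ^ 2)))
    (F := fun y => ENNReal.ofReal (kernel x w y t)) (fun n => ?_) (ae_of_all _ fun y m n hmn => ?_)
    (ae_of_all _ fun y => ?_)
  · refine le_of_tendsto' hlim fun n => ?_
    rw [lintegral_kernel_mul_exp hN hk x w ht (by positivity)]
    calc _ ≤ ∫⁻ η : EuclideanSpace ℝ (Fin k), ENNReal.ofReal ((2 * Real.pi * t) ^ (-((N : ℝ) / 2)) *
            Real.exp (-(1 / (2 * t)) * ‖w - x‖ ^ 2)) *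
            gauss η := by
          refine lintegral_mono fun η => ?_
          rw [gauss, ← ENNReal.ofReal_mul (by positivity)]
          refine ENNReal.ofReal_le_ofReal ?_
          have h1 := mehler_le_heat hN x w (by positivity : 0 ≤ 1 / ((n : ℝ) + 1) * ‖η‖) ht
          rw [Real.mul_rpow (by positivity) ht.le, norm_sub_rev w x, Real.rpow_neg ht.le,
            ← Real.inv_rpow ht.le]
          calc _ ≤ (2 * Real.pi) ^ (-((N : ℝ) / 2)) * (2 * Real.pi) ^ (-((k : ℝ) / 2)) *
              ((t⁻¹ ^ ((N : ℝ) / 2) * Real.exp (-(‖x - w‖ ^ 2 / (2 * t)))) *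
                Real.exp (-(1 / 2) * ‖η‖ ^ 2)) := by gcongr
            _ = _ := by
              rw [show -(1 / (2 * t)) * ‖x - w‖ ^ 2 = -(‖x - w‖ ^ 2 / (2 * t)) by ring]
              ring
      _ = _ := by
          rw [lintegral_const_mul' _ _ ENNReal.ofReal_ne_top, lintegral_gauss, mul_one]
  · have h1 : Measurable fun y : EuclideanSpace ℝ (Fin k) => kernel x w y t := by
      have h2 : Measurable fun y : EuclideanSpace ℝ (Fin k) => (x, w, y) := by fun_prop
      have h3 := (measurable_kernel hN ht).comp h2
      exact h3
    have h2 : Measurable fun y : EuclideanSpace ℝ (Fin k) =>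
        Real.exp (-((1 / ((n : ℝ) + 1)) ^ 2 / 2) * ‖y‖ ^ 2) := by fun_prop
    exact (h1.mul h2).ennreal_ofReal.aemeasurable
  · exact ENNReal.ofReal_le_ofReal (mul_le_mul_of_nonneg_left (monotone_exp_weight y hmn)
      (kernel_nonneg hN hk x w y ht))
  · simpa using ENNReal.tendsto_ofReal ((tendsto_exp_weight y).const_mul (kernel x w y t))

end Mass

/-! ### The two-point heat kernel: unit marginals and concentration as `t → 0` -/

section HeatKernel

variable {N k : ℕ}

/-- The heat kernel as a function of two points of the space. -/
noncomputable def heat (t : ℝ) (a b : Space N k) : ℝ := kernel a.1 b.1 (a.2 - b.2) t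

theorem heat_nonneg (hN : 1 ≤ N) (hk : 1 ≤ k) {t : ℝ} (ht : 0 < t) (a b : Space N k) :
    0 ≤ heat t a b :=
  kernel_nonneg hN hk _ _ _ ht

theorem heat_comm (hN : 1 ≤ N) {t : ℝ} (ht : 0 < t) (a b : Space N k) : heat t a b = heat t b a := by
  unfold heat
  rw [kernel_symm hN _ _ _ ht, neg_sub]

theorem exists_heat_le (N k : ℕ) (hN : 1 ≤ N) : ∃ A : ℝ, 0 < A ∧ ∀ t : ℝ, 0 < t →
    ∀ a b : Space N k, heat t a b ≤ A * t ^ (-(((N : ℝ) + 2 * k) / 2)) := by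
  obtain ⟨A, hA, h⟩ := exists_kernel_le N k hN
  exact ⟨A, hA, fun t ht a b => h _ _ _ t ht⟩

theorem measurable_heat (hN : 1 ≤ N) {t : ℝ} (ht : 0 < t) :
    Measurable (Function.uncurry (heat (N := N) (k := k) t)) := by
  have h : Measurable fun q : Space N k × Space N k => (q.1.1, q.2.1, q.1.2 - q.2.2) := by fun_prop
  have h2 := (measurable_kernel (k := k) hN ht).comp h
  exact h2

theorem measurable_heat_right (hN : 1 ≤ N) {t : ℝ} (ht : 0 < t) (a : Space N k) :
    Measurable (heat t a) :=
  (measurable_heat hN ht).of_uncurry_left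

theorem tendsto_heat (hN : 1 ≤ N) {t₀ : ℝ} (ht₀ : 0 < t₀) (a b : Space N k) :
    Tendsto (fun t => heat t a b) (𝓝 t₀) (𝓝 (heat t₀ a b)) :=
  tendsto_kernel hN _ _ _ ht₀

theorem lintegral_heat_mul {t : ℝ} (hN : 1 ≤ N) (ht : 0 < t) (a : Space N k)
    {g : EuclideanSpace ℝ (Fin N) → EuclideanSpace ℝ (Fin k) → ℝ}
    (hg : Measurable (Function.uncurry g)) :
    ∫⁻ b, ENNReal.ofReal (heat t a b * g b.1 (a.2 - b.2)) =
      ∫⁻ w, ∫⁻ y, ENNReal.ofReal (kernel a.1 w y t * g w y) := by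
  rw [Measure.volume_eq_prod, lintegral_prod]
  · refine lintegral_congr fun w => ?_
    exact lintegral_sub_left_eq_self (fun y => ENNReal.ofReal (kernel a.1 w y t * g w y)) a.2
  · have h : Measurable fun b : Space N k => (b.1, a.2 - b.2) := by fun_prop
    have h2 := hg.comp h
    exact ((measurable_heat_right hN ht a).mul h2).ennreal_ofReal.aemeasurable

theorem lintegral_heat_mul_exp (hN : 1 ≤ N) (hk : 1 ≤ k) {t s : ℝ} (ht : 0 < t) (hs : 0 < s)
    (a : Space N k) :
    ∫⁻ b, ENNReal.ofReal (heat t a b * Real.exp (-(s ^ 2 / 2) * ‖a.2 - b.2‖ ^ 2)) =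
      ∫⁻ η : EuclideanSpace ℝ (Fin k), ENNReal.ofReal (mass a.1 t (s * ‖η‖)) * gauss η := by
  rw [← lintegral_lintegral_kernel_mul_exp hN hk a.1 ht hs]
  exact lintegral_heat_mul hN ht a (g := fun _ y => Real.exp (-(s ^ 2 / 2) * ‖y‖ ^ 2))
    (by unfold Function.uncurry; fun_prop)

/-- The integrals with cutoff increase to the left side by monotone convergence, and tend to `1` by
`tendsto_lintegral_mass`. -/
theorem lintegral_heat (hN : 1 ≤ N) (hk : 1 ≤ k) {t : ℝ} (ht : 0 < t) (a : Space N k) :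
    ∫⁻ b, ENNReal.ofReal (heat t a b) = 1 := by
  have h1 : Tendsto (fun n : ℕ => ∫⁻ b, ENNReal.ofReal (heat t a b *
      Real.exp (-((1 / ((n : ℝ) + 1)) ^ 2 / 2) * ‖a.2 - b.2‖ ^ 2))) atTop
      (𝓝 (∫⁻ b, ENNReal.ofReal (heat t a b))) := by
    refine lintegral_tendsto_of_tendsto_of_monotone (fun n => ?_)
      (ae_of_all _ fun b m n hmn => ?_) (ae_of_all _ fun b => ?_)
    · have h2 : Measurable fun b : Space N k =>
        Real.exp (-((1 / ((n : ℝ) + 1)) ^ 2 / 2) * ‖a.2 - b.2‖ ^ 2) := by fun_prop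
      exact ((measurable_heat_right hN ht a).mul h2).ennreal_ofReal.aemeasurable
    · exact ENNReal.ofReal_le_ofReal (mul_le_mul_of_nonneg_left (monotone_exp_weight _ hmn)
        (heat_nonneg hN hk ht a b))
    · simpa using ENNReal.tendsto_ofReal ((tendsto_exp_weight (a.2 - b.2)).const_mul (heat t a b))
  have h2 := tendsto_lintegral_mass (k := k) (l := atTop) a.1 (t := fun _ : ℕ => t)
    (s := fun n : ℕ => 1 / ((n : ℝ) + 1)) (Eventually.of_forall fun _ => ht.le)
    (Eventually.of_forall fun _ => by positivity) tendsto_const_nhds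
    tendsto_one_div_add_atTop_nhds_zero_nat (Or.inr rfl)
  refine tendsto_nhds_unique h1 (h2.congr fun n => ?_)
  rw [lintegral_heat_mul_exp hN hk ht (by positivity)]

theorem lintegral_heat_left (hN : 1 ≤ N) (hk : 1 ≤ k) {t : ℝ} (ht : 0 < t) (b : Space N k) :
    ∫⁻ a, ENNReal.ofReal (heat t a b) = 1 := by
  simp only [heat_comm hN ht _ b]
  exact lintegral_heat hN hk ht b

theorem integrable_heat (hN : 1 ≤ N) (hk : 1 ≤ k) {t : ℝ} (ht : 0 < t) (a : Space N k) :
    Integrable (heat t a) := by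
  refine ⟨(measurable_heat_right hN ht a).aestronglyMeasurable, ?_⟩
  rw [hasFiniteIntegral_iff_ofReal (ae_of_all _ fun b => heat_nonneg hN hk ht a b),
    lintegral_heat hN hk ht]
  exact ENNReal.one_lt_top

theorem integral_heat (hN : 1 ≤ N) (hk : 1 ≤ k) {t : ℝ} (ht : 0 < t) (a : Space N k) :
    ∫ b, heat t a b = 1 := by
  rw [integral_eq_lintegral_of_nonneg_ae (ae_of_all _ fun b => heat_nonneg hN hk ht a b)
    (measurable_heat_right hN ht a).aestronglyMeasurable, lintegral_heat hN hk ht]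
  rfl

/-- Concentration in the second variable: the mass weighted by the fixed cutoff `s = 1` tends to the
full mass `1`. -/
theorem tendsto_integral_heat_snd (hN : 1 ≤ N) (hk : 1 ≤ k) (a : Space N k) :
    Tendsto (fun t => ∫ b, heat t a b * (1 - Real.exp (-(1 / 2) * ‖a.2 - b.2‖ ^ 2))) (𝓝[>] 0)
      (𝓝 0) := by
  have h2 := tendsto_lintegral_mass (k := k) (l := 𝓝[>] (0 : ℝ)) a.1 (t := fun t => t)
    (s := fun _ => 1) (eventually_nhdsWithin_of_forall fun t (ht : 0 < t) => ht.le)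
    (Eventually.of_forall fun _ => zero_le_one) (tendsto_nhdsWithin_of_tendsto_nhds tendsto_id)
    tendsto_const_nhds (Or.inl rfl)
  have h3 := ((ENNReal.tendsto_toReal ENNReal.one_ne_top).comp h2).const_sub 1
  simp only [ENNReal.toReal_one, sub_self] at h3
  refine h3.congr' ?_
  filter_upwards [self_mem_nhdsWithin] with t (ht : 0 < t)
  have hm : Measurable fun b : Space N k => Real.exp (-(1 / 2) * ‖a.2 - b.2‖ ^ 2) := by fun_prop
  have hi : Integrable fun b => heat t a b * Real.exp (-(1 / 2) * ‖a.2 - b.2‖ ^ 2) := by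
    refine (integrable_heat hN hk ht a).mul_bdd (c := 1) hm.aestronglyMeasurable
      (ae_of_all _ fun b => ?_)
    rw [Real.norm_of_nonneg (Real.exp_pos _).le, Real.exp_le_one_iff, neg_mul, Left.neg_nonpos_iff]
    positivity
  simp only [mul_sub, mul_one]
  rw [integral_sub (integrable_heat hN hk ht a) hi, integral_heat hN hk ht]
  congr 1
  have h4 := lintegral_heat_mul_exp hN hk ht one_pos a
  rw [one_pow] at h4
  rw [integral_eq_lintegral_of_nonneg_ae (ae_of_all _ fun b => mul_nonneg (heat_nonneg hN hk ht a b)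
    (Real.exp_pos _).le) hi.aestronglyMeasurable, h4]
  rfl

/-- Concentration in the first variable: the marginal is dominated by the Euclidean heat kernel, for
which the right side is the exact value. -/
theorem integral_heat_fst_le (hN : 1 ≤ N) (hk : 1 ≤ k) {t : ℝ} (ht : 0 < t) (a : Space N k) :
    ∫ b, heat t a b * (1 - Real.exp (-(1 / 2) * ‖b.1 - a.1‖ ^ 2)) ≤
      1 - (1 + t) ^ (-((N : ℝ) / 2)) := by
  have hle : ∀ w : EuclideanSpace ℝ (Fin N), 0 ≤ 1 - Real.exp (-(1 / 2) * ‖w - a.1‖ ^ 2) := by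
    intro w
    rw [sub_nonneg, Real.exp_le_one_iff, neg_mul, Left.neg_nonpos_iff]
    positivity
  have hm : Measurable fun b : Space N k => 1 - Real.exp (-(1 / 2) * ‖b.1 - a.1‖ ^ 2) := by fun_prop
  have hpow : (1 + t) ^ (-((N : ℝ) / 2)) ≤ 1 :=
    Real.rpow_le_one_of_one_le_of_nonpos (by linarith) (by
      have : (0 : ℝ) ≤ N := by positivity
      linarith)
  rw [integral_eq_lintegral_of_nonneg_ae (ae_of_all _ fun b => mul_nonneg (heat_nonneg hN hk ht a b)
    (hle _)) ((measurable_heat_right hN ht a).mul hm).aestronglyMeasurable]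
  refine ENNReal.toReal_le_of_le_ofReal (by linarith) ?_
  have h1 := lintegral_heat_mul hN ht a (g := fun w _ => 1 - Real.exp (-(1 / 2) * ‖w - a.1‖ ^ 2))
    (by unfold Function.uncurry; fun_prop)
  rw [h1]
  have e1 := (integrable_exp_neg_mul_sq_norm (V := EuclideanSpace ℝ (Fin N))
    (by positivity : 0 < 1 / (2 * t))).comp_sub_right a.1
  have e2 := (integrable_exp_neg_mul_sq_norm (V := EuclideanSpace ℝ (Fin N))
    (by positivity : 0 < 1 / (2 * t) + 1 / 2)).comp_sub_right a.1
  calc ∫⁻ w, ∫⁻ y, ENNReal.ofReal (kernel a.1 w y t * (1 - Real.exp (-(1 / 2) * ‖w - a.1‖ ^ 2)))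
      ≤ ∫⁻ w, ENNReal.ofReal ((2 * Real.pi * t) ^ (-((N : ℝ) / 2)) *
          (Real.exp (-(1 / (2 * t)) * ‖w - a.1‖ ^ 2) -
            Real.exp (-(1 / (2 * t) + 1 / 2) * ‖w - a.1‖ ^ 2))) := by
        refine lintegral_mono fun w => ?_
        simp only [ENNReal.ofReal_mul' (hle w)]
        rw [lintegral_mul_const' _ _ ENNReal.ofReal_ne_top]
        refine (mul_le_mul_left (lintegral_kernel_le hN hk a.1 w ht) _).trans_eq ?_
        rw [← ENNReal.ofReal_mul' (hle w), mul_assoc, mul_sub, mul_one, ← Real.exp_add]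
        ring_nf
    _ = ENNReal.ofReal (1 - (1 + t) ^ (-((N : ℝ) / 2))) := by
        have e3 : Integrable fun w => (2 * Real.pi * t) ^ (-((N : ℝ) / 2)) *
          (Real.exp (-(1 / (2 * t)) * ‖w - a.1‖ ^ 2) -
            Real.exp (-(1 / (2 * t) + 1 / 2) * ‖w - a.1‖ ^ 2)) := (e1.sub e2).const_mul _
        rw [← ofReal_integral_eq_lintegral_ofReal e3 (ae_of_all _ fun w => ?_),
          integral_const_mul, integral_sub e1 e2,
          integral_sub_right_eq_self (fun w => Real.exp (-(1 / (2 * t)) * ‖w‖ ^ 2)) a.1,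
          integral_sub_right_eq_self (fun w => Real.exp (-(1 / (2 * t) + 1 / 2) * ‖w‖ ^ 2)) a.1,
          GaussianFourier.integral_rexp_neg_mul_sq_norm (by positivity),
          GaussianFourier.integral_rexp_neg_mul_sq_norm (by positivity), finrank_euclideanSpace_fin]
        · congr 1
          have h1 : Real.pi / (1 / (2 * t)) = 2 * Real.pi * t := by field_simp
          have h2 : Real.pi / (1 / (2 * t) + 1 / 2) = 2 * Real.pi * t / (1 + t) := by field_simp
          rw [h1, h2, Real.div_rpow (by positivity) (by positivity), Real.rpow_neg (by positivity),
            Real.rpow_neg (by positivity)]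
          have : (2 * Real.pi * t) ^ ((N : ℝ) / 2) ≠ 0 := by positivity
          field_simp
        · simp only [Pi.zero_apply]
          refine mul_nonneg (by positivity) (sub_nonneg.2 ?_)
          gcongr
          linarith

theorem tendsto_integral_heat_fst (hN : 1 ≤ N) (hk : 1 ≤ k) (a : Space N k) :
    Tendsto (fun t => ∫ b, heat t a b * (1 - Real.exp (-(1 / 2) * ‖b.1 - a.1‖ ^ 2))) (𝓝[>] 0)
      (𝓝 0) := by
  have h1 : Tendsto (fun t : ℝ => 1 - (1 + t) ^ (-((N : ℝ) / 2))) (𝓝[>] 0) (𝓝 0) := by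
    have : ContinuousAt (fun t : ℝ => 1 - (1 + t) ^ (-((N : ℝ) / 2))) 0 := by
      refine continuousAt_const.sub (ContinuousAt.rpow_const (by fun_prop) (Or.inl (by norm_num)))
    have h := this.tendsto
    simp only [add_zero, Real.one_rpow, sub_self] at h
    exact tendsto_nhdsWithin_of_tendsto_nhds h
  refine tendsto_of_tendsto_of_tendsto_of_le_of_le' tendsto_const_nhds h1 ?_ ?_
  · filter_upwards [self_mem_nhdsWithin] with t (ht : 0 < t)
    refine integral_nonneg fun b => mul_nonneg (heat_nonneg hN hk ht a b) ?_
    rw [sub_nonneg, Real.exp_le_one_iff, neg_mul, Left.neg_nonpos_iff]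
    positivity
  · filter_upwards [self_mem_nhdsWithin] with t (ht : 0 < t)
    exact integral_heat_fst_le hN hk ht a

end HeatKernel

/-! ### Integral operators with a bounded bistochastic kernel -/

section KernelOperator

variable {Ω : Type*} [MeasurableSpace Ω] {μ : Measure Ω} [SigmaFinite μ]

/-- A nonnegative measurable kernel with both marginals equal to `1`, bounded by `A`. -/
structure Bistochastic (μ : Measure Ω) (κ : Ω → Ω → ℝ) (A : ℝ) : Prop where
  measurable : Measurable (Function.uncurry κ)
  nonneg : ∀ a b, 0 ≤ κ a b
  lintegral_right : ∀ a, ∫⁻ b, ENNReal.ofReal (κ a b) ∂μ = 1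
  lintegral_left : ∀ b, ∫⁻ a, ENNReal.ofReal (κ a b) ∂μ = 1
  le : ∀ a b, κ a b ≤ A

variable {κ : Ω → Ω → ℝ} {A : ℝ} {p q : ℝ≥0∞}

omit [SigmaFinite μ] in
-- `κ a ·` is the density of a probability measure, for which `L^1` norms are at most `L^r` norms.
theorem Bistochastic.jensen (h : Bistochastic μ κ A) {r : ℝ} (hr : 1 ≤ r) {φ : Ω → ℝ}
    (hφ : AEStronglyMeasurable φ μ) (a : Ω) :
    (∫⁻ b, ENNReal.ofReal (κ a b) * ‖φ b‖ₑ ∂μ) ^ r ≤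
      ∫⁻ b, ENNReal.ofReal (κ a b) * ‖φ b‖ₑ ^ r ∂μ := by
  have hm : Measurable fun b => ENNReal.ofReal (κ a b) := h.measurable.of_uncurry_left.ennreal_ofReal
  set ν := μ.withDensity fun b => ENNReal.ofReal (κ a b)
  have : IsProbabilityMeasure ν :=
    ⟨by rw [withDensity_apply _ MeasurableSet.univ, Measure.restrict_univ, h.lintegral_right]⟩
  have h1 := eLpNorm'_le_eLpNorm'_of_exponent_le (f := φ) one_pos hr ν
    (hφ.mono_ac (withDensity_absolutelyContinuous _ _))
  simp only [eLpNorm'_eq_lintegral_enorm, ENNReal.rpow_one, div_one] at h1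
  have e : ∀ g : Ω → ℝ≥0∞, ∫⁻ b, g b ∂ν = ∫⁻ b, ENNReal.ofReal (κ a b) * g b ∂μ := fun g =>
    lintegral_withDensity_eq_lintegral_mul_non_measurable μ hm
      (ae_of_all _ fun _ => ENNReal.ofReal_lt_top) g
  rw [e, e] at h1
  calc _ ≤ ((∫⁻ b, ENNReal.ofReal (κ a b) * ‖φ b‖ₑ ^ r ∂μ) ^ (1 / r)) ^ r := by gcongr
    _ = _ := by rw [← ENNReal.rpow_mul, one_div_mul_cancel (by positivity), ENNReal.rpow_one]

omit [SigmaFinite μ] in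
theorem Bistochastic.lintegral_le (h : Bistochastic μ κ A) (g : Ω → ℝ≥0∞) (a : Ω) :
    ∫⁻ b, ENNReal.ofReal (κ a b) * g b ∂μ ≤ ENNReal.ofReal A * ∫⁻ b, g b ∂μ := by
  rw [← lintegral_const_mul' _ _ ENNReal.ofReal_ne_top]
  exact lintegral_mono fun b => mul_le_mul_left (ENNReal.ofReal_le_ofReal (h.le a b)) _

theorem Bistochastic.lintegral_lintegral (h : Bistochastic μ κ A) {g : Ω → ℝ≥0∞} (hg : AEMeasurable g μ) :
    ∫⁻ a, ∫⁻ b, ENNReal.ofReal (κ a b) * g b ∂μ ∂μ = ∫⁻ b, g b ∂μ := by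
  rw [lintegral_lintegral_swap]
  · refine lintegral_congr fun b => ?_
    rw [lintegral_mul_const _ h.measurable.of_uncurry_right.ennreal_ofReal, h.lintegral_left, one_mul]
  · exact h.measurable.ennreal_ofReal.aemeasurable.mul hg.comp_snd

omit [SigmaFinite μ] in
theorem Bistochastic.enorm_kernel_mul (h : Bistochastic μ κ A) (φ : Ω → ℝ) (a b : Ω) :
    ‖κ a b * φ b‖ₑ = ENNReal.ofReal (κ a b) * ‖φ b‖ₑ := by
  rw [enorm_mul, Real.enorm_of_nonneg (h.nonneg a b)]

omit [SigmaFinite μ] in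
theorem lintegral_rpow_lt_top_of_memLp {φ : Ω → ℝ} (hp : 1 ≤ p) (hp' : p ≠ ∞) (hφ : MemLp φ p μ) :
    ∫⁻ b, ‖φ b‖ₑ ^ p.toReal ∂μ < ∞ :=
  lintegral_rpow_enorm_lt_top_of_eLpNorm_lt_top (by positivity) hp' hφ.2

omit [SigmaFinite μ] in
theorem one_le_toReal (hp : 1 ≤ p) (hp' : p ≠ ∞) : 1 ≤ p.toReal := by
  simpa using ENNReal.toReal_mono hp' hp

omit [SigmaFinite μ] in
theorem Bistochastic.integrable (h : Bistochastic μ κ A) (hp : 1 ≤ p) (hp' : p ≠ ∞) {φ : Ω → ℝ}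
    (hφ : MemLp φ p μ) (a : Ω) : Integrable (fun b => κ a b * φ b) μ := by
  refine ⟨h.measurable.of_uncurry_left.aestronglyMeasurable.mul hφ.1, ?_⟩
  unfold HasFiniteIntegral
  simp only [h.enorm_kernel_mul]
  have hr := one_le_toReal hp hp'
  refine (ENNReal.rpow_lt_top_iff_of_pos (by linarith : 0 < p.toReal)).1 ?_
  refine (h.jensen hr hφ.1 a).trans_lt ((h.lintegral_le _ a).trans_lt ?_)
  exact ENNReal.mul_lt_top ENNReal.ofReal_lt_top (lintegral_rpow_lt_top_of_memLp hp hp' hφ)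

/-- The integral operator with kernel `κ`. -/
noncomputable def kernelInt (μ : Measure Ω) (κ : Ω → Ω → ℝ) (φ : Ω → ℝ) (a : Ω) : ℝ :=
  ∫ b, κ a b * φ b ∂μ

theorem Bistochastic.aestronglyMeasurable (h : Bistochastic μ κ A) {φ : Ω → ℝ}
    (hφ : AEStronglyMeasurable φ μ) : AEStronglyMeasurable (kernelInt μ κ φ) μ :=
  AEStronglyMeasurable.integral_prod_right' (f := fun q : Ω × Ω => κ q.1 q.2 * φ q.2)
    (h.measurable.aestronglyMeasurable.mul hφ.comp_snd)

omit [SigmaFinite μ] in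
theorem Bistochastic.enorm_kernelInt_rpow_le (h : Bistochastic μ κ A) {r : ℝ} (hr : 1 ≤ r) {φ : Ω → ℝ}
    (hφ : AEStronglyMeasurable φ μ) (a : Ω) :
    ‖kernelInt μ κ φ a‖ₑ ^ r ≤ ∫⁻ b, ENNReal.ofReal (κ a b) * ‖φ b‖ₑ ^ r ∂μ := by
  refine le_trans ?_ (h.jensen hr hφ a)
  simp only [← h.enorm_kernel_mul]
  exact ENNReal.rpow_le_rpow (enorm_integral_le_lintegral_enorm _) (by linarith)

/-- Write `|Kφ|^q` as `(|Kφ|^p)^{q/p-1} |Kφ|^p`. By Jensen and `κ ≤ A` the first factor is at most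
`(A ∫|φ|^p)^{q/p-1}`; the second integrates to at most `∫|φ|^p` by Jensen and the left marginal. -/
theorem Bistochastic.eLpNorm_le (h : Bistochastic μ κ A) (hA : 0 < A) (hp : 1 ≤ p) (hq' : q ≠ ∞)
    (hpq : p ≤ q) {φ : Ω → ℝ} (hφ : AEStronglyMeasurable φ μ) :
    eLpNorm (kernelInt μ κ φ) q μ ≤
      ENNReal.ofReal (A ^ (1 / p.toReal - 1 / q.toReal)) * eLpNorm φ p μ := by
  have hp' : p ≠ ∞ := ne_top_of_le_ne_top hq' hpq
  have hr := one_le_toReal hp hp'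
  have hr0 : 0 < p.toReal := by linarith
  have hrs : p.toReal ≤ q.toReal := ENNReal.toReal_mono hq' hpq
  have hs0 : 0 < q.toReal := by linarith
  rw [eLpNorm_eq_lintegral_rpow_enorm_toReal (by positivity) hp',
    eLpNorm_eq_lintegral_rpow_enorm_toReal (hp.trans hpq |> fun h => by positivity) hq']
  set I := ∫⁻ b, ‖φ b‖ₑ ^ p.toReal ∂μ with hI
  have hm : AEMeasurable (fun b => ‖φ b‖ₑ ^ p.toReal) μ := hφ.enorm.pow_const _
  have hpt : ∀ a, ‖kernelInt μ κ φ a‖ₑ ^ q.toReal ≤ (ENNReal.ofReal A * I) ^ (q.toReal / p.toReal - 1) *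
      ∫⁻ b, ENNReal.ofReal (κ a b) * ‖φ b‖ₑ ^ p.toReal ∂μ := by
    intro a
    have h1 := h.enorm_kernelInt_rpow_le hr hφ a
    have h2 : 0 ≤ q.toReal / p.toReal - 1 := by
      rw [sub_nonneg, one_le_div hr0]; exact hrs
    calc ‖kernelInt μ κ φ a‖ₑ ^ q.toReal =
        (‖kernelInt μ κ φ a‖ₑ ^ p.toReal) ^ (q.toReal / p.toReal - 1) * ‖kernelInt μ κ φ a‖ₑ ^ p.toReal := by
          rw [← ENNReal.rpow_mul, ← ENNReal.rpow_add_of_nonneg _ _ (by positivity) hr0.le]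
          congr 1; field_simp; ring
      _ ≤ _ := by
          refine mul_le_mul' (ENNReal.rpow_le_rpow (h1.trans (h.lintegral_le _ a)) h2) h1
  have h2 : 0 ≤ q.toReal / p.toReal - 1 := by
    rw [sub_nonneg, one_le_div hr0]; exact hrs
  have h3 : ∫⁻ a, ‖kernelInt μ κ φ a‖ₑ ^ q.toReal ∂μ ≤
      ENNReal.ofReal A ^ (q.toReal / p.toReal - 1) * I ^ (q.toReal / p.toReal) := by
    refine (lintegral_mono hpt).trans ?_
    rw [lintegral_const_mul'', h.lintegral_lintegral hm, ← hI, ENNReal.mul_rpow_of_nonneg _ _ h2, mul_assoc]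
    · refine mul_le_mul' le_rfl ?_
      nth_rewrite 2 [← ENNReal.rpow_one I]
      rw [← ENNReal.rpow_add_of_nonneg _ _ h2 zero_le_one, sub_add_cancel]
    · exact (h.measurable.ennreal_ofReal.aemeasurable.mul hm.comp_snd).lintegral_prod_right'
  calc _ ≤ (ENNReal.ofReal A ^ (q.toReal / p.toReal - 1) * I ^ (q.toReal / p.toReal)) ^ (1 / q.toReal) :=
        ENNReal.rpow_le_rpow h3 (by positivity)
    _ = _ := by
        rw [ENNReal.mul_rpow_of_nonneg _ _ (by positivity), ← ENNReal.rpow_mul, ← ENNReal.rpow_mul,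
          ENNReal.ofReal_rpow_of_pos hA]
        have e1 : (q.toReal / p.toReal - 1) * (1 / q.toReal) = 1 / p.toReal - 1 / q.toReal := by
          field_simp
        have e2 : q.toReal / p.toReal * (1 / q.toReal) = 1 / p.toReal := by field_simp
        rw [e1, e2]

theorem Bistochastic.memLp (h : Bistochastic μ κ A) (hA : 0 < A) (hp : 1 ≤ p) (hq' : q ≠ ∞)
    (hpq : p ≤ q) {φ : Ω → ℝ} (hφ : MemLp φ p μ) : MemLp (kernelInt μ κ φ) q μ :=
  ⟨h.aestronglyMeasurable hφ.1, (h.eLpNorm_le hA hp hq' hpq hφ.1).trans_lt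
    (ENNReal.mul_lt_top ENNReal.ofReal_lt_top hφ.2)⟩

omit [SigmaFinite μ] in
theorem kernelInt_congr {φ ψ : Ω → ℝ} (h : φ =ᵐ[μ] ψ) : kernelInt μ κ φ = kernelInt μ κ ψ := by
  ext a
  refine integral_congr_ae ?_
  filter_upwards [h] with b hb
  rw [hb]

/-- The integral operator with kernel `κ`, from `L^p` to `L^q`, `1 ≤ p ≤ q < ∞`. -/
noncomputable def Bistochastic.op (h : Bistochastic μ κ A) (hA : 0 < A) [Fact (1 ≤ p)] [Fact (1 ≤ q)]
    (hq : q ≠ ∞) (hpq : p ≤ q) : Lp ℝ p μ →L[ℝ] Lp ℝ q μ :=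
  LinearMap.mkContinuous
    { toFun := fun φ => (h.memLp hA (Fact.out : 1 ≤ p) hq hpq (Lp.memLp φ)).toLp _
      map_add' := fun φ ψ => by
        rw [← MemLp.toLp_add]
        congr 1
        rw [kernelInt_congr (Lp.coeFn_add φ ψ)]
        ext a
        simp only [kernelInt, Pi.add_apply, mul_add]
        exact integral_add (h.integrable Fact.out (ne_top_of_le_ne_top hq hpq) (Lp.memLp φ) a)
          (h.integrable Fact.out (ne_top_of_le_ne_top hq hpq) (Lp.memLp ψ) a)
      map_smul' := fun c φ => by
        rw [RingHom.id_apply, ← MemLp.toLp_const_smul]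
        congr 1
        rw [kernelInt_congr (Lp.coeFn_smul c φ)]
        ext a
        simp only [kernelInt, Pi.smul_apply, smul_eq_mul, mul_left_comm _ c]
        exact integral_const_mul _ _ }
    (A ^ (1 / p.toReal - 1 / q.toReal)) fun φ => by
      simp only [LinearMap.coe_mk, AddHom.coe_mk]
      rw [Lp.norm_toLp, Lp.norm_def, ← ENNReal.toReal_ofReal (by positivity :
        0 ≤ A ^ (1 / p.toReal - 1 / q.toReal)), ← ENNReal.toReal_mul]
      exact ENNReal.toReal_mono (ENNReal.mul_ne_top ENNReal.ofReal_ne_top (Lp.eLpNorm_ne_top φ))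
        (h.eLpNorm_le hA Fact.out hq hpq (Lp.aestronglyMeasurable φ))

theorem Bistochastic.coeFn_op (h : Bistochastic μ κ A) (hA : 0 < A) [Fact (1 ≤ p)] [Fact (1 ≤ q)]
    (hq : q ≠ ∞) (hpq : p ≤ q) (φ : Lp ℝ p μ) : h.op hA hq hpq φ =ᵐ[μ] kernelInt μ κ φ :=
  MemLp.coeFn_toLp (h.memLp hA (Fact.out : 1 ≤ p) hq hpq (Lp.memLp φ))

theorem Bistochastic.norm_op_le (h : Bistochastic μ κ A) (hA : 0 < A) [Fact (1 ≤ p)] [Fact (1 ≤ q)]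
    (hq : q ≠ ∞) (hpq : p ≤ q) :
    ‖(h.op hA hq hpq : Lp ℝ p μ →L[ℝ] Lp ℝ q μ)‖ ≤ A ^ (1 / p.toReal - 1 / q.toReal) :=
  LinearMap.mkContinuous_norm_le _ (by positivity) _

end KernelOperator

/-! ### Tools for strong convergence: density, Scheffé's lemma, passage from `L^1` to `L^q` -/

section StrongConvergence

theorem tendsto_clm_of_dense {ι E F : Type*} [NormedAddCommGroup E] [NormedSpace ℝ E]
    [NormedAddCommGroup F] [NormedSpace ℝ F] {l : Filter ι} {T : ι → E →L[ℝ] F} {T₀ : E →L[ℝ] F}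
    {C : ℝ} (hC : ∀ᶠ i in l, ‖T i‖ ≤ C) {s : Set E} (hs : Dense s)
    (h : ∀ x ∈ s, Tendsto (fun i => T i x) l (𝓝 (T₀ x))) (x : E) :
    Tendsto (fun i => T i x) l (𝓝 (T₀ x)) := by
  set D := max C ‖T₀‖ + 1
  have hD : 0 < D := by
    have : 0 ≤ max C ‖T₀‖ := (norm_nonneg T₀).trans (le_max_right _ _)
    positivity
  refine Metric.tendsto_nhds.2 fun ε hε => ?_
  obtain ⟨y, hy, hxy⟩ := Metric.dense_iff.1 hs x (ε / (4 * D)) (by positivity)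
  filter_upwards [hC, Metric.tendsto_nhds.1 (h y hxy) (ε / 2) (by positivity)] with i hi hi'
  rw [Metric.mem_ball] at hy
  have hb : ∀ S : E →L[ℝ] F, ‖S‖ ≤ D → dist (S x) (S y) < ε / 4 := by
    intro S hS
    rw [dist_eq_norm, ← map_sub]
    calc ‖S (x - y)‖ ≤ D * ‖x - y‖ := (S.le_opNorm _).trans (by gcongr)
      _ < D * (ε / (4 * D)) := by
        rw [dist_comm, dist_eq_norm] at hy
        gcongr
      _ = ε / 4 := by field_simp
  have h1 := hb (T i) (by linarith [le_max_left C ‖T₀‖])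
  have h2 := hb T₀ (by linarith [le_max_right C ‖T₀‖])
  rw [dist_comm] at h2
  linarith [dist_triangle4 (T i x) (T i y) (T₀ y) (T₀ x)]

variable {Ω ι : Type*} [MeasurableSpace Ω] {μ : Measure Ω} {l : Filter ι} [l.IsCountablyGenerated]

/-- Scheffé's lemma: `|f-g| = 2(g-f)⁺ + (f-g)`, where the first term is dominated by `2g` and the
second has integral zero. -/
theorem tendsto_lintegral_sub_of_tendsto_ae {f : ι → Ω → ℝ} {g : Ω → ℝ}
    (hf : ∀ᶠ i in l, Integrable (f i) μ) (hg : Integrable g μ) (hf0 : ∀ᶠ i in l, ∀ a, 0 ≤ f i a)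
    (hg0 : ∀ a, 0 ≤ g a) (hfg : ∀ᶠ i in l, ∫ a, f i a ∂μ = ∫ a, g a ∂μ)
    (hlim : ∀ a, Tendsto (fun i => f i a) l (𝓝 (g a))) :
    Tendsto (fun i => ∫ a, |f i a - g a| ∂μ) l (𝓝 0) := by
  have h1 : Tendsto (fun i => ∫ a, max (g a - f i a) 0 ∂μ) l (𝓝 (∫ _a, (0 : ℝ) ∂μ)) := by
    refine tendsto_integral_filter_of_dominated_convergence g ?_ ?_ hg (ae_of_all _ fun a => ?_)
    · filter_upwards [hf] with i hi
      exact ((hg.sub hi).pos_part).aestronglyMeasurable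
    · filter_upwards [hf0] with i hi
      refine ae_of_all _ fun a => ?_
      rw [Real.norm_of_nonneg (le_max_right _ _)]
      exact max_le (by linarith [hi a]) (hg0 a)
    · have := ((hlim a).const_sub (g a)).max (tendsto_const_nhds (x := (0 : ℝ)))
      simpa using this
  have h2 := h1.const_mul 2
  simp only [integral_zero, mul_zero] at h2
  refine h2.congr' ?_
  filter_upwards [hf, hfg] with i hi hi'
  have e : ∀ a, |f i a - g a| = 2 * max (g a - f i a) 0 + (f i a - g a) := by
    intro a
    rcases le_total (g a) (f i a) with h | h
    · rw [max_eq_right (by linarith), abs_of_nonneg (by linarith)]; ring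
    · rw [max_eq_left (by linarith), abs_of_nonpos (by linarith)]; ring
  have i1 : Integrable (fun a => 2 * max (g a - f i a) 0) μ := ((hg.sub hi).pos_part).const_mul 2
  have i2 : Integrable (fun a => f i a - g a) μ := hi.sub hg
  simp only [e]
  rw [integral_add i1 i2, integral_const_mul,
    integral_sub hi hg, hi', sub_self, add_zero]

omit [l.IsCountablyGenerated] in
-- `|f-g|^q ≤ B^{q-1} |f-g|`.
theorem tendsto_eLpNorm_sub_of_bounded {f : ι → Ω → ℝ} {g : Ω → ℝ} {B : ℝ} {q : ℝ≥0∞} (hq : 1 ≤ q)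
    (hq' : q ≠ ∞) (hf : ∀ᶠ i in l, Integrable (f i) μ) (hg : Integrable g μ)
    (hB : ∀ᶠ i in l, ∀ a, |f i a - g a| ≤ B)
    (h : Tendsto (fun i => ∫ a, |f i a - g a| ∂μ) l (𝓝 0)) :
    Tendsto (fun i => eLpNorm (f i - g) q μ) l (𝓝 0) := by
  have hr := one_le_toReal hq hq'
  have h1 : Tendsto (fun i => (ENNReal.ofReal B ^ (q.toReal - 1) *
      ENNReal.ofReal (∫ a, |f i a - g a| ∂μ)) ^ (1 / q.toReal)) l (𝓝 0) := by
    have h2 := ENNReal.Tendsto.const_mul (a := ENNReal.ofReal B ^ (q.toReal - 1))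
      (ENNReal.tendsto_ofReal h) (Or.inr (ENNReal.rpow_ne_top_of_nonneg (by linarith) ENNReal.ofReal_ne_top))
    rw [ENNReal.ofReal_zero, mul_zero] at h2
    have h3 := h2.ennrpow_const (1 / q.toReal)
    rwa [ENNReal.zero_rpow_of_pos (by positivity)] at h3
  refine tendsto_of_tendsto_of_tendsto_of_le_of_le' tendsto_const_nhds h1
    (Eventually.of_forall fun _ => zero_le) ?_
  filter_upwards [hf, hB] with i hi hBi
  rw [eLpNorm_eq_lintegral_rpow_enorm_toReal (by positivity) hq']
  refine ENNReal.rpow_le_rpow ?_ (by positivity)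
  have hn : ∫⁻ a, ‖f i a - g a‖ₑ ∂μ = ENNReal.ofReal (∫ a, |f i a - g a| ∂μ) := by
    have i1 : Integrable (fun a => |f i a - g a|) μ := (hi.sub hg).abs
    rw [ofReal_integral_eq_lintegral_ofReal i1 (ae_of_all _ fun _ => abs_nonneg _)]
    refine lintegral_congr fun a => ?_
    rw [← Real.enorm_eq_ofReal_abs]
  rw [← hn, ← lintegral_const_mul' _ _
    (ENNReal.rpow_ne_top_of_nonneg (by linarith) ENNReal.ofReal_ne_top)]
  refine lintegral_mono fun a => ?_
  simp only [Pi.sub_apply]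
  calc ‖f i a - g a‖ₑ ^ q.toReal = ‖f i a - g a‖ₑ ^ (q.toReal - 1) * ‖f i a - g a‖ₑ := by
        nth_rewrite 3 [← ENNReal.rpow_one ‖f i a - g a‖ₑ]
        rw [← ENNReal.rpow_add_of_nonneg _ _ (by linarith) zero_le_one, sub_add_cancel]
    _ ≤ _ := by
        refine mul_le_mul' (ENNReal.rpow_le_rpow ?_ (by linarith)) le_rfl
        rw [Real.enorm_eq_ofReal_abs]
        exact ENNReal.ofReal_le_ofReal (hBi a)

end StrongConvergence

/-! ### Sup bound and conservation of the integral -/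

section KernelIntegral

variable {Ω : Type*} [MeasurableSpace Ω] {μ : Measure Ω} [SigmaFinite μ] {κ : Ω → Ω → ℝ} {A : ℝ}

omit [SigmaFinite μ] in
theorem Bistochastic.abs_kernelInt_le (h : Bistochastic μ κ A) {φ : Ω → ℝ} {B : ℝ} (hB : ∀ b, |φ b| ≤ B)
    (a : Ω) : |kernelInt μ κ φ a| ≤ B := by
  have h0 : 0 ≤ B := (abs_nonneg _).trans (hB a)
  have hm : AEStronglyMeasurable (κ a) μ := h.measurable.of_uncurry_left.aestronglyMeasurable
  have hi : Integrable (κ a) μ := by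
    refine ⟨hm, ?_⟩
    rw [hasFiniteIntegral_iff_ofReal (ae_of_all _ fun b => h.nonneg a b), h.lintegral_right]
    exact ENNReal.one_lt_top
  have h1 : ∫ b, κ a b ∂μ = 1 := by
    rw [integral_eq_lintegral_of_nonneg_ae (ae_of_all _ fun b => h.nonneg a b) hm, h.lintegral_right]
    rfl
  rw [← Real.norm_eq_abs]
  refine (norm_integral_le_of_norm_le (hi.mul_const B) (ae_of_all _ fun b => ?_)).trans_eq ?_
  · rw [norm_mul, Real.norm_of_nonneg (h.nonneg a b)]
    exact mul_le_mul_of_nonneg_left (hB b) (h.nonneg a b)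
  · rw [integral_mul_const, h1, one_mul]

/-- Fubini and the left marginal. Equality of the integrals is the hypothesis that Scheffé's lemma
requires. -/
theorem Bistochastic.integral_kernelInt (h : Bistochastic μ κ A) {φ : Ω → ℝ} (hφ : Integrable φ μ) :
    Integrable (kernelInt μ κ φ) μ ∧ ∫ a, kernelInt μ κ φ a ∂μ = ∫ b, φ b ∂μ := by
  have hm : AEStronglyMeasurable (Function.uncurry fun a b => κ a b * φ b) (μ.prod μ) :=
    h.measurable.aestronglyMeasurable.mul hφ.1.comp_snd
  have hi : Integrable (Function.uncurry fun a b => κ a b * φ b) (μ.prod μ) := by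
    refine ⟨hm, ?_⟩
    unfold HasFiniteIntegral
    rw [lintegral_prod _ hm.enorm]
    simp only [Function.uncurry, h.enorm_kernel_mul]
    rw [h.lintegral_lintegral hφ.1.enorm]
    exact hφ.2
  refine ⟨hi.integral_prod_left, ?_⟩
  unfold kernelInt
  rw [integral_integral_swap hi]
  congr 1 with b
  have hm : AEStronglyMeasurable (fun a => κ a b) μ := h.measurable.of_uncurry_right.aestronglyMeasurable
  rw [integral_mul_const, integral_eq_lintegral_of_nonneg_ae (ae_of_all _ fun a => h.nonneg a b) hm,
    h.lintegral_left, ENNReal.toReal_one, one_mul]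

end KernelIntegral

/-! ### The heat operators from `L^p` to `L^q` and their strong continuity -/

section HeatOperator

variable {N k : ℕ} {p q : ℝ≥0∞}

/-- A constant `A` with `K(x, w, y; t) ≤ A t^{-(N+2k)/2}`. -/
noncomputable def heatBound (N k : ℕ) (hN : 1 ≤ N) : ℝ := Classical.choose (exists_heat_le N k hN)

theorem heatBound_pos (hN : 1 ≤ N) : 0 < heatBound N k hN :=
  (Classical.choose_spec (exists_heat_le N k hN)).1

theorem bistochastic_heat (hN : 1 ≤ N) (hk : 1 ≤ k) {t : ℝ} (ht : 0 < t) :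
    Bistochastic volume (heat (N := N) (k := k) t)
      (heatBound N k hN * t ^ (-(((N : ℝ) + 2 * k) / 2))) where
  measurable := measurable_heat hN ht
  nonneg := heat_nonneg hN hk ht
  lintegral_right := lintegral_heat hN hk ht
  lintegral_left := lintegral_heat_left hN hk ht
  le := (Classical.choose_spec (exists_heat_le N k hN)).2 t ht

theorem heatBound_mul_pos (hN : 1 ≤ N) {t : ℝ} (ht : 0 < t) :
    0 < heatBound N k hN * t ^ (-(((N : ℝ) + 2 * k) / 2)) :=
  mul_pos (heatBound_pos hN) (Real.rpow_pos_of_pos ht _)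

/-- The operator `S(t)` from `L^p` to `L^q`, for `t > 0`. -/
noncomputable def heatOp (hN : 1 ≤ N) (hk : 1 ≤ k) [Fact (1 ≤ p)] [Fact (1 ≤ q)] (hq : q ≠ ∞)
    (hpq : p ≤ q) (t : ℝ) :
    Lp ℝ p (volume : Measure (Space N k)) →L[ℝ] Lp ℝ q (volume : Measure (Space N k)) :=
  if ht : 0 < t then (bistochastic_heat hN hk ht).op (heatBound_mul_pos hN ht) hq hpq else 0

variable [Fact (1 ≤ p)] [Fact (1 ≤ q)]

theorem coeFn_heatOp (hN : 1 ≤ N) (hk : 1 ≤ k) (hq : q ≠ ∞) (hpq : p ≤ q) {t : ℝ} (ht : 0 < t)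
    (φ : Lp ℝ p (volume : Measure (Space N k))) :
    heatOp hN hk hq hpq t φ =ᵐ[volume] kernelInt volume (heat t) φ := by
  rw [heatOp, dif_pos ht]
  exact Bistochastic.coeFn_op _ _ _ _ _

theorem norm_heatOp_le (hN : 1 ≤ N) (hk : 1 ≤ k) (hq : q ≠ ∞) (hpq : p ≤ q) {t : ℝ} (ht : 0 < t) :
    ‖(heatOp hN hk hq hpq t : Lp ℝ p (volume : Measure (Space N k)) →L[ℝ] Lp ℝ q volume)‖ ≤
      heatBound N k hN ^ (1 / p.toReal - 1 / q.toReal) *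
        t ^ (-(((N : ℝ) + 2 * k) / 2 * (1 / p.toReal - 1 / q.toReal))) := by
  rw [heatOp, dif_pos ht]
  refine (Bistochastic.norm_op_le _ _ _ _).trans_eq ?_
  rw [Real.mul_rpow (heatBound_pos hN).le (by positivity), ← Real.rpow_mul ht.le, neg_mul]

theorem norm_heatOp_le_one (hN : 1 ≤ N) (hk : 1 ≤ k) (hp : p ≠ ∞) (t : ℝ) :
    ‖(heatOp hN hk hp le_rfl t : Lp ℝ p (volume : Measure (Space N k)) →L[ℝ] Lp ℝ p volume)‖ ≤ 1 := by
  by_cases ht : 0 < t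
  · simpa using norm_heatOp_le hN hk hp le_rfl ht
  · rw [heatOp, dif_neg ht, norm_zero]
    exact zero_le_one

theorem tendsto_kernelInt_heat (hN : 1 ≤ N) (hk : 1 ≤ k) {t₀ : ℝ} (ht₀ : 0 < t₀) {φ : Space N k → ℝ}
    (hφ : Integrable φ) (a : Space N k) :
    Tendsto (fun t => kernelInt volume (heat t) φ a) (𝓝 t₀) (𝓝 (kernelInt volume (heat t₀) φ a)) := by
  have hev : ∀ᶠ t in 𝓝 t₀, t₀ / 2 < t := lt_mem_nhds (by linarith)
  refine tendsto_integral_filter_of_dominated_convergence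
    (fun b => heatBound N k hN * (t₀ / 2) ^ (-(((N : ℝ) + 2 * k) / 2)) * |φ b|) ?_ ?_
    (hφ.abs.const_mul _) (ae_of_all _ fun b => (tendsto_heat hN ht₀ a b).mul_const _)
  · filter_upwards [hev] with t ht
    exact (measurable_heat_right hN (by linarith) a).aestronglyMeasurable.mul hφ.1
  · filter_upwards [hev] with t ht
    refine ae_of_all _ fun b => ?_
    have h := bistochastic_heat (k := k) hN hk (by linarith : 0 < t)
    rw [norm_mul, Real.norm_of_nonneg (h.nonneg a b), Real.norm_eq_abs]
    refine mul_le_mul_of_nonneg_right ((h.le a b).trans ?_) (abs_nonneg _)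
    refine mul_le_mul_of_nonneg_left ?_ (heatBound_pos hN).le
    refine Real.rpow_le_rpow_of_nonpos (by linarith) ht.le ?_
    rw [Left.neg_nonpos_iff]
    positivity

/-- The kernel is an approximate identity. A point at distance at least `δ` from `a` is that far in
one of the two components, so there one of the weights `g₁`, `g₂` is at least `c`. Hence `|φ b - φ
a| ≤ ε/2 + (2B/c)(g₁ b + g₂ b)` everywhere, and the averages of both weights tend to `0`. -/
theorem tendsto_kernelInt_heat_zero (hN : 1 ≤ N) (hk : 1 ≤ k) {φ : Space N k → ℝ}
    (hφ : Continuous φ) {B : ℝ} (hB : ∀ b, |φ b| ≤ B) (a : Space N k) :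
    Tendsto (fun t => kernelInt volume (heat t) φ a) (𝓝[>] 0) (𝓝 (φ a)) := by
  have hB0 : 0 ≤ B := (abs_nonneg _).trans (hB a)
  refine Metric.tendsto_nhds.2 fun ε hε => ?_
  obtain ⟨δ, hδ, hδε⟩ := Metric.continuous_iff.1 hφ a (ε / 2) (by positivity)
  set c := 1 - Real.exp (-(1 / 2) * δ ^ 2) with hc
  have hc0 : 0 < c := by
    rw [hc, sub_pos, Real.exp_lt_one_iff]
    nlinarith [sq_pos_of_pos hδ]
  set g₁ : Space N k → ℝ := fun b => 1 - Real.exp (-(1 / 2) * ‖b.1 - a.1‖ ^ 2) with hg₁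
  set g₂ : Space N k → ℝ := fun b => 1 - Real.exp (-(1 / 2) * ‖a.2 - b.2‖ ^ 2) with hg₂
  have hw : ∀ r : ℝ, 0 ≤ 1 - Real.exp (-(1 / 2) * r ^ 2) ∧ 1 - Real.exp (-(1 / 2) * r ^ 2) ≤ 1 := by
    intro r
    refine ⟨?_, by linarith [Real.exp_pos (-(1 / 2) * r ^ 2)]⟩
    rw [sub_nonneg, Real.exp_le_one_iff, neg_mul, Left.neg_nonpos_iff]
    positivity
  have hw2 : ∀ r : ℝ, δ ≤ r → c ≤ 1 - Real.exp (-(1 / 2) * r ^ 2) := by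
    intro r hr
    have : δ ^ 2 ≤ r ^ 2 := by gcongr
    rw [hc]
    gcongr 1 - Real.exp ?_
    linarith
  have hpt : ∀ b, |φ b - φ a| ≤ ε / 2 + 2 * B / c * (g₁ b + g₂ b) := by
    intro b
    have h1 := (hw ‖b.1 - a.1‖).1
    have h2 := (hw ‖a.2 - b.2‖).1
    rcases lt_or_ge (dist b a) δ with h | h
    · have h3 := hδε b h
      rw [Real.dist_eq] at h3
      have : 0 ≤ 2 * B / c * (g₁ b + g₂ b) := by
        have : 0 ≤ g₁ b + g₂ b := add_nonneg h1 h2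
        positivity
      linarith
    · have h3 : c ≤ g₁ b + g₂ b := by
        rw [Prod.dist_eq, le_max_iff, dist_eq_norm, dist_comm, dist_eq_norm] at h
        rcases h with h | h
        · linarith [hw2 _ h]
        · linarith [hw2 _ h]
      have h4 : |φ b - φ a| ≤ 2 * B := by
        have := abs_sub (φ b) (φ a)
        linarith [hB b, hB a]
      have h5 : 2 * B ≤ 2 * B / c * (g₁ b + g₂ b) := by
        rw [div_mul_eq_mul_div, le_div_iff₀ hc0]
        gcongr
      linarith
  have hlim := ((tendsto_integral_heat_fst hN hk a).add (tendsto_integral_heat_snd hN hk a)).const_mul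
    (2 * B / c)
  rw [add_zero, mul_zero] at hlim
  filter_upwards [self_mem_nhdsWithin, hlim.eventually (gt_mem_nhds (half_pos hε))] with t (ht : 0 < t) hlt
  have hi := integrable_heat hN hk ht a
  have hiφ : Integrable fun b => heat t a b * φ b :=
    hi.mul_bdd (c := B) hφ.aestronglyMeasurable (ae_of_all _ hB)
  have hi₁ : Integrable fun b => heat t a b * g₁ b :=
    hi.mul_bdd (c := 1) (by fun_prop) (ae_of_all _ fun b => by
      rw [Real.norm_of_nonneg (hw _).1]; exact (hw _).2)
  have hi₂ : Integrable fun b => heat t a b * g₂ b :=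
    hi.mul_bdd (c := 1) (by fun_prop) (ae_of_all _ fun b => by
      rw [Real.norm_of_nonneg (hw _).1]; exact (hw _).2)
  have e1 : kernelInt volume (heat t) φ a - φ a = ∫ b, heat t a b * (φ b - φ a) := by
    simp only [mul_sub]
    rw [integral_sub hiφ (hi.mul_const _), integral_mul_const, integral_heat hN hk ht, one_mul]
    rfl
  rw [Real.dist_eq, e1, ← Real.norm_eq_abs]
  calc ‖∫ b, heat t a b * (φ b - φ a)‖
      ≤ ∫ b, (heat t a b * (ε / 2) + 2 * B / c * (heat t a b * g₁ b + heat t a b * g₂ b)) := by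
        refine norm_integral_le_of_norm_le ((hi.mul_const _).add ((hi₁.add hi₂).const_mul _))
          (ae_of_all _ fun b => ?_)
        have h0 := heat_nonneg hN hk ht a b
        rw [norm_mul, Real.norm_of_nonneg h0, Real.norm_eq_abs]
        calc _ ≤ heat t a b * (ε / 2 + 2 * B / c * (g₁ b + g₂ b)) := by
              gcongr
              exact hpt b
          _ = _ := by ring
    _ = ε / 2 + 2 * B / c * ((∫ b, heat t a b * g₁ b) + ∫ b, heat t a b * g₂ b) := by
        have j : Integrable fun b => 2 * B / c * (heat t a b * g₁ b + heat t a b * g₂ b) :=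
          (hi₁.add hi₂).const_mul _
        rw [integral_add (hi.mul_const _) j, integral_mul_const,
          integral_const_mul, integral_add hi₁ hi₂, integral_heat hN hk ht, one_mul]
    _ < ε := by linarith

/-- Treats `t → t₀ > 0` (`G` the operator at `t₀`) and `t → 0` (`G` the identity) together. For `ψ`
in `C_c`, Scheffé gives convergence in `L^1` and the common sup bound upgrades it to `L^q`; density
and the bound on the operators do the rest. -/
theorem tendsto_heatOp_of_pointwise (hN : 1 ≤ N) (hk : 1 ≤ k) (hq : q ≠ ∞) (hpq : p ≤ q) {l : Filter ℝ}
    [l.NeBot] [l.IsCountablyGenerated] (hl : ∀ᶠ t in l, 0 < t)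
    {C : ℝ} (hC : ∀ᶠ t in l, ‖(heatOp hN hk hq hpq t :
      Lp ℝ p (volume : Measure (Space N k)) →L[ℝ] Lp ℝ q volume)‖ ≤ C)
    {G : (Space N k → ℝ) → Space N k → ℝ}
    (hlim : ∀ ψ : Space N k → ℝ, Continuous ψ → HasCompactSupport ψ → ∀ a,
      Tendsto (fun t => kernelInt volume (heat t) ψ a) l (𝓝 (G ψ a)))
    (hint : ∀ ψ : Space N k → ℝ, Integrable ψ → Integrable (G ψ) ∧ ∫ a, G ψ a = ∫ a, ψ a)
    {T₀ : Lp ℝ p (volume : Measure (Space N k)) →L[ℝ] Lp ℝ q (volume : Measure (Space N k))}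
    (hT₀ : ∀ φ, T₀ φ =ᵐ[volume] G φ)
    (hG : ∀ φ ψ : Space N k → ℝ, φ =ᵐ[volume] ψ → G φ =ᵐ[volume] G ψ)
    (φ : Lp ℝ p (volume : Measure (Space N k))) :
    Tendsto (fun t => heatOp hN hk hq hpq t φ) l (𝓝 (T₀ φ)) := by
  have hp : p ≠ ∞ := ne_top_of_le_ne_top hq hpq
  have hL1 : ∀ ψ : Space N k → ℝ, Continuous ψ → HasCompactSupport ψ → (∀ a, 0 ≤ ψ a) →
      Tendsto (fun t => ∫ a, |kernelInt volume (heat t) ψ a - G ψ a|) l (𝓝 0) := by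
    intro ψ hψ hψc hψ0
    have hi := hψ.integrable_of_hasCompactSupport hψc (μ := volume)
    have h0 : ∀ᶠ t in l, ∀ a, 0 ≤ kernelInt volume (heat t) ψ a := by
      filter_upwards [hl] with t ht a
      exact integral_nonneg fun b => mul_nonneg (heat_nonneg hN hk ht a b) (hψ0 b)
    refine tendsto_lintegral_sub_of_tendsto_ae ?_ (hint ψ hi).1 h0 (fun a => ?_) ?_ (hlim ψ hψ hψc)
    · filter_upwards [hl] with t ht
      exact ((bistochastic_heat hN hk ht).integral_kernelInt hi).1
    · refine ge_of_tendsto (hlim ψ hψ hψc a) ?_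
      filter_upwards [h0] with t ht using ht a
    · filter_upwards [hl] with t ht
      rw [((bistochastic_heat hN hk ht).integral_kernelInt hi).2, (hint ψ hi).2]
  have hcc : ∀ ψ : Space N k → ℝ, Continuous ψ → HasCompactSupport ψ →
      Tendsto (fun t => eLpNorm (kernelInt volume (heat t) ψ - G ψ) q volume) l (𝓝 0) := by
    intro ψ hψ hψc
    have hi := hψ.integrable_of_hasCompactSupport hψc (μ := volume)
    obtain ⟨B, hB⟩ := hψc.exists_bound_of_continuous hψ
    -- Scheffé's lemma needs nonnegative functions, so `ψ` is split into its positive and negative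
    -- parts.
    set ψ₁ : Space N k → ℝ := fun a => max (ψ a) 0
    set ψ₂ : Space N k → ℝ := fun a => max (-ψ a) 0
    have hc₁ : HasCompactSupport ψ₁ := hψc.comp_left (g := fun r : ℝ => max r 0) (by simp)
    have hc₂ : HasCompactSupport ψ₂ := hψc.comp_left (g := fun r : ℝ => max (-r) 0) (by simp)
    have hψ₁ : Continuous ψ₁ := hψ.max continuous_const
    have hψ₂ : Continuous ψ₂ := hψ.neg.max continuous_const
    have hi₁ := hψ₁.integrable_of_hasCompactSupport hc₁ (μ := volume)
    have hi₂ := hψ₂.integrable_of_hasCompactSupport hc₂ (μ := volume)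
    have hadd : ∀ t, 0 < t → ∀ a, kernelInt volume (heat t) ψ a =
        kernelInt volume (heat t) ψ₁ a - kernelInt volume (heat t) ψ₂ a := by
      intro t ht a
      have h := bistochastic_heat (k := k) hN hk ht
      have hψ12 : ∀ b, ψ b = ψ₁ b - ψ₂ b := fun b => by
        simp only [ψ₁, ψ₂]
        rcases le_total 0 (ψ b) with h | h
        · rw [max_eq_left h, max_eq_right (by linarith)]; ring
        · rw [max_eq_right h, max_eq_left (by linarith)]; ring
      unfold kernelInt
      rw [← integral_sub (h.integrable le_rfl ENNReal.one_ne_top (memLp_one_iff_integrable.2 hi₁) a)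
        (h.integrable le_rfl ENNReal.one_ne_top (memLp_one_iff_integrable.2 hi₂) a)]
      congr 1 with b
      rw [hψ12 b, mul_sub]
    -- `G` is not assumed linear; this instance is inherited from the pointwise limit.
    have hGadd : ∀ a, G ψ a = G ψ₁ a - G ψ₂ a := by
      intro a
      refine tendsto_nhds_unique (hlim ψ hψ hψc a)
        (((hlim ψ₁ hψ₁ hc₁ a).sub (hlim ψ₂ hψ₂ hc₂ a)).congr' ?_)
      filter_upwards [hl] with t ht
      rw [hadd t ht]
    have hbd : ∀ᶠ t in l, ∀ a, |kernelInt volume (heat t) ψ a| ≤ B := by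
      filter_upwards [hl] with t ht a
      exact (bistochastic_heat hN hk ht).abs_kernelInt_le hB a
    refine tendsto_eLpNorm_sub_of_bounded (B := B + B) Fact.out hq ?_ (hint ψ hi).1 ?_ ?_
    · filter_upwards [hl] with t ht
      exact ((bistochastic_heat hN hk ht).integral_kernelInt hi).1
    · filter_upwards [hbd] with t ht a
      refine (abs_sub _ _).trans (add_le_add (ht a) ?_)
      refine le_of_tendsto (hlim ψ hψ hψc a).abs ?_
      filter_upwards [hbd] with s hs using hs a
    · have h12 := (hL1 ψ₁ hψ₁ hc₁ fun a => le_max_right _ _).add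
        (hL1 ψ₂ hψ₂ hc₂ fun a => le_max_right _ _)
      rw [add_zero] at h12
      refine tendsto_of_tendsto_of_tendsto_of_le_of_le' tendsto_const_nhds h12
        (Eventually.of_forall fun t => integral_nonneg fun a => abs_nonneg _) ?_
      filter_upwards [hl] with t ht
      have h := bistochastic_heat (k := k) hN hk ht
      have j₁ : Integrable fun a => |kernelInt volume (heat t) ψ₁ a - G ψ₁ a| :=
        ((h.integral_kernelInt hi₁).1.sub (hint ψ₁ hi₁).1).abs
      have j₂ : Integrable fun a => |kernelInt volume (heat t) ψ₂ a - G ψ₂ a| :=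
        ((h.integral_kernelInt hi₂).1.sub (hint ψ₂ hi₂).1).abs
      have j : Integrable fun a => |kernelInt volume (heat t) ψ a - G ψ a| :=
        ((h.integral_kernelInt hi).1.sub (hint ψ hi).1).abs
      rw [← integral_add j₁ j₂]
      refine integral_mono j (j₁.add j₂) fun a => ?_
      simp only [hadd t ht a, hGadd a]
      refine le_trans (le_of_eq ?_) (abs_sub _ _)
      congr 1
      ring
  refine tendsto_clm_of_dense (s := {φ | ∃ ψ : Space N k → ℝ, Continuous ψ ∧ HasCompactSupport ψ ∧
    φ =ᵐ[volume] ψ}) hC ?_ ?_ φ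
  · refine Metric.dense_iff.2 fun f r hr => ?_
    obtain ⟨g, hgc, hfg, hg, hgm⟩ := (Lp.memLp f).exists_hasCompactSupport_eLpNorm_sub_le hp
      (ε := ENNReal.ofReal (r / 2)) (by simpa using hr)
    refine ⟨hgm.toLp g, ?_, g, hg, hgc, hgm.coeFn_toLp⟩
    rw [Metric.mem_ball, dist_comm, Lp.dist_def,
      eLpNorm_congr_ae ((ae_eq_refl (f : Space N k → ℝ)).sub hgm.coeFn_toLp)]
    exact (ENNReal.toReal_le_of_le_ofReal (by positivity) hfg).trans_lt (by linarith)
  · rintro f ⟨ψ, hψ, hψc, hfψ⟩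
    rw [Lp.tendsto_Lp_iff_tendsto_eLpNorm']
    refine (hcc ψ hψ hψc).congr' ?_
    filter_upwards [hl] with t ht
    refine eLpNorm_congr_ae ?_
    have h1 := coeFn_heatOp hN hk hq hpq ht f
    rw [kernelInt_congr hfψ] at h1
    exact (h1.sub ((hT₀ f).trans (hG _ _ hfψ))).symm

theorem tendsto_heatOp (hN : 1 ≤ N) (hk : 1 ≤ k) (hq : q ≠ ∞) (hpq : p ≤ q) {t₀ : ℝ} (ht₀ : 0 < t₀)
    (φ : Lp ℝ p (volume : Measure (Space N k))) :
    Tendsto (fun t => heatOp hN hk hq hpq t φ) (𝓝 t₀) (𝓝 (heatOp hN hk hq hpq t₀ φ)) := by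
  have hC : ContinuousAt (fun t : ℝ => heatBound N k hN ^ (1 / p.toReal - 1 / q.toReal) *
        t ^ (-(((N : ℝ) + 2 * k) / 2 * (1 / p.toReal - 1 / q.toReal)))) t₀ :=
    continuousAt_const.mul (continuousAt_id.rpow_const (Or.inl ht₀.ne'))
  have hev : ∀ᶠ t in 𝓝 t₀, 0 < t := lt_mem_nhds ht₀
  refine tendsto_heatOp_of_pointwise (G := kernelInt volume (heat t₀)) hN hk hq hpq hev
    (C := heatBound N k hN ^ (1 / p.toReal - 1 / q.toReal) *
        t₀ ^ (-(((N : ℝ) + 2 * k) / 2 * (1 / p.toReal - 1 / q.toReal))) + 1) ?_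
    (fun ψ hψ hψc a => tendsto_kernelInt_heat hN hk ht₀ (hψ.integrable_of_hasCompactSupport hψc) a)
    (fun ψ hψ => (bistochastic_heat hN hk ht₀).integral_kernelInt hψ)
    (fun φ => coeFn_heatOp hN hk hq hpq ht₀ φ) (fun φ ψ h => by rw [kernelInt_congr h]) φ
  filter_upwards [hev, hC.eventually (gt_mem_nhds (lt_add_one _))] with t ht hlt
  exact (norm_heatOp_le hN hk hq hpq ht).trans hlt.le

theorem tendsto_heatOp_zero (hN : 1 ≤ N) (hk : 1 ≤ k) (hp : p ≠ ∞)
    (φ : Lp ℝ p (volume : Measure (Space N k))) :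
    Tendsto (fun t => heatOp hN hk hp le_rfl t φ) (𝓝[>] 0) (𝓝 φ) := by
  refine tendsto_heatOp_of_pointwise (l := 𝓝[>] (0 : ℝ)) (G := id) (T₀ := ContinuousLinearMap.id ℝ _) hN hk hp le_rfl
    self_mem_nhdsWithin (C := 1) (Eventually.of_forall fun t => norm_heatOp_le_one hN hk hp t)
    (fun ψ hψ hψc a => ?_) (fun ψ hψ => ⟨hψ, rfl⟩) (fun φ => ae_eq_refl _) (fun φ ψ h => h) φ
  obtain ⟨B, hB⟩ := hψc.exists_bound_of_continuous hψ
  exact tendsto_kernelInt_heat_zero hN hk hψ hB a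

end HeatOperator

/-! ### Duhamel integrals with an integrable singularity at both ends -/

section Duhamel

/-- The Beta-type integral `∫₀¹ (1-θ)^{-γ} θ^{-β} dθ`. -/
noncomputable def betaInt (γ β : ℝ) : ℝ := ∫ θ in Ioo (0 : ℝ) 1, (1 - θ) ^ (-γ) * θ ^ (-β)

/-- The integrand is the norm of that of the complex Beta integral with parameters `1 - β` and `1 -
γ`. -/
theorem integrableOn_beta {γ β : ℝ} (hγ : γ < 1) (hβ : β < 1) :
    IntegrableOn (fun θ : ℝ => (1 - θ) ^ (-γ) * θ ^ (-β)) (Ioo 0 1) := by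
  have h := Complex.betaIntegral_convergent (u := ((1 - β : ℝ) : ℂ)) (v := ((1 - γ : ℝ) : ℂ))
    (by simpa using hβ) (by simpa using hγ)
  rw [intervalIntegrable_iff_integrableOn_Ioo_of_le zero_le_one] at h
  refine IntegrableOn.congr_fun h.norm (fun θ hθ => ?_) measurableSet_Ioo
  have h1 : 0 < 1 - θ := by linarith [hθ.2]
  rw [norm_mul, ← Complex.ofReal_one, ← Complex.ofReal_sub, ← Complex.ofReal_sub, ← Complex.ofReal_sub,
    Complex.norm_cpow_eq_rpow_re_of_pos hθ.1, Complex.norm_cpow_eq_rpow_re_of_pos h1,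
    Complex.ofReal_re, Complex.ofReal_re, mul_comm]
  congr 2 <;> ring

theorem betaInt_nonneg (γ β : ℝ) : 0 ≤ betaInt γ β :=
  setIntegral_nonneg measurableSet_Ioo fun θ hθ =>
    mul_nonneg (Real.rpow_nonneg (by linarith [hθ.2]) _) (Real.rpow_nonneg hθ.1.le _)

variable {X W : Type*} [NormedAddCommGroup X] [NormedSpace ℝ X]
  [NormedAddCommGroup W] [NormedSpace ℝ W]

/-- A strongly continuous family of operators for `t > 0` with `‖S t‖ ≤ C t^{-γ}`. -/
structure SingularFamily (S : ℝ → X →L[ℝ] W) (C γ : ℝ) : Prop where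
  norm_le : ∀ t, 0 < t → ‖S t‖ ≤ C * t ^ (-γ)
  tendsto : ∀ x t, 0 < t → Tendsto (fun s => S s x) (𝓝 t) (𝓝 (S t x))
  nonneg : 0 ≤ C
  exponent_nonneg : 0 ≤ γ
  exponent_lt : γ < 1

/-- A forcing term, continuous on `(0,T]`, with `‖g s‖ ≤ K s^{-β}`. -/
structure Forcing (g : ℝ → X) (T K β : ℝ) : Prop where
  continuousOn : ContinuousOn g (Ioc 0 T)
  norm_le : ∀ s ∈ Ioc 0 T, ‖g s‖ ≤ K * s ^ (-β)
  nonneg : 0 ≤ K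
  exponent_nonneg : 0 ≤ β
  exponent_lt : β < 1

/-- The Duhamel integral. -/
noncomputable def duhamelInt (S : ℝ → X →L[ℝ] W) (g : ℝ → X) (t : ℝ) : W :=
  ∫ s in (0 : ℝ)..t, S (t - s) (g s)

/-- The substitution `s = tθ` moves the dependence on `t` from the domain to the integrand, so that
continuity in `t` becomes dominated convergence and the power of `t` scales out. -/
theorem duhamelInt_eq (S : ℝ → X →L[ℝ] W) (g : ℝ → X) {t : ℝ} (ht : 0 < t) :
    duhamelInt S g t = t • ∫ θ in Ioo (0 : ℝ) 1, S (t - t * θ) (g (t * θ)) := by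
  have h := intervalIntegral.integral_comp_mul_left (a := 0) (b := 1)
    (fun s => S (t - s) (g s)) ht.ne'
  rw [intervalIntegral.integral_of_le zero_le_one, integral_Ioc_eq_integral_Ioo] at h
  rw [h, mul_zero, mul_one, smul_inv_smul₀ ht.ne', duhamelInt]

variable {S : ℝ → X →L[ℝ] W} {g : ℝ → X} {C γ T K β : ℝ}

/-- Strong continuity and local boundedness of the norms give joint continuity. -/
theorem SingularFamily.tendsto_apply (hS : SingularFamily S C γ) {ι : Type*} {l : Filter ι}
    {t : ι → ℝ} {x : ι → X} {t₀ : ℝ} {x₀ : X} (ht₀ : 0 < t₀) (ht : Tendsto t l (𝓝 t₀))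
    (hx : Tendsto x l (𝓝 x₀)) : Tendsto (fun i => S (t i) (x i)) l (𝓝 (S t₀ x₀)) := by
  have h1 : Tendsto (fun i => S (t i) x₀) l (𝓝 (S t₀ x₀)) := (hS.tendsto x₀ t₀ ht₀).comp ht
  have h2 : Tendsto (fun i => S (t i) (x i - x₀)) l (𝓝 0) := by
    have hb : Tendsto (fun i => C * t i ^ (-γ) * ‖x i - x₀‖) l (𝓝 0) := by
      have h3 := ((ht.rpow_const (p := -γ) (Or.inl ht₀.ne')).const_mul C).mul
        ((hx.sub_const x₀).norm)
      simpa using h3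
    refine squeeze_zero_norm' ?_ hb
    filter_upwards [ht.eventually (lt_mem_nhds ht₀)] with i hi
    exact ((S (t i)).le_opNorm _).trans (by gcongr; exact hS.norm_le _ hi)
  have h3 := h2.add h1
  rw [zero_add] at h3
  refine h3.congr fun i => ?_
  rw [map_sub, sub_add_cancel]

theorem SingularFamily.norm_apply_le (hS : SingularFamily S C γ) (hg : Forcing g T K β) {t θ : ℝ}
    (ht : t ∈ Ioc 0 T) (hθ : θ ∈ Ioo (0 : ℝ) 1) :
    ‖S (t - t * θ) (g (t * θ))‖ ≤ C * K * t ^ (-γ - β) * ((1 - θ) ^ (-γ) * θ ^ (-β)) := by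
  have h1 : 0 < 1 - θ := by linarith [hθ.2]
  have h2 : 0 < t * θ := mul_pos ht.1 hθ.1
  have h3 : t * θ ≤ T := (mul_le_of_le_one_right ht.1.le hθ.2.le).trans ht.2
  have e : t - t * θ = t * (1 - θ) := by ring
  have hC := hS.nonneg
  have ht0 := ht.1
  have hθ0 := hθ.1
  calc ‖S (t - t * θ) (g (t * θ))‖ ≤ ‖S (t - t * θ)‖ * ‖g (t * θ)‖ := (S _).le_opNorm _
    _ ≤ C * (t * (1 - θ)) ^ (-γ) * (K * (t * θ) ^ (-β)) := by
        rw [e]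
        gcongr
        · exact hS.norm_le _ (mul_pos ht.1 h1)
        · exact hg.norm_le _ ⟨h2, h3⟩
    _ = _ := by
        rw [Real.mul_rpow ht.1.le h1.le, Real.mul_rpow ht.1.le hθ.1.le, sub_eq_add_neg (-γ),
          Real.rpow_add ht.1]
        ring

theorem SingularFamily.aestronglyMeasurable (hS : SingularFamily S C γ) (hg : Forcing g T K β) {t : ℝ}
    (ht : t ∈ Ioc 0 T) : AEStronglyMeasurable (fun θ => S (t - t * θ) (g (t * θ)))
      (volume.restrict (Ioo 0 1)) := by
  refine ContinuousOn.aestronglyMeasurable (fun θ hθ => ?_) measurableSet_Ioo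
  have h1 : 0 < t - t * θ := by nlinarith [ht.1, hθ.2]
  have hc : ContinuousOn (fun θ => g (t * θ)) (Ioo 0 1) := by
    refine hg.continuousOn.comp (by fun_prop) fun θ hθ => ⟨mul_pos ht.1 hθ.1, ?_⟩
    exact (mul_le_of_le_one_right ht.1.le hθ.2.le).trans ht.2
  refine hS.tendsto_apply h1 ?_ (hc θ hθ)
  exact tendsto_nhdsWithin_of_tendsto_nhds (by fun_prop : Continuous fun θ => t - t * θ).continuousAt

theorem SingularFamily.integrableOn (hS : SingularFamily S C γ) (hg : Forcing g T K β) {t : ℝ}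
    (ht : t ∈ Ioc 0 T) : IntegrableOn (fun θ => S (t - t * θ) (g (t * θ))) (Ioo 0 1) := by
  refine ((integrableOn_beta hS.exponent_lt hg.exponent_lt).const_mul (C * K * t ^ (-γ - β))).mono'
    (hS.aestronglyMeasurable hg ht) ?_
  exact (ae_restrict_iff' measurableSet_Ioo).2 (ae_of_all _ fun θ hθ => hS.norm_apply_le hg ht hθ)

theorem SingularFamily.intervalIntegrable (hS : SingularFamily S C γ) (hg : Forcing g T K β) {t : ℝ}
    (ht : t ∈ Ioc 0 T) : IntervalIntegrable (fun s => S (t - s) (g s)) volume 0 t := by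
  have h := (intervalIntegrable_iff_integrableOn_Ioo_of_le zero_le_one).2 (hS.integrableOn hg ht)
  rw [← IntervalIntegrable.comp_mul_left_iff (c := t) ht.1.ne', zero_div, div_self ht.1.ne']
  exact h

theorem SingularFamily.norm_duhamelInt_le (hS : SingularFamily S C γ) (hg : Forcing g T K β) {t : ℝ}
    (ht : t ∈ Ioc 0 T) :
    ‖duhamelInt S g t‖ ≤ C * K * betaInt γ β * t ^ (1 - γ - β) := by
  rw [duhamelInt_eq S g ht.1, norm_smul, Real.norm_of_nonneg ht.1.le]
  have h1 : ‖∫ θ in Ioo (0 : ℝ) 1, S (t - t * θ) (g (t * θ))‖ ≤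
      ∫ θ in Ioo (0 : ℝ) 1, C * K * t ^ (-γ - β) * ((1 - θ) ^ (-γ) * θ ^ (-β)) := by
    refine norm_integral_le_of_norm_le
      ((integrableOn_beta hS.exponent_lt hg.exponent_lt).const_mul (C * K * t ^ (-γ - β))) ?_
    exact (ae_restrict_iff' measurableSet_Ioo).2 (ae_of_all _ fun θ hθ => hS.norm_apply_le hg ht hθ)
  rw [integral_const_mul] at h1
  calc _ ≤ t * (C * K * t ^ (-γ - β) * betaInt γ β) := by
        gcongr
        · exact ht.1.le
        · exact h1
    _ = _ := by
        rw [show 1 - γ - β = 1 + (-γ - β) by ring, Real.rpow_add ht.1, Real.rpow_one]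
        ring

theorem SingularFamily.continuousOn_duhamelInt (hS : SingularFamily S C γ) (hg : Forcing g T K β) :
    ContinuousOn (duhamelInt S g) (Ioc 0 T) := by
  have h : ContinuousOn (fun t => t • ∫ θ in Ioo (0 : ℝ) 1, S (t - t * θ) (g (t * θ))) (Ioc 0 T) := by
    refine continuousOn_id.smul fun t₀ ht₀ => ?_
    have ht₀' := ht₀.1
    refine tendsto_integral_filter_of_dominated_convergence
      (fun θ => C * K * (t₀ / 2) ^ (-γ - β) * ((1 - θ) ^ (-γ) * θ ^ (-β))) ?_ ?_
      ((integrableOn_beta hS.exponent_lt hg.exponent_lt).const_mul _) ?_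
    · filter_upwards [self_mem_nhdsWithin] with t ht
      exact hS.aestronglyMeasurable hg ht
    · filter_upwards [self_mem_nhdsWithin, nhdsWithin_le_nhds (lt_mem_nhds (half_lt_self ht₀'))]
        with t ht hlt
      refine (ae_restrict_iff' measurableSet_Ioo).2 (ae_of_all _ fun θ hθ => ?_)
      refine (hS.norm_apply_le hg ht hθ).trans ?_
      have h1 : 0 ≤ (1 - θ) ^ (-γ) * θ ^ (-β) :=
        mul_nonneg (Real.rpow_nonneg (by linarith [hθ.2]) _) (Real.rpow_nonneg hθ.1.le _)
      have h2 : t ^ (-γ - β) ≤ (t₀ / 2) ^ (-γ - β) :=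
        Real.rpow_le_rpow_of_nonpos (by positivity) hlt.le
          (by linarith [hS.exponent_nonneg, hg.exponent_nonneg])
      have := mul_nonneg hS.nonneg hg.nonneg
      gcongr
    · refine (ae_restrict_iff' measurableSet_Ioo).2 (ae_of_all _ fun θ hθ => ?_)
      have h1 : 0 < t₀ - t₀ * θ := by nlinarith [hθ.2]
      refine hS.tendsto_apply h1 ?_ ?_
      · exact tendsto_nhdsWithin_of_tendsto_nhds
          (by fun_prop : Continuous fun t => t - t * θ).continuousAt
      · have hc : ContinuousOn (fun t => g (t * θ)) (Ioc 0 T) := by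
          refine hg.continuousOn.comp (by fun_prop) fun t ht => ⟨mul_pos ht.1 hθ.1, ?_⟩
          exact (mul_le_of_le_one_right ht.1.le hθ.2.le).trans ht.2
        exact hc t₀ ht₀
  exact h.congr fun t ht => duhamelInt_eq S g ht.1

theorem SingularFamily.duhamelInt_sub (hS : SingularFamily S C γ) {g₂ : ℝ → X} {K₂ : ℝ}
    (hg : Forcing g T K β) (hg₂ : Forcing g₂ T K₂ β) {t : ℝ} (ht : t ∈ Ioc 0 T) :
    duhamelInt S g t - duhamelInt S g₂ t = duhamelInt S (fun s => g s - g₂ s) t := by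
  unfold duhamelInt
  rw [← intervalIntegral.integral_sub (hS.intervalIntegrable hg ht) (hS.intervalIntegrable hg₂ ht)]
  simp only [map_sub]

/-- `e^{-λt} ≤ (λt)^{-c}` for `0 ≤ c ≤ 1`: a slightly stronger singularity is accepted in return for
the factor `λ^{-c}`, which is small for large `λ`. -/
theorem SingularFamily.exp_smul (hS : SingularFamily S C γ) {c lam : ℝ} (hc : 0 ≤ c) (hc1 : c ≤ 1)
    (hcγ : γ + c < 1) (hlam : 0 < lam) :
    SingularFamily (fun t => Real.exp (-lam * t) • S t) (C * lam ^ (-c)) (γ + c) where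
  norm_le t ht := by
    rw [norm_smul, Real.norm_of_nonneg (Real.exp_pos _).le]
    have hx : 0 < lam * t := mul_pos hlam ht
    have h1 : (lam * t) ^ c ≤ Real.exp (lam * t) := by
      rcases le_total (lam * t) 1 with h | h
      · exact (Real.rpow_le_one hx.le h hc).trans (Real.one_le_exp hx.le)
      · exact (Real.rpow_le_self_of_one_le h hc1).trans
          ((le_add_of_nonneg_right zero_le_one).trans (Real.add_one_le_exp _))
    have h2 : Real.exp (-lam * t) ≤ (lam * t) ^ (-c) := by
      rw [neg_mul, Real.exp_neg, Real.rpow_neg hx.le]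
      gcongr
    have hC := hS.nonneg
    calc _ ≤ (lam * t) ^ (-c) * (C * t ^ (-γ)) := by
          gcongr
          exact hS.norm_le t ht
      _ = _ := by
          rw [Real.mul_rpow hlam.le ht.le, neg_add, Real.rpow_add ht]
          ring
  tendsto x t ht := by
    have h1 : Tendsto (fun s => Real.exp (-lam * s)) (𝓝 t) (𝓝 (Real.exp (-lam * t))) :=
      (by fun_prop : Continuous fun s => Real.exp (-lam * s)).tendsto t
    exact h1.smul (hS.tendsto x t ht)
  nonneg := mul_nonneg hS.nonneg (by positivity)
  exponent_nonneg := add_nonneg hS.exponent_nonneg hc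
  exponent_lt := hcγ

theorem duhamelInt_exp_smul (S : ℝ → X →L[ℝ] W) (g : ℝ → X) (lam t : ℝ) :
    duhamelInt (fun t => Real.exp (-lam * t) • S t) (fun s => Real.exp (-lam * s) • g s) t =
      Real.exp (-lam * t) • duhamelInt S g t := by
  unfold duhamelInt
  rw [← intervalIntegral.integral_smul]
  congr 1 with s
  rw [smul_apply, map_smul, smul_smul, ← Real.exp_add]
  ring_nf

variable {Y : Type*} [NormedAddCommGroup Y] [NormedSpace ℝ Y]

/-- Up to the scalar `t`, the pair of Duhamel integrals is the mean of a `Z`-valued function over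
the probability space `(0,1)`, and a closed convex set contains such means. -/
theorem duhamelInt_mem [CompleteSpace X] [CompleteSpace Y] {SX : ℝ → X →L[ℝ] X} {SY : ℝ → X →L[ℝ] Y}
    {C' γ' : ℝ} {Z : Submodule ℝ (X × Y)} (hX : SingularFamily SX C γ) (hY : SingularFamily SY C' γ')
    (hZ : IsClosed (Z : Set (X × Y))) (hS : ∀ t, 0 < t → ∀ x, (SX t x, SY t x) ∈ Z)
    (hg : Forcing g T K β) {t : ℝ} (ht : t ∈ Ioc 0 T) :
    (duhamelInt SX g t, duhamelInt SY g t) ∈ Z := by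
  rw [duhamelInt_eq SX g ht.1, duhamelInt_eq SY g ht.1]
  have : IsProbabilityMeasure ((volume : Measure ℝ).restrict (Ioo 0 1)) := ⟨by simp⟩
  have h := Convex.integral_mem (μ := volume.restrict (Ioo (0 : ℝ) 1)) (s := (Z : Set (X × Y)))
    (f := fun θ => (SX (t - t * θ) (g (t * θ)), SY (t - t * θ) (g (t * θ)))) Z.convex hZ
    ((ae_restrict_iff' measurableSet_Ioo).2 (ae_of_all _ fun θ hθ => hS _ (by nlinarith [ht.1, hθ.2]) _))
    ((hX.integrableOn hg ht).prodMk (hY.integrableOn hg ht))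
  rw [integral_pair (hX.integrableOn hg ht) (hY.integrableOn hg ht)] at h
  exact Z.smul_mem t h

end Duhamel

/-! ### The abstract semilinear problem: Lipschitz dependence and existence -/

section Evolution

variable {X Y : Type*} [NormedAddCommGroup X] [NormedSpace ℝ X]
  [NormedAddCommGroup Y] [NormedSpace ℝ Y]

/-- The semilinear Cauchy problem in a pair of compatible spaces: `SX` acts on `X`, `SY` maps `X`
to the smoother space `Y` with a singularity at `t = 0`, and `f : Y → X` is locally Lipschitz with
growth `ρ`; `Z` relates the elements of `X` and `Y` that are to be identified. -/
structure EvolutionSystem (SX : ℝ → X →L[ℝ] X) (SY : ℝ → X →L[ℝ] Y) (f : Y → X)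
    (Z : Submodule ℝ (X × Y)) (C α L ρ : ℝ) : Prop where
  familyX : SingularFamily SX 1 0
  familyY : SingularFamily SY C α
  apply_zero : ∀ x, SX 0 x = x
  tendsto_zero : ∀ x, Tendsto (fun t => SX t x) (𝓝[>] 0) (𝓝 x)
  isClosed : IsClosed (Z : Set (X × Y))
  mem : ∀ t, 0 < t → ∀ x, (SX t x, SY t x) ∈ Z
  map_zero : f 0 = 0
  lipschitz : ∀ u v, ‖f u - f v‖ ≤ L * (‖u‖ ^ (ρ - 1) + ‖v‖ ^ (ρ - 1)) * ‖u - v‖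
  nonneg : 0 ≤ L
  one_lt : 1 < ρ
  mul_lt_one : α * ρ < 1

/-- `w` is continuous on `(0,T]` with `t^α ‖w t‖ ≤ R`. -/
structure Weighted (w : ℝ → Y) (α T R : ℝ) : Prop where
  continuousOn : ContinuousOn w (Ioc 0 T)
  le : ∀ t ∈ Ioc 0 T, t ^ α * ‖w t‖ ≤ R

/-- `w` solves the integral equation in `Y` on `(0,T]`. -/
structure MildY (SY : ℝ → X →L[ℝ] Y) (f : Y → X) (α T : ℝ) (x₀ : X) (w : ℝ → Y) (R : ℝ) : Prop
    extends Weighted w α T R where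
  eq : ∀ t ∈ Ioc 0 T, w t = SY t x₀ + duhamelInt SY (fun s => f (w s)) t

variable {SX : ℝ → X →L[ℝ] X} {SY : ℝ → X →L[ℝ] Y} {f : Y → X} {Z : Submodule ℝ (X × Y)}
  {C α L ρ T R : ℝ}

omit [NormedSpace ℝ Y] in
theorem Weighted.norm_le {w : ℝ → Y} (h : Weighted w α T R) {t : ℝ} (ht : t ∈ Ioc 0 T) :
    ‖w t‖ ≤ R * t ^ (-α) := by
  have h1 := h.le t ht
  have h2 : 0 < t ^ α := Real.rpow_pos_of_pos ht.1 _
  rw [Real.rpow_neg ht.1.le, ← div_eq_mul_inv, le_div_iff₀ h2, mul_comm]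
  exact h1

namespace EvolutionSystem

variable (hE : EvolutionSystem SX SY f Z C α L ρ)
include hE

theorem mul_nonneg : 0 ≤ α * ρ :=
  _root_.mul_nonneg hE.familyY.exponent_nonneg (by linarith [hE.one_lt])

theorem continuous_map : Continuous f := by
  refine continuous_iff_continuousAt.2 fun v => ?_
  refine tendsto_iff_norm_sub_tendsto_zero.2 ?_
  have hρ := hE.one_lt
  have h1 : Continuous fun u : Y => L * (‖u‖ ^ (ρ - 1) + ‖v‖ ^ (ρ - 1)) * ‖u - v‖ := by
    have : Continuous fun u : Y => ‖u‖ ^ (ρ - 1) :=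
      continuous_norm.rpow_const fun _ => Or.inr (by linarith)
    fun_prop
  have h2 := h1.tendsto v
  simp only [sub_self, norm_zero, mul_zero] at h2
  exact squeeze_zero (fun _ => norm_nonneg _) (fun u => hE.lipschitz u v) h2

theorem forcing {w : ℝ → Y} (hR : 0 ≤ R) (hw : Weighted w α T R) :
    Forcing (fun s => f (w s)) T (L * R ^ ρ) (α * ρ) where
  continuousOn := hE.continuous_map.comp_continuousOn hw.continuousOn
  norm_le s hs := by
    have hρ := hE.one_lt
    have hL := hE.nonneg
    have h1 := hE.lipschitz (w s) 0
    rw [hE.map_zero, sub_zero, sub_zero, norm_zero, Real.zero_rpow (by linarith), add_zero] at h1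
    have h2 : ‖w s‖ ^ (ρ - 1) * ‖w s‖ = ‖w s‖ ^ ρ := by
      nth_rewrite 2 [← Real.rpow_one ‖w s‖]
      rw [← Real.rpow_add_of_nonneg (norm_nonneg _) (by linarith) zero_le_one, sub_add_cancel]
    rw [mul_assoc, h2] at h1
    refine h1.trans ?_
    calc L * ‖w s‖ ^ ρ ≤ L * (R * s ^ (-α)) ^ ρ := by
          gcongr
          exact hw.norm_le hs
      _ = _ := by
          rw [Real.mul_rpow hR (Real.rpow_nonneg hs.1.le _), ← Real.rpow_mul hs.1.le]
          ring_nf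
  nonneg := _root_.mul_nonneg hE.nonneg (Real.rpow_nonneg hR _)
  exponent_nonneg := hE.mul_nonneg
  exponent_lt := hE.mul_lt_one

/-- The Lipschitz bound contributes `s^{-α(ρ-1)}` from the sizes of `w` and `v`, and `s^{-α}` from
their difference: together `s^{-αρ}`. -/
theorem forcing_sub {w v : ℝ → Y} (hR : 0 ≤ R) (hw : Weighted w α T R) (hv : Weighted v α T R)
    {lam m : ℝ} (hm : 0 ≤ m)
    (h : ∀ s ∈ Ioc 0 T, Real.exp (-lam * s) * (s ^ α * ‖w s - v s‖) ≤ m) :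
    Forcing (fun s => Real.exp (-lam * s) • (f (w s) - f (v s))) T (L * (2 * R ^ (ρ - 1)) * m) (α * ρ) where
  continuousOn := by
    have h1 := hE.continuous_map.comp_continuousOn hw.continuousOn
    have h2 := hE.continuous_map.comp_continuousOn hv.continuousOn
    exact ContinuousOn.smul (by fun_prop) (h1.sub h2)
  norm_le s hs := by
    have hρ := hE.one_lt
    have hL := hE.nonneg
    have hs0 := hs.1
    rw [norm_smul, Real.norm_of_nonneg (Real.exp_pos _).le]
    have h1 : ‖w s‖ ^ (ρ - 1) ≤ (R * s ^ (-α)) ^ (ρ - 1) :=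
      Real.rpow_le_rpow (norm_nonneg _) (hw.norm_le hs) (by linarith)
    have h2 : ‖v s‖ ^ (ρ - 1) ≤ (R * s ^ (-α)) ^ (ρ - 1) :=
      Real.rpow_le_rpow (norm_nonneg _) (hv.norm_le hs) (by linarith)
    have h3 : Real.exp (-lam * s) * ‖w s - v s‖ ≤ m * s ^ (-α) := by
      have := h s hs
      rw [Real.rpow_neg hs.1.le, ← div_eq_mul_inv, le_div_iff₀ (by positivity)]
      linarith
    calc Real.exp (-lam * s) * ‖f (w s) - f (v s)‖
        ≤ Real.exp (-lam * s) * (L * (‖w s‖ ^ (ρ - 1) + ‖v s‖ ^ (ρ - 1)) * ‖w s - v s‖) := by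
          gcongr
          exact hE.lipschitz _ _
      _ = L * (‖w s‖ ^ (ρ - 1) + ‖v s‖ ^ (ρ - 1)) * (Real.exp (-lam * s) * ‖w s - v s‖) := by ring
      _ ≤ L * ((R * s ^ (-α)) ^ (ρ - 1) + (R * s ^ (-α)) ^ (ρ - 1)) * (m * s ^ (-α)) := by gcongr
      _ = _ := by
          rw [Real.mul_rpow hR (by positivity), ← Real.rpow_mul hs.1.le,
            show -(α * ρ) = -α * (ρ - 1) + -α by ring, Real.rpow_add hs.1]
          ring
  nonneg := by
    have := hE.nonneg
    positivity
  exponent_nonneg := hE.mul_nonneg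
  exponent_lt := hE.mul_lt_one

theorem weighted_apply_le (x : X) {t : ℝ} (ht : 0 < t) : t ^ α * ‖SY t x‖ ≤ C * ‖x‖ := by
  have h1 : ‖SY t x‖ ≤ C * t ^ (-α) * ‖x‖ := ((SY t).le_opNorm x).trans (by
    gcongr
    exact hE.familyY.norm_le t ht)
  calc t ^ α * ‖SY t x‖ ≤ t ^ α * (C * t ^ (-α) * ‖x‖) := by gcongr
    _ = _ := by
      rw [Real.rpow_neg ht.le]
      have : t ^ α ≠ 0 := by positivity
      field_simp

omit hE in
-- Applied to the supremum `m` of `ψ`, the hypothesis reads `m ≤ a + m/2`. The a priori bound `m₀`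
-- ensures that `m` is finite.
theorem le_of_forall_le_half {s : Set ℝ} {ψ : ℝ → ℝ} {a m₀ : ℝ} (h0 : ∀ t ∈ s, 0 ≤ ψ t)
    (hm₀ : ∀ t ∈ s, ψ t ≤ m₀)
    (h : ∀ m, 0 ≤ m → (∀ t ∈ s, ψ t ≤ m) → ∀ t ∈ s, ψ t ≤ a + m / 2) : ∀ t ∈ s, ψ t ≤ 2 * a := by
  intro t ht
  have hb : BddAbove (ψ '' s) := ⟨m₀, by rintro _ ⟨r, hr, rfl⟩; exact hm₀ r hr⟩
  have hle : ∀ r ∈ s, ψ r ≤ sSup (ψ '' s) := fun r hr => le_csSup hb ⟨r, hr, rfl⟩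
  have h1 : sSup (ψ '' s) ≤ a + sSup (ψ '' s) / 2 := by
    refine csSup_le ⟨ψ t, t, ht, rfl⟩ ?_
    rintro _ ⟨r, hr, rfl⟩
    exact h _ ((h0 t ht).trans (hle t ht)) hle r hr
  linarith [hle t ht]

/-- For the norm `sup e^{-λt} t^α ‖w - v‖`, the difference of the Duhamel terms has Lipschitz
constant at most `Q λ^{-c}`, which a large `λ` brings below `1/2`. Neither `T` nor `R` need be
small, and undoing the weight costs `e^{λT}`. -/
theorem exists_lipschitz_Y (hT : 0 < T) (hR : 0 ≤ R) : ∃ D : ℝ, 0 ≤ D ∧ ∀ (x₀ y₀ : X) (w v : ℝ → Y),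
    MildY SY f α T x₀ w R → MildY SY f α T y₀ v R →
    ∀ t ∈ Ioc 0 T, t ^ α * ‖w t - v t‖ ≤ D * ‖x₀ - y₀‖ := by
  have hα := hE.familyY.exponent_lt
  have hα0 := hE.familyY.exponent_nonneg
  have hαρ := hE.mul_lt_one
  have hαρ0 := hE.mul_nonneg
  have hC := hE.familyY.nonneg
  have hL := hE.nonneg
  -- Small enough that `α + c < 1`, so the weighted family is still integrable, and that `1 - c - αρ
  -- ≥ 0`, so the remaining power of `t` is bounded on `(0,T]`.
  set c := min (1 - α) (1 - α * ρ) / 2 with hc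
  have hc0 : 0 < c := half_pos (lt_min (by linarith) (by linarith))
  have hc1 : 2 * c ≤ 1 - α := by rw [hc]; linarith [min_le_left (1 - α) (1 - α * ρ)]
  have hc2 : 2 * c ≤ 1 - α * ρ := by rw [hc]; linarith [min_le_right (1 - α) (1 - α * ρ)]
  set Q := C * (L * (2 * R ^ (ρ - 1))) * betaInt (α + c) (α * ρ) * T ^ (1 - c - α * ρ) with hQ
  have hB := betaInt_nonneg (α + c) (α * ρ)
  have hQ0 : 0 ≤ Q := by positivity
  -- Chosen so that `Q λ^{-c} = Q / (2Q + 1) ≤ 1/2`.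
  set lam := (2 * Q + 1) ^ (1 / c) with hlam
  have hlam0 : 0 < lam := by positivity
  have hlamc : lam ^ (-c) = 1 / (2 * Q + 1) := by
    rw [hlam, ← Real.rpow_mul (by positivity), show 1 / c * -c = -1 by field_simp, Real.rpow_neg_one,
      one_div]
  refine ⟨2 * C * Real.exp (lam * T), by positivity, fun x₀ y₀ w v hw hv => ?_⟩
  have key := le_of_forall_le_half (s := Ioc 0 T) (a := C * ‖x₀ - y₀‖) (m₀ := R + R)
    (ψ := fun t => Real.exp (-lam * t) * (t ^ α * ‖w t - v t‖))
    (fun t ht => by have := ht.1; positivity) (fun t ht => ?_) (fun m hm hψ t ht => ?_)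
  · intro t ht
    have h1 := key t ht
    simp only [neg_mul, Real.exp_neg] at h1
    rw [inv_mul_le_iff₀ (Real.exp_pos _)] at h1
    refine h1.trans ?_
    have : Real.exp (lam * t) ≤ Real.exp (lam * T) := by
      have := ht.2
      gcongr
    calc Real.exp (lam * t) * (2 * (C * ‖x₀ - y₀‖)) ≤ Real.exp (lam * T) * (2 * (C * ‖x₀ - y₀‖)) := by
          gcongr
      _ = _ := by ring
  · have ht0 := ht.1
    have h1 : Real.exp (-lam * t) ≤ 1 := by
      rw [Real.exp_le_one_iff]
      nlinarith
    have h2 : t ^ α * ‖w t - v t‖ ≤ R + R := by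
      calc t ^ α * ‖w t - v t‖ ≤ t ^ α * (‖w t‖ + ‖v t‖) := by
            gcongr
            exact norm_sub_le _ _
        _ ≤ _ := by
            rw [mul_add]
            exact add_le_add (hw.le t ht) (hv.le t ht)
    exact (mul_le_of_le_one_left (by positivity) h1).trans h2
  · have ht0 := ht.1
    have hF := hE.forcing_sub hR hw.toWeighted hv.toWeighted hm hψ
    have hS := hE.familyY.exp_smul hc0.le (by linarith) (by linarith) hlam0
    have h1 := hS.norm_duhamelInt_le hF ht
    rw [duhamelInt_exp_smul, norm_smul, Real.norm_of_nonneg (Real.exp_pos _).le] at h1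
    have h2 : w t - v t = SY t (x₀ - y₀) + duhamelInt SY (fun s => f (w s) - f (v s)) t := by
      rw [hw.eq t ht, hv.eq t ht, ← hE.familyY.duhamelInt_sub (hE.forcing hR hw.toWeighted)
        (hE.forcing hR hv.toWeighted) ht, map_sub]
      abel
    have h3 : Real.exp (-lam * t) ≤ 1 := by
      rw [Real.exp_le_one_iff]
      nlinarith
    have h4 := hE.weighted_apply_le (x₀ - y₀) ht0
    have h5 : t ^ (1 - c - α * ρ) ≤ T ^ (1 - c - α * ρ) :=
      Real.rpow_le_rpow ht0.le ht.2 (by linarith)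
    have h6 : t ^ α * t ^ (1 - (α + c) - α * ρ) = t ^ (1 - c - α * ρ) := by
      rw [← Real.rpow_add ht0]
      congr 1
      ring
    calc Real.exp (-lam * t) * (t ^ α * ‖w t - v t‖)
        ≤ Real.exp (-lam * t) * (t ^ α *
          (‖SY t (x₀ - y₀)‖ + ‖duhamelInt SY (fun s => f (w s) - f (v s)) t‖)) := by
          rw [h2]
          gcongr
          exact norm_add_le _ _
      _ = Real.exp (-lam * t) * (t ^ α * ‖SY t (x₀ - y₀)‖) + t ^ α * (Real.exp (-lam * t) *
          ‖duhamelInt SY (fun s => f (w s) - f (v s)) t‖) := by ring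
      _ ≤ 1 * (C * ‖x₀ - y₀‖) + t ^ α * (C * lam ^ (-c) * (L * (2 * R ^ (ρ - 1)) * m) *
          betaInt (α + c) (α * ρ) * t ^ (1 - (α + c) - α * ρ)) := by
          gcongr
      _ = C * ‖x₀ - y₀‖ + (C * (L * (2 * R ^ (ρ - 1))) * betaInt (α + c) (α * ρ) *
          (t ^ α * t ^ (1 - (α + c) - α * ρ))) * lam ^ (-c) * m := by ring
      _ ≤ C * ‖x₀ - y₀‖ + Q * lam ^ (-c) * m := by
          rw [h6, hQ]
          gcongr
      _ ≤ C * ‖x₀ - y₀‖ + m / 2 := by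
          rw [hlamc]
          have : Q * (1 / (2 * Q + 1)) ≤ 1 / 2 := by
            rw [mul_one_div, div_le_div_iff₀ (by positivity) (by norm_num)]
            linarith
          nlinarith

/-- The estimate in `Y` bounds the difference of the forcing terms in `X` by a multiple of
`s^{-αρ}`, and `SX` is contractive. -/
theorem exists_lipschitz_X (hT : 0 < T) (hR : 0 ≤ R) : ∃ D : ℝ, 0 ≤ D ∧ ∀ (x₀ y₀ : X) (w v : ℝ → Y),
    MildY SY f α T x₀ w R → MildY SY f α T y₀ v R → ∀ t ∈ Ioc 0 T,
    ‖(SX t x₀ + duhamelInt SX (fun s => f (w s)) t) - (SX t y₀ + duhamelInt SX (fun s => f (v s)) t)‖ ≤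
      D * ‖x₀ - y₀‖ := by
  obtain ⟨D, hD, h⟩ := hE.exists_lipschitz_Y hT hR
  have hαρ := hE.mul_lt_one
  have hL := hE.nonneg
  have hB := betaInt_nonneg 0 (α * ρ)
  refine ⟨1 + L * (2 * R ^ (ρ - 1)) * D * betaInt 0 (α * ρ) * T ^ (1 - α * ρ), by positivity,
    fun x₀ y₀ w v hw hv t ht => ?_⟩
  have hF := hE.forcing_sub (lam := 0) hR hw.toWeighted hv.toWeighted
    (by positivity : 0 ≤ D * ‖x₀ - y₀‖) (by simpa using h x₀ y₀ w v hw hv)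
  simp only [neg_zero, zero_mul, Real.exp_zero, one_smul] at hF
  have h1 := hE.familyX.norm_duhamelInt_le hF ht
  have h2 : ‖SX t (x₀ - y₀)‖ ≤ ‖x₀ - y₀‖ := by
    have := hE.familyX.norm_le t ht.1
    rw [neg_zero, Real.rpow_zero, one_mul] at this
    exact ((SX t).le_opNorm _).trans (mul_le_of_le_one_left (norm_nonneg _) this)
  have h3 : t ^ (1 - 0 - α * ρ) ≤ T ^ (1 - α * ρ) := by
    rw [sub_zero]
    exact Real.rpow_le_rpow ht.1.le ht.2 (by linarith)
  have h4 : (SX t x₀ + duhamelInt SX (fun s => f (w s)) t) -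
      (SX t y₀ + duhamelInt SX (fun s => f (v s)) t) =
      SX t (x₀ - y₀) + duhamelInt SX (fun s => f (w s) - f (v s)) t := by
    rw [← hE.familyX.duhamelInt_sub (hE.forcing hR hw.toWeighted) (hE.forcing hR hv.toWeighted) ht,
      map_sub]
    abel
  rw [h4]
  calc _ ≤ ‖SX t (x₀ - y₀)‖ + ‖duhamelInt SX (fun s => f (w s) - f (v s)) t‖ := norm_add_le _ _
    _ ≤ ‖x₀ - y₀‖ + 1 * (L * (2 * R ^ (ρ - 1)) * (D * ‖x₀ - y₀‖)) * betaInt 0 (α * ρ) *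
        T ^ (1 - α * ρ) := by
        refine add_le_add h2 (h1.trans ?_)
        gcongr
    _ = _ := by ring

/-- At `t = 0` the Duhamel term is `O(t^{1-αρ})`, so continuity there reduces to that of the linear
flow. -/
theorem continuousOn_X {w : ℝ → Y} (hR : 0 ≤ R) (hw : Weighted w α T R) (x₀ : X) :
    ContinuousOn (fun t => SX t x₀ + duhamelInt SX (fun s => f (w s)) t) (Icc 0 T) := by
  have hF := hE.forcing hR hw
  have hαρ := hE.mul_lt_one
  intro t₀ ht₀
  rcases ht₀.1.eq_or_lt with rfl | h0
  · have e0 : SX 0 x₀ + duhamelInt SX (fun s => f (w s)) 0 = x₀ := by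
      rw [hE.apply_zero, duhamelInt, intervalIntegral.integral_same, add_zero]
    rw [← continuousWithinAt_sdiff_self, ContinuousWithinAt, e0]
    have h1 : Tendsto (fun t => SX t x₀) (𝓝[Icc 0 T \ {0}] 0) (𝓝 x₀) :=
      (hE.tendsto_zero x₀).mono_left (nhdsWithin_mono _ fun t ht =>
        lt_of_le_of_ne ht.1.1 fun h => ht.2 h.symm)
    have h2 : Tendsto (fun t => duhamelInt SX (fun s => f (w s)) t) (𝓝[Icc 0 T \ {0}] 0) (𝓝 0) := by
      have h3 : Tendsto (fun t : ℝ => 1 * (L * R ^ ρ) * betaInt 0 (α * ρ) * t ^ (1 - 0 - α * ρ))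
          (𝓝[Icc 0 T \ {0}] 0) (𝓝 0) := by
        have h4 : ContinuousAt (fun t : ℝ => 1 * (L * R ^ ρ) * betaInt 0 (α * ρ) * t ^ (1 - 0 - α * ρ)) 0 :=
          continuousAt_const.mul (continuousAt_id.rpow_const (Or.inr (by linarith)))
        have h5 := h4.tendsto
        rw [Real.zero_rpow (by linarith), mul_zero] at h5
        exact tendsto_nhdsWithin_of_tendsto_nhds h5
      refine squeeze_zero_norm' ?_ h3
      filter_upwards [self_mem_nhdsWithin] with t ht
      exact hE.familyX.norm_duhamelInt_le hF ⟨lt_of_le_of_ne ht.1.1 fun h => ht.2 h.symm, ht.1.2⟩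
    simpa using h1.add h2
  · have h1 : ContinuousWithinAt (fun t => SX t x₀ + duhamelInt SX (fun s => f (w s)) t) (Ioc 0 T) t₀ :=
      (tendsto_nhdsWithin_of_tendsto_nhds (hE.familyX.tendsto x₀ t₀ h0)).add
        (hE.familyX.continuousOn_duhamelInt hF t₀ ⟨h0, ht₀.2⟩)
    refine h1.mono_of_mem_nhdsWithin ?_
    filter_upwards [self_mem_nhdsWithin, nhdsWithin_le_nhds (lt_mem_nhds h0)] with t ht ht'
    exact ⟨ht', ht.2⟩

/-- The equation is solved in `Y`; the same formula with `SX` defines a curve in `X` that is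
identified with `w` through `Z`. -/
theorem mem_of_mildY [CompleteSpace X] [CompleteSpace Y] {w : ℝ → Y} (hR : 0 ≤ R) {x₀ : X}
    (hw : MildY SY f α T x₀ w R) {t : ℝ} (ht : t ∈ Ioc 0 T) :
    (SX t x₀ + duhamelInt SX (fun s => f (w s)) t, w t) ∈ Z := by
  rw [hw.eq t ht]
  exact Z.add_mem (hE.mem t ht.1 x₀) (duhamelInt_mem hE.familyX hE.familyY hE.isClosed hE.mem
    (hE.forcing hR hw.toWeighted) ht)

end EvolutionSystem

/-- The function on `ℝ` with `t^α w(t) = v(t)` on `(0,T]`. -/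
noncomputable def unweight (α T : ℝ) (v : BoundedContinuousFunction (Ioc 0 T) Y) (s : ℝ) : Y :=
  open Classical in if h : s ∈ Ioc 0 T then s ^ (-α) • v ⟨s, h⟩ else 0

theorem unweight_apply (v : BoundedContinuousFunction (Ioc 0 T) Y) {s : ℝ} (hs : s ∈ Ioc 0 T) :
    unweight α T v s = s ^ (-α) • v ⟨s, hs⟩ := dif_pos hs

theorem rpow_smul_unweight (v : BoundedContinuousFunction (Ioc 0 T) Y) {s : ℝ} (hs : s ∈ Ioc 0 T) :
    s ^ α • unweight α T v s = v ⟨s, hs⟩ := by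
  rw [unweight_apply v hs, smul_smul, ← Real.rpow_add hs.1, add_neg_cancel, Real.rpow_zero, one_smul]

theorem weighted_unweight (v : BoundedContinuousFunction (Ioc 0 T) Y) (hv : ‖v‖ ≤ R) :
    Weighted (unweight α T v) α T R where
  continuousOn := by
    rw [continuousOn_iff_continuous_domRestrict]
    have : (Ioc 0 T).domRestrict (unweight α T v) = fun s : Ioc 0 T => (s : ℝ) ^ (-α) • v s := by
      ext s
      exact unweight_apply v s.2
    rw [this]
    refine Continuous.smul ?_ v.continuous
    exact continuous_subtype_val.rpow_const fun s => Or.inl s.2.1.ne'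
  le t ht := by
    have := congrArg norm (rpow_smul_unweight (α := α) v ht)
    rw [norm_smul, Real.norm_of_nonneg (Real.rpow_nonneg ht.1.le _)] at this
    rw [this]
    exact (v.norm_coe_le_norm _).trans hv

theorem weighted_unweight_sub_le (v v' : BoundedContinuousFunction (Ioc 0 T) Y) {t : ℝ} (ht : t ∈ Ioc 0 T) :
    t ^ α * ‖unweight α T v t - unweight α T v' t‖ ≤ dist v v' := by
  have : ‖t ^ α • (unweight α T v t - unweight α T v' t)‖ = ‖v ⟨t, ht⟩ - v' ⟨t, ht⟩‖ := by
    rw [smul_sub, rpow_smul_unweight, rpow_smul_unweight]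
  rw [norm_smul, Real.norm_of_nonneg (Real.rpow_nonneg ht.1.le _)] at this
  rw [this, ← dist_eq_norm]
  exact BoundedContinuousFunction.dist_coe_le_dist _

namespace EvolutionSystem

variable (hE : EvolutionSystem SX SY f Z C α L ρ)
include hE

theorem weighted_duhamelInt_le {g : ℝ → X} {K : ℝ} (hg : Forcing g T K (α * ρ)) {t : ℝ}
    (ht : t ∈ Ioc 0 T) :
    t ^ α * ‖duhamelInt SY g t‖ ≤ C * K * betaInt α (α * ρ) * T ^ (1 - α * ρ) := by
  have h1 := hE.familyY.norm_duhamelInt_le hg ht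
  have ht0 := ht.1
  have hC := hE.familyY.nonneg
  have hK := hg.nonneg
  have hB := betaInt_nonneg α (α * ρ)
  have hαρ := hE.mul_lt_one
  calc t ^ α * ‖duhamelInt SY g t‖ ≤ t ^ α * (C * K * betaInt α (α * ρ) * t ^ (1 - α - α * ρ)) := by
        gcongr
    _ = C * K * betaInt α (α * ρ) * t ^ (1 - α * ρ) := by
        rw [show 1 - α * ρ = α + (1 - α - α * ρ) by ring, Real.rpow_add ht0]
        ring
    _ ≤ _ := by
        have := Real.rpow_le_rpow ht0.le ht.2 (by linarith : 0 ≤ 1 - α * ρ)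
        gcongr

/-- The map whose fixed points are the weighted solutions. -/
noncomputable def picard (T : ℝ) (x₀ : X) (v : BoundedContinuousFunction (Ioc 0 T) Y) :
    BoundedContinuousFunction (Ioc 0 T) Y :=
  BoundedContinuousFunction.ofNormedAddCommGroup
    (fun t : Ioc 0 T => (t : ℝ) ^ α • (SY t x₀ + duhamelInt SY (fun s => f (unweight α T v s)) t))
    (by
      have hF := hE.forcing (norm_nonneg v) (weighted_unweight (α := α) v le_rfl)
      have h1 : ContinuousOn (fun t => SY t x₀) (Ioc 0 T) := fun t ht =>
        tendsto_nhdsWithin_of_tendsto_nhds (hE.familyY.tendsto x₀ t ht.1)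
      have h2 := h1.add (hE.familyY.continuousOn_duhamelInt hF)
      have h3 : ContinuousOn (fun t : ℝ => t ^ α) (Ioc 0 T) :=
        continuousOn_id.rpow_const fun t ht => Or.inl ht.1.ne'
      exact continuousOn_iff_continuous_domRestrict.1 (h3.smul h2))
    (C * ‖x₀‖ + C * (L * ‖v‖ ^ ρ) * betaInt α (α * ρ) * T ^ (1 - α * ρ)) fun t => by
      have hF := hE.forcing (norm_nonneg v) (weighted_unweight (α := α) v le_rfl)
      rw [norm_smul, Real.norm_of_nonneg (Real.rpow_nonneg t.2.1.le _)]
      have h0 := Real.rpow_nonneg t.2.1.le α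
      calc _ ≤ (t : ℝ) ^ α * (‖SY t x₀‖ + ‖duhamelInt SY (fun s => f (unweight α T v s)) t‖) := by
            gcongr
            exact norm_add_le _ _
        _ ≤ _ := by
            rw [mul_add]
            exact add_le_add (hE.weighted_apply_le x₀ t.2.1) (hE.weighted_duhamelInt_le hF t.2)

theorem picard_apply (x₀ : X) (v : BoundedContinuousFunction (Ioc 0 T) Y) (t : Ioc 0 T) :
    picard hE T x₀ v t =
      (t : ℝ) ^ α • (SY t x₀ + duhamelInt SY (fun s => f (unweight α T v s)) t) := rfl

theorem norm_picard_le (x₀ : X) (v : BoundedContinuousFunction (Ioc 0 T) Y) (hv : ‖v‖ ≤ R)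
    (hT : 0 < T) :
    ‖picard hE T x₀ v‖ ≤ C * ‖x₀‖ + C * (L * R ^ ρ) * betaInt α (α * ρ) * T ^ (1 - α * ρ) := by
  have hC := hE.familyY.nonneg
  have hL := hE.nonneg
  have hρ := hE.one_lt
  have hB := betaInt_nonneg α (α * ρ)
  refine (BoundedContinuousFunction.norm_ofNormedAddCommGroup_le _ (by positivity) _).trans ?_
  gcongr

theorem dist_picard_le (x₀ : X) (v v' : BoundedContinuousFunction (Ioc 0 T) Y) (hv : ‖v‖ ≤ R)
    (hv' : ‖v'‖ ≤ R) (hT : 0 < T) :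
    dist (picard hE T x₀ v) (picard hE T x₀ v') ≤
      C * (L * (2 * R ^ (ρ - 1)) * dist v v') * betaInt α (α * ρ) * T ^ (1 - α * ρ) := by
  have hR : 0 ≤ R := (norm_nonneg v).trans hv
  have hC := hE.familyY.nonneg
  have hL := hE.nonneg
  have hB := betaInt_nonneg α (α * ρ)
  refine (BoundedContinuousFunction.dist_le (by positivity)).2 fun t => ?_
  have hF := hE.forcing hR (weighted_unweight (α := α) v hv)
  have hF' := hE.forcing hR (weighted_unweight (α := α) v' hv')
  have hd := hE.forcing_sub (lam := 0) hR (weighted_unweight (α := α) v hv)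
    (weighted_unweight (α := α) v' hv') (dist_nonneg : 0 ≤ dist v v')
    (by simpa using fun t h1 h2 => weighted_unweight_sub_le (α := α) v v' ⟨h1, h2⟩)
  simp only [neg_zero, zero_mul, Real.exp_zero, one_smul] at hd
  have e : picard hE T x₀ v t - picard hE T x₀ v' t = (t : ℝ) ^ α •
      duhamelInt SY (fun s => f (unweight α T v s) - f (unweight α T v' s)) t := by
    rw [← hE.familyY.duhamelInt_sub hF hF' t.2]
    rw [picard_apply, picard_apply, ← smul_sub]
    congr 1
    abel
  rw [dist_eq_norm, e, norm_smul, Real.norm_of_nonneg (Real.rpow_nonneg t.2.1.le _)]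
  exact hE.weighted_duhamelInt_le hd t.2

/-- Contraction on a ball of bounded continuous functions `t^α w(t)` on `(0,T]`. Radius and time are
chosen from `M` alone, before the datum. -/
theorem exists_mildY [CompleteSpace Y] {M : ℝ} (hM : 0 ≤ M) : ∃ T R : ℝ, 0 < T ∧ 0 ≤ R ∧
    ∀ x₀ : X, ‖x₀‖ ≤ M → ∃ w, MildY SY f α T x₀ w R := by
  have hC := hE.familyY.nonneg
  have hL := hE.nonneg
  have hB := betaInt_nonneg α (α * ρ)
  have hαρ := hE.mul_lt_one
  -- The linear part has weighted norm at most `C M`; the `1` leaves room for the Duhamel term.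
  set R := C * M + 1 with hR
  have hR0 : 0 ≤ R := by positivity
  set Q := C * (L * R ^ ρ) * betaInt α (α * ρ) with hQ
  set Q' := C * (L * (2 * R ^ (ρ - 1))) * betaInt α (α * ρ) with hQ'
  have hQ0 : 0 ≤ Q := by positivity
  have hQ0' : 0 ≤ Q' := by positivity
  -- Makes `T^{1-αρ} = 1/(2(Q+Q')+1)`, hence `Q T^{1-αρ} ≤ 1` (the ball is preserved) and `Q'
  -- T^{1-αρ} ≤ 1/2` (contraction).
  set T := (2 * (Q + Q') + 1) ^ (-(1 / (1 - α * ρ))) with hT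
  have hT0 : 0 < T := by positivity
  have hTp : T ^ (1 - α * ρ) = 1 / (2 * (Q + Q') + 1) := by
    have : 1 - α * ρ ≠ 0 := by linarith
    rw [hT, ← Real.rpow_mul (by positivity), neg_mul, one_div_mul_cancel this, Real.rpow_neg_one, one_div]
  have hQT : Q * T ^ (1 - α * ρ) ≤ 1 := by
    rw [hTp, mul_one_div, div_le_one (by positivity)]
    linarith
  have hQT' : Q' * T ^ (1 - α * ρ) ≤ 1 / 2 := by
    rw [hTp, mul_one_div, div_le_div_iff₀ (by positivity) (by norm_num)]
    linarith
  refine ⟨T, R, hT0, hR0, fun x₀ hx₀ => ?_⟩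
  set s := Metric.closedBall (0 : BoundedContinuousFunction (Ioc 0 T) Y) R with hs
  have hmem : ∀ v ∈ s, ‖v‖ ≤ R := fun v hv => by simpa [hs] using hv
  have hmaps : MapsTo (picard hE T x₀) s s := by
    intro v hv
    rw [hs, mem_closedBall_zero_iff]
    have h1 := hE.norm_picard_le x₀ v (hmem v hv) hT0
    have h2 : C * ‖x₀‖ ≤ C * M := by gcongr
    linarith
  have hcontr : ContractingWith (1 / 2) (hmaps.restrict (picard hE T x₀) s s) := by
    refine ⟨by rw [← NNReal.coe_lt_coe]; norm_num, LipschitzWith.of_dist_le_mul fun v v' => ?_⟩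
    have h1 := hE.dist_picard_le x₀ v v' (hmem v v.2) (hmem v' v'.2) hT0
    rw [Subtype.dist_eq]
    simp only [MapsTo.val_restrict_apply]
    calc _ ≤ _ := h1
      _ = Q' * T ^ (1 - α * ρ) * dist v v' := by rw [hQ', Subtype.dist_eq]; ring
      _ ≤ 1 / 2 * dist v v' := by gcongr
      _ = _ := by push_cast; rfl
  obtain ⟨v, hv, hfix, -⟩ := hcontr.exists_fixedPoint' (Metric.isClosed_closedBall.isComplete) hmaps
    (x := 0) (by simp [hs, hR0]) (edist_ne_top _ _)
  refine ⟨unweight α T v, { weighted_unweight v (hmem v hv) with eq := fun t ht => ?_ }⟩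
  have h1 : picard hE T x₀ v ⟨t, ht⟩ = v ⟨t, ht⟩ := by rw [hfix]
  rw [unweight_apply v ht, ← h1, picard_apply, smul_smul, ← Real.rpow_add ht.1, neg_add_cancel, Real.rpow_zero, one_smul]

end EvolutionSystem

end Evolution

/-! ### The power nonlinearity from `L^{ρp}` to `L^p` -/

section Power

theorem rpow_mul_sub_le {ρ a b : ℝ} (hρ : 1 < ρ) (hb : 0 ≤ b) (hab : b ≤ a) :
    a ^ (ρ - 1) * a - b ^ (ρ - 1) * b ≤ ρ * a ^ (ρ - 1) * (a - b) := by
  have key : ∀ c : ℝ, 0 ≤ c → c ^ (ρ - 1) * c = c ^ ρ := fun c hc => by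
    nth_rewrite 2 [← Real.rpow_one c]
    rw [← Real.rpow_add_of_nonneg hc (by linarith) zero_le_one, sub_add_cancel]
  rcases (hb.trans hab).eq_or_lt with rfl | ha
  · have : b = 0 := le_antisymm hab hb
    simp [this]
  -- Bernoulli's inequality `(b/a)^ρ ≥ 1 + ρ(b/a - 1)`, to be multiplied by `a^ρ`.
  have h := one_add_mul_self_le_rpow_one_add (s := b / a - 1) (by linarith [div_nonneg hb ha.le]) hρ.le
  rw [add_sub_cancel, Real.div_rpow hb ha.le, le_div_iff₀ (Real.rpow_pos_of_pos ha _), ← key a ha.le] at h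
  have h2 : (1 + ρ * (b / a - 1)) * (a ^ (ρ - 1) * a) =
      a ^ (ρ - 1) * a - ρ * a ^ (ρ - 1) * (a - b) := by
    field_simp
    ring
  rw [key b hb]
  linarith

/-- For equal signs this reduces to `rpow_mul_sub_le`. For opposite signs `|a - b| = |a| + |b|`, and
the bound holds term by term. -/
theorem abs_signed_rpow_sub_le {ρ : ℝ} (hρ : 1 < ρ) (a b : ℝ) :
    |(|a| ^ (ρ - 1) * a - |b| ^ (ρ - 1) * b)| ≤ ρ * (|a| ^ (ρ - 1) * |a - b| + |b| ^ (ρ - 1) * |a - b|) := by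
  have main : ∀ a b : ℝ, 0 ≤ b → b ≤ a → |(a ^ (ρ - 1) * a - b ^ (ρ - 1) * b)| ≤
      ρ * (a ^ (ρ - 1) * (a - b) + b ^ (ρ - 1) * (a - b)) := by
    intro a b hb hab
    have h0 : b ^ (ρ - 1) * b ≤ a ^ (ρ - 1) * a :=
      mul_le_mul (Real.rpow_le_rpow hb hab (by linarith)) hab hb (Real.rpow_nonneg (hb.trans hab) _)
    have h1 : 0 ≤ b ^ (ρ - 1) * (a - b) := mul_nonneg (Real.rpow_nonneg hb _) (by linarith)
    rw [abs_of_nonneg (by linarith)]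
    have := rpow_mul_sub_le hρ hb hab
    nlinarith
  have opp : ∀ a b : ℝ, 0 ≤ a → 0 ≤ b → a ^ (ρ - 1) * a + b ^ (ρ - 1) * b ≤
      ρ * (a ^ (ρ - 1) * (a + b) + b ^ (ρ - 1) * (a + b)) := by
    intro a b ha hb
    have h1 := Real.rpow_nonneg ha (ρ - 1)
    have h2 := Real.rpow_nonneg hb (ρ - 1)
    have : a ^ (ρ - 1) * a + b ^ (ρ - 1) * b ≤ a ^ (ρ - 1) * (a + b) + b ^ (ρ - 1) * (a + b) := by
      gcongr <;> linarith
    have h3 : 0 ≤ a ^ (ρ - 1) * (a + b) + b ^ (ρ - 1) * (a + b) := by positivity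
    nlinarith
  have same : ∀ a b : ℝ, 0 ≤ a → 0 ≤ b → |(a ^ (ρ - 1) * a - b ^ (ρ - 1) * b)| ≤
      ρ * (a ^ (ρ - 1) * |a - b| + b ^ (ρ - 1) * |a - b|) := by
    intro a b ha hb
    rcases le_total b a with h | h
    · rw [abs_of_nonneg (sub_nonneg.2 h)]
      exact main a b hb h
    · rw [abs_sub_comm, abs_sub_comm a, abs_of_nonneg (sub_nonneg.2 h), add_comm]
      exact main b a ha h
  rcases le_total 0 a with ha | ha <;> rcases le_total 0 b with hb | hb
  · rw [abs_of_nonneg ha, abs_of_nonneg hb]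
    exact same a b ha hb
  · rw [abs_of_nonneg ha, abs_of_nonpos hb, abs_of_nonneg (by linarith : 0 ≤ a - b)]
    have h := opp a (-b) ha (by linarith)
    rw [abs_of_nonneg]
    · simpa [sub_eq_add_neg] using h
    · have h1 := mul_nonneg (Real.rpow_nonneg ha (ρ - 1)) ha
      have h2 := mul_nonneg (Real.rpow_nonneg (neg_nonneg.2 hb) (ρ - 1)) (neg_nonneg.2 hb)
      linarith
  · rw [abs_of_nonpos ha, abs_of_nonneg hb, abs_sub_comm, abs_sub_comm a,
      abs_of_nonneg (by linarith : 0 ≤ b - a)]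
    have h := opp (-a) b (by linarith) hb
    rw [abs_of_nonneg]
    · rw [show -a + b = b - a by ring] at h
      linarith
    · have h1 := mul_nonneg (Real.rpow_nonneg hb (ρ - 1)) hb
      have h2 := mul_nonneg (Real.rpow_nonneg (neg_nonneg.2 ha) (ρ - 1)) (neg_nonneg.2 ha)
      linarith
  · rw [abs_of_nonpos ha, abs_of_nonpos hb]
    have h := same (-a) (-b) (by linarith) (by linarith)
    rw [show -a - -b = -(a - b) by ring, abs_neg, ← abs_neg] at h
    convert h using 2
    ring

variable {Ω : Type*} [MeasurableSpace Ω] {μ : Measure Ω} {ρ : ℝ} {p q : ℝ≥0∞}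

theorem holderTriple_of_eq_mul (hρ : 1 < ρ) (hq : q = ENNReal.ofReal ρ * p) :
    ENNReal.HolderTriple (p * ENNReal.ofReal (ρ / (ρ - 1))) q p := by
  have h0 : 0 < ρ - 1 := by linarith
  have hρ0 : 0 < ρ := by linarith
  have h1 : ENNReal.ofReal (ρ / (ρ - 1)) ≠ 0 := by simpa using div_pos hρ0 h0
  have h2 : ENNReal.ofReal ρ ≠ 0 := by simpa using hρ0
  constructor
  rw [hq, ENNReal.mul_inv (Or.inr ENNReal.ofReal_ne_top) (Or.inr h1),
    ENNReal.mul_inv (Or.inl h2) (Or.inl ENNReal.ofReal_ne_top), mul_comm _ p⁻¹, ← mul_add,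
    ← ENNReal.ofReal_inv_of_pos (div_pos hρ0 h0), ← ENNReal.ofReal_inv_of_pos hρ0,
    ← ENNReal.ofReal_add (by positivity) (by positivity)]
  have : (ρ / (ρ - 1))⁻¹ + ρ⁻¹ = 1 := by
    field_simp
    ring
  rw [this, ENNReal.ofReal_one, mul_one]

theorem aestronglyMeasurable_signed_rpow {φ : Ω → ℝ} (hφ : AEStronglyMeasurable φ μ) (r : ℝ) :
    AEStronglyMeasurable (fun a => |φ a| ^ r * φ a) μ :=
  ((hφ.norm.aemeasurable.pow_const r).aestronglyMeasurable).mul hφ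

theorem memLp_signed_rpow (hρ : 1 < ρ) (hq : q = ENNReal.ofReal ρ * p) {φ : Ω → ℝ} (hφ : MemLp φ q μ) :
    MemLp (fun a => |φ a| ^ (ρ - 1) * φ a) p μ := by
  refine ⟨aestronglyMeasurable_signed_rpow hφ.1 _, ?_⟩
  have h1 : eLpNorm (fun a => |φ a| ^ (ρ - 1) * φ a) p μ = eLpNorm (fun a => ‖φ a‖ ^ ρ) p μ := by
    refine eLpNorm_congr_norm_ae (ae_of_all _ fun a => ?_)
    rw [norm_mul, Real.norm_eq_abs (φ a), Real.norm_of_nonneg (Real.rpow_nonneg (abs_nonneg _) _),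
      Real.norm_of_nonneg (Real.rpow_nonneg (abs_nonneg _) _)]
    nth_rewrite 2 [← Real.rpow_one |φ a|]
    rw [← Real.rpow_add_of_nonneg (abs_nonneg _) (by linarith) zero_le_one, sub_add_cancel]
  rw [h1, eLpNorm_norm_rpow _ (by linarith), mul_comm, ← hq]
  exact ENNReal.rpow_lt_top_of_nonneg (by linarith) hφ.2.ne

/-- Hölder with exponents `ρp/(ρ-1)` and `ρp`; the norm of `|φ|^{ρ-1}` in the former is the power
`ρ-1` of the norm of `φ` in `L^{ρp}`. -/
theorem eLpNorm_rpow_mul_le (hρ : 1 < ρ) (hq : q = ENNReal.ofReal ρ * p) {φ ψ : Ω → ℝ}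
    (hφ : AEStronglyMeasurable φ μ) (hψ : AEStronglyMeasurable ψ μ) :
    eLpNorm (fun a => |φ a| ^ (ρ - 1) * |ψ a|) p μ ≤ eLpNorm φ q μ ^ (ρ - 1) * eLpNorm ψ q μ := by
  have h0 : 0 < ρ - 1 := by linarith
  have := holderTriple_of_eq_mul hρ hq
  have h1 : AEStronglyMeasurable (fun a => ‖φ a‖ ^ (ρ - 1)) μ :=
    (hφ.norm.aemeasurable.pow_const _).aestronglyMeasurable
  have h2 := eLpNorm_smul_le_mul_eLpNorm (p := p * ENNReal.ofReal (ρ / (ρ - 1))) (q := q) (r := p)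
    hψ.norm h1
  rw [eLpNorm_norm_rpow _ h0, eLpNorm_norm, mul_assoc, ← ENNReal.ofReal_mul (by positivity),
    div_mul_cancel₀ _ h0.ne', mul_comm p, ← hq] at h2
  exact h2

theorem eLpNorm_signed_rpow_sub_le [hp : Fact (1 ≤ p)] (hρ : 1 < ρ) (hq : q = ENNReal.ofReal ρ * p)
    {φ ψ : Ω → ℝ} (hφ : AEStronglyMeasurable φ μ) (hψ : AEStronglyMeasurable ψ μ) :
    eLpNorm (fun a => |φ a| ^ (ρ - 1) * φ a - |ψ a| ^ (ρ - 1) * ψ a) p μ ≤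
      ENNReal.ofReal ρ * (eLpNorm φ q μ ^ (ρ - 1) * eLpNorm (φ - ψ) q μ +
        eLpNorm ψ q μ ^ (ρ - 1) * eLpNorm (φ - ψ) q μ) := by
  have hm : ∀ χ : Ω → ℝ, AEStronglyMeasurable χ μ →
      AEStronglyMeasurable (fun a => |χ a| ^ (ρ - 1) * |(φ - ψ) a|) μ := fun χ hχ =>
    ((hχ.norm.aemeasurable.pow_const _).aestronglyMeasurable).mul (hφ.sub hψ).norm
  have h1 := eLpNorm_le_mul_eLpNorm_of_ae_le_mul (p := p) (μ := μ) (c := ρ)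
    (f := fun a => |φ a| ^ (ρ - 1) * φ a - |ψ a| ^ (ρ - 1) * ψ a)
    (g := (fun a => |φ a| ^ (ρ - 1) * |(φ - ψ) a|) + fun a => |ψ a| ^ (ρ - 1) * |(φ - ψ) a|)
    (ae_of_all _ fun a => by
      have h := abs_signed_rpow_sub_le hρ (φ a) (ψ a)
      rw [Real.norm_eq_abs]
      refine h.trans (mul_le_mul_of_nonneg_left (Real.le_norm_self _) (by linarith)))
  refine h1.trans ?_
  gcongr
  refine (eLpNorm_add_le (hm φ hφ) (hm ψ hψ) hp.out).trans ?_
  gcongr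
  · exact eLpNorm_rpow_mul_le hρ hq hφ (hφ.sub hψ)
  · exact eLpNorm_rpow_mul_le hρ hq hψ (hφ.sub hψ)

/-- The map `φ ↦ |φ|^{ρ-1} φ` from `L^{ρp}` to `L^p`. -/
noncomputable def powerMap (μ : Measure Ω) (hρ : 1 < ρ) (hq : q = ENNReal.ofReal ρ * p) (φ : Lp ℝ q μ) :
    Lp ℝ p μ :=
  (memLp_signed_rpow hρ hq (Lp.memLp φ)).toLp _

theorem coeFn_powerMap (hρ : 1 < ρ) (hq : q = ENNReal.ofReal ρ * p) (φ : Lp ℝ q μ) :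
    powerMap μ hρ hq φ =ᵐ[μ] fun a => |φ a| ^ (ρ - 1) * φ a :=
  MemLp.coeFn_toLp _

theorem powerMap_zero (hρ : 1 < ρ) (hq : q = ENNReal.ofReal ρ * p) : powerMap μ hρ hq 0 = 0 := by
  refine Lp.ext ?_
  filter_upwards [coeFn_powerMap (μ := μ) hρ hq 0, Lp.coeFn_zero ℝ q μ, Lp.coeFn_zero ℝ p μ] with a h1 h2 h3
  rw [h1, h2, h3, Pi.zero_apply, mul_zero]

theorem norm_powerMap_sub_le [Fact (1 ≤ p)] [Fact (1 ≤ q)] (hρ : 1 < ρ) (hq : q = ENNReal.ofReal ρ * p)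
    (φ ψ : Lp ℝ q μ) :
    ‖powerMap μ hρ hq φ - powerMap μ hρ hq ψ‖ ≤ ρ * (‖φ‖ ^ (ρ - 1) + ‖ψ‖ ^ (ρ - 1)) * ‖φ - ψ‖ := by
  have h := eLpNorm_signed_rpow_sub_le hρ hq (Lp.aestronglyMeasurable φ) (Lp.aestronglyMeasurable ψ)
  have e1 : eLpNorm (fun a => |φ a| ^ (ρ - 1) * φ a - |ψ a| ^ (ρ - 1) * ψ a) p μ =
      ‖powerMap μ hρ hq φ - powerMap μ hρ hq ψ‖ₑ := by
    rw [Lp.enorm_def]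
    refine eLpNorm_congr_ae ?_
    filter_upwards [coeFn_powerMap hρ hq φ, coeFn_powerMap hρ hq ψ,
      Lp.coeFn_sub (powerMap μ hρ hq φ) (powerMap μ hρ hq ψ)] with a h1 h2 h3
    rw [h3, Pi.sub_apply, h1, h2]
  have e2 : eLpNorm ((φ : Ω → ℝ) - (ψ : Ω → ℝ)) q μ = ‖φ - ψ‖ₑ := by
    rw [Lp.enorm_def]
    exact eLpNorm_congr_ae (Lp.coeFn_sub φ ψ).symm
  rw [e1, e2, ← Lp.enorm_def, ← Lp.enorm_def] at h
  have hρ0 : 0 < ρ - 1 := by linarith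
  rw [← ofReal_norm, ← ofReal_norm, ← ofReal_norm, ← ofReal_norm,
    ENNReal.ofReal_rpow_of_nonneg (norm_nonneg _) hρ0.le,
    ENNReal.ofReal_rpow_of_nonneg (norm_nonneg _) hρ0.le,
    ← ENNReal.ofReal_mul (by positivity), ← ENNReal.ofReal_mul (by positivity),
    ← ENNReal.ofReal_add (by positivity) (by positivity), ← ENNReal.ofReal_mul (by linarith),
    ENNReal.ofReal_le_ofReal_iff (by positivity)] at h
  linarith

end Power

/-! ### Identification of elements of `L^p` and `L^q` -/

section Compatible

variable {Ω : Type*} [MeasurableSpace Ω] {μ : Measure Ω} {p q : ℝ≥0∞}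

/-- The pairs of elements of `L^p` and `L^q` that are represented by the same function. -/
def compatible (p q : ℝ≥0∞) (μ : Measure Ω) : Submodule ℝ (Lp ℝ p μ × Lp ℝ q μ) where
  carrier := {x | x.1 =ᵐ[μ] x.2}
  add_mem' {x y} (hx : x.1 =ᵐ[μ] x.2) (hy : y.1 =ᵐ[μ] y.2) :=
    ((Lp.coeFn_add x.1 y.1).trans (hx.add hy)).trans (Lp.coeFn_add x.2 y.2).symm
  zero_mem' := (Lp.coeFn_zero ℝ p μ).trans (Lp.coeFn_zero ℝ q μ).symm
  smul_mem' c x (hx : x.1 =ᵐ[μ] x.2) :=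
    ((Lp.coeFn_smul c x.1).trans (hx.const_smul c)).trans (Lp.coeFn_smul c x.2).symm

theorem mem_compatible {x : Lp ℝ p μ × Lp ℝ q μ} : x ∈ compatible p q μ ↔ x.1 =ᵐ[μ] x.2 := Iff.rfl

/-- On a space of infinite measure neither of `L^p` and `L^q` contains the other, but convergence in
either implies convergence in measure, whose limits are unique almost everywhere. -/
theorem isClosed_compatible [Fact (1 ≤ p)] [Fact (1 ≤ q)] :
    IsClosed (compatible p q μ : Set (Lp ℝ p μ × Lp ℝ q μ)) := by
  refine IsSeqClosed.isClosed fun x z hx hz => ?_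
  have h1 : TendstoInMeasure μ (fun n => ((x n).1 : Ω → ℝ)) atTop z.1 :=
    tendstoInMeasure_of_tendsto_Lp ((continuous_fst.tendsto z).comp hz)
  have h2 : TendstoInMeasure μ (fun n => ((x n).2 : Ω → ℝ)) atTop z.2 :=
    tendstoInMeasure_of_tendsto_Lp ((continuous_snd.tendsto z).comp hz)
  exact tendstoInMeasure_ae_unique h1 (h2.congr_left fun n => (mem_compatible.1 (hx n)).symm)

end Compatible

/-! ### Translation to the Grushin problem and conclusion -/

section Solution

variable {N k : ℕ} {ρ T R : ℝ} {p q : ℝ≥0∞}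

theorem semigroup_eq_kernelInt {t : ℝ} (ht : 0 < t) (φ : Space N k → ℝ) :
    semigroup t φ = kernelInt volume (heat t) φ := by
  funext a
  exact if_pos ht

theorem ne_top_of_eq_mul (hp : p ≠ ∞) (hq : q = ENNReal.ofReal ρ * p) : q ≠ ∞ :=
  hq ▸ ENNReal.mul_ne_top ENNReal.ofReal_ne_top hp

theorem le_of_eq_mul (hρ : 1 < ρ) (hq : q = ENNReal.ofReal ρ * p) : p ≤ q := by
  rw [hq]
  exact le_mul_of_one_le_left' (by rw [← ENNReal.ofReal_one]; exact ENNReal.ofReal_le_ofReal hρ.le)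

theorem toReal_of_eq_mul (hρ : 1 < ρ) (hq : q = ENNReal.ofReal ρ * p) : q.toReal = ρ * p.toReal := by
  rw [hq, ENNReal.toReal_mul, ENNReal.toReal_ofReal (by linarith)]

variable [Fact (1 ≤ p)] [Fact (1 ≤ q)]

/-- The semigroup on `L^p`. -/
noncomputable def heatSemigroup (hN : 1 ≤ N) (hk : 1 ≤ k) (hp : p ≠ ∞) (t : ℝ) :
    Lp ℝ p (volume : Measure (Space N k)) →L[ℝ] Lp ℝ p (volume : Measure (Space N k)) :=
  if 0 < t then heatOp hN hk hp le_rfl t else ContinuousLinearMap.id ℝ _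

theorem heatSemigroup_of_pos (hN : 1 ≤ N) (hk : 1 ≤ k) (hp : p ≠ ∞) {t : ℝ} (ht : 0 < t) :
    (heatSemigroup hN hk hp t : Lp ℝ p (volume : Measure (Space N k)) →L[ℝ] _) =
      heatOp hN hk hp le_rfl t := if_pos ht

theorem coeFn_heatSemigroup (hN : 1 ≤ N) (hk : 1 ≤ k) (hp : p ≠ ∞) (t : ℝ)
    (φ : Lp ℝ p (volume : Measure (Space N k))) :
    heatSemigroup hN hk hp t φ =ᵐ[volume] semigroup t φ := by
  by_cases ht : 0 < t
  · rw [heatSemigroup_of_pos hN hk hp ht, semigroup_eq_kernelInt ht]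
    exact coeFn_heatOp hN hk hp le_rfl ht φ
  · have : semigroup t φ = φ := funext fun a => if_neg ht
    rw [heatSemigroup, if_neg ht, this]
    rfl

theorem singularFamily_heatSemigroup (hN : 1 ≤ N) (hk : 1 ≤ k) (hp : p ≠ ∞) :
    SingularFamily (heatSemigroup hN hk hp :
      ℝ → Lp ℝ p (volume : Measure (Space N k)) →L[ℝ] Lp ℝ p (volume : Measure (Space N k))) 1 0 where
  norm_le t ht := by
    rw [neg_zero, Real.rpow_zero, one_mul, heatSemigroup_of_pos hN hk hp ht]
    exact norm_heatOp_le_one hN hk hp t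
  tendsto φ t ht := by
    have h := tendsto_heatOp hN hk hp le_rfl ht φ
    rw [heatSemigroup_of_pos hN hk hp ht]
    refine h.congr' ?_
    filter_upwards [lt_mem_nhds ht] with s hs
    rw [heatSemigroup_of_pos hN hk hp hs]
  nonneg := zero_le_one
  exponent_nonneg := le_rfl
  exponent_lt := zero_lt_one

omit [Fact (1 ≤ p)] [Fact (1 ≤ q)] in
theorem alpha_nonneg (hρ : 1 < ρ) : 0 ≤ alpha N k ρ p :=
  div_nonneg (mul_nonneg (by positivity) (by linarith))
    (mul_nonneg (by linarith) ENNReal.toReal_nonneg)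

/-- `αρ = (N+2k)(ρ-1)/(2p)`, so this is the hypothesis on `p`. -/
theorem alpha_mul_lt_one (hρ : 1 < ρ) (hp_top : p ≠ ∞)
    (hp : ((N : ℝ) + 2 * k) / 2 * (ρ - 1) < p.toReal) : alpha N k ρ p * ρ < 1 := by
  have h1 := one_le_toReal (Fact.out : 1 ≤ p) hp_top
  have h2 : alpha N k ρ p * ρ = ((N : ℝ) + 2 * k) / 2 * (ρ - 1) / p.toReal := by
    unfold alpha
    field_simp
  rw [h2, div_lt_one (by linarith)]
  exact hp

/-- For `q = ρp` the smoothing exponent `(N+2k)/2 · (1/p - 1/q)` equals `α`. -/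
theorem singularFamily_heatOp (hN : 1 ≤ N) (hk : 1 ≤ k) (hρ : 1 < ρ) (hp_top : p ≠ ∞)
    (hp : ((N : ℝ) + 2 * k) / 2 * (ρ - 1) < p.toReal) (hq : q = ENNReal.ofReal ρ * p) :
    SingularFamily (heatOp hN hk (ne_top_of_eq_mul hp_top hq) (le_of_eq_mul hρ hq) :
      ℝ → Lp ℝ p (volume : Measure (Space N k)) →L[ℝ] Lp ℝ q (volume : Measure (Space N k)))
      (heatBound N k hN ^ (1 / p.toReal - 1 / q.toReal)) (alpha N k ρ p) where
  norm_le t ht := by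
    refine (norm_heatOp_le hN hk _ _ ht).trans_eq ?_
    congr 3
    have h1 := one_le_toReal (Fact.out : 1 ≤ p) hp_top
    have h2 : p.toReal ≠ 0 := by linarith
    have h3 : ρ ≠ 0 := by linarith
    rw [toReal_of_eq_mul hρ hq, alpha]
    field_simp
  tendsto φ t ht := tendsto_heatOp hN hk _ _ ht φ
  nonneg := Real.rpow_nonneg (heatBound_pos hN).le _
  exponent_nonneg := alpha_nonneg hρ
  exponent_lt := by
    have h1 := alpha_mul_lt_one hρ hp_top hp
    have h2 := alpha_nonneg (N := N) (k := k) (p := p) hρ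
    nlinarith

theorem evolutionSystem (hN : 1 ≤ N) (hk : 1 ≤ k) (hρ : 1 < ρ) (hp_top : p ≠ ∞)
    (hp : ((N : ℝ) + 2 * k) / 2 * (ρ - 1) < p.toReal) (hq : q = ENNReal.ofReal ρ * p) :
    EvolutionSystem (heatSemigroup hN hk hp_top)
      (heatOp hN hk (ne_top_of_eq_mul hp_top hq) (le_of_eq_mul hρ hq))
      (powerMap (volume : Measure (Space N k)) hρ hq) (compatible p q volume)
      (heatBound N k hN ^ (1 / p.toReal - 1 / q.toReal)) (alpha N k ρ p) ρ ρ where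
  familyX := singularFamily_heatSemigroup hN hk hp_top
  familyY := singularFamily_heatOp hN hk hρ hp_top hp hq
  apply_zero φ := by
    rw [heatSemigroup, if_neg (lt_irrefl _)]
    rfl
  tendsto_zero φ := by
    refine (tendsto_heatOp_zero hN hk hp_top φ).congr' ?_
    filter_upwards [self_mem_nhdsWithin] with t ht
    rw [heatSemigroup_of_pos hN hk hp_top ht]
  isClosed := isClosed_compatible
  mem t ht φ := by
    rw [heatSemigroup_of_pos hN hk hp_top ht]
    exact mem_compatible.2 ((coeFn_heatOp hN hk _ _ ht φ).trans (coeFn_heatOp hN hk _ _ ht φ).symm)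
  map_zero := powerMap_zero hρ hq
  lipschitz := norm_powerMap_sub_le hρ hq
  nonneg := by linarith
  one_lt := hρ
  mul_lt_one := alpha_mul_lt_one hρ hp_top hp

theorem isSemigroupValue_iff (hN : 1 ≤ N) (hk : 1 ≤ k) (hp_top : p ≠ ∞) {t : ℝ} (ht : 0 < t)
    {φ : Space N k → ℝ} {φ' g : Lp ℝ p (volume : Measure (Space N k))} (hφ : φ =ᵐ[volume] φ') :
    IsSemigroupValue t φ g ↔ g = heatSemigroup hN hk hp_top t φ' := by
  have h1 := coeFn_heatSemigroup hN hk hp_top t φ'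
  rw [semigroup_eq_kernelInt ht, ← kernelInt_congr hφ, ← semigroup_eq_kernelInt ht] at h1
  constructor
  · rintro ⟨-, h⟩
    exact Lp.ext (h.trans h1.symm)
  · rintro rfl
    refine ⟨ae_of_all _ fun a => ?_, h1⟩
    exact (bistochastic_heat hN hk ht).integrable Fact.out hp_top
      ((memLp_congr_ae hφ).2 (Lp.memLp φ')) a

omit [Fact (1 ≤ p)] [Fact (1 ≤ q)] in
theorem nonlinearity_ae_eq_powerMap (hρ : 1 < ρ) (hq : q = ENNReal.ofReal ρ * p)
    {φ : Space N k → ℝ} {ψ : Lp ℝ q (volume : Measure (Space N k))} (h : φ =ᵐ[volume] ψ) :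
    nonlinearity ρ φ =ᵐ[volume] powerMap volume hρ hq ψ := by
  filter_upwards [h, coeFn_powerMap hρ hq ψ] with a h1 h2
  rw [h2, nonlinearity, h1]

omit [Fact (1 ≤ p)] in
theorem eLpNorm_eq_of_compatible {φ : Lp ℝ p (volume : Measure (Space N k))}
    {ψ : Lp ℝ q (volume : Measure (Space N k))} (h : φ =ᵐ[volume] ψ) :
    eLpNorm φ q volume = ENNReal.ofReal ‖ψ‖ := by
  rw [eLpNorm_congr_ae h, ofReal_norm, Lp.enorm_def]

omit [Fact (1 ≤ p)] in
theorem eLpNorm_sub_eq_of_compatible {φ φ' : Lp ℝ p (volume : Measure (Space N k))}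
    {ψ ψ' : Lp ℝ q (volume : Measure (Space N k))} (h : φ =ᵐ[volume] ψ) (h' : φ' =ᵐ[volume] ψ') :
    eLpNorm (φ - φ' : Lp ℝ p (volume : Measure (Space N k))) q volume = ENNReal.ofReal ‖ψ - ψ'‖ :=
  eLpNorm_eq_of_compatible ((compatible p q volume).sub_mem (x := (φ, ψ)) (y := (φ', ψ')) h h')

/-- Solutions of the integral equation in `L^{ρp}` are mild solutions in `L^p`. -/
theorem isSolution_of_mildY (hN : 1 ≤ N) (hk : 1 ≤ k) (hρ : 1 < ρ) (hp_top : p ≠ ∞)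
    (hp : ((N : ℝ) + 2 * k) / 2 * (ρ - 1) < p.toReal) (hq : q = ENNReal.ofReal ρ * p)
    (hR : 0 ≤ R) {u₀ : Lp ℝ p (volume : Measure (Space N k))}
    {w : ℝ → Lp ℝ q (volume : Measure (Space N k))}
    (hw : MildY (heatOp hN hk (ne_top_of_eq_mul hp_top hq) (le_of_eq_mul hρ hq))
      (powerMap (volume : Measure (Space N k)) hρ hq) (alpha N k ρ p) T u₀ w R) :
    IsSolution ρ T u₀ (fun t => heatSemigroup hN hk hp_top t u₀ +
      duhamelInt (heatSemigroup hN hk hp_top) (fun s => powerMap volume hρ hq (w s)) t) ∧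
    xNorm ρ T (fun t => heatSemigroup hN hk hp_top t u₀ +
      duhamelInt (heatSemigroup hN hk hp_top) (fun s => powerMap volume hρ hq (w s)) t) ≤
      ENNReal.ofReal R := by
  have hE := evolutionSystem hN hk hρ hp_top hp hq
  set u : ℝ → Lp ℝ p (volume : Measure (Space N k)) := fun t => heatSemigroup hN hk hp_top t u₀ +
      duhamelInt (heatSemigroup hN hk hp_top) (fun s => powerMap volume hρ hq (w s)) t with hu
  have huw : ∀ t ∈ Ioc 0 T, u t =ᵐ[volume] w t := fun t ht =>
    mem_compatible.1 (hE.mem_of_mildY hR hw ht)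
  have hx : xNorm ρ T u ≤ ENNReal.ofReal R := by
    refine iSup₂_le fun t ht => ?_
    rw [← hq, eLpNorm_eq_of_compatible (huw t ht), ← ENNReal.ofReal_mul (Real.rpow_nonneg ht.1.le _)]
    exact ENNReal.ofReal_le_ofReal (hw.le t ht)
  refine ⟨⟨⟨hE.continuousOn_X hR hw.toWeighted u₀, fun t ht => ?_⟩,
    ⟨hx.trans_lt ENNReal.ofReal_lt_top, fun t₀ ht₀ => ?_⟩⟩, hx⟩
  · refine ⟨fun s => heatSemigroup hN hk hp_top (t - s) (powerMap volume hρ hq (w s)),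
      ae_of_all _ fun s hs => ?_, ?_, ?_⟩
    · refine (isSemigroupValue_iff hN hk hp_top (sub_pos.2 hs.2) ?_).2 rfl
      exact nonlinearity_ae_eq_powerMap hρ hq (huw s ⟨hs.1, hs.2.le.trans ht.2⟩)
    · rcases ht.1.eq_or_lt with rfl | h0
      · exact IntervalIntegrable.refl
      · exact hE.familyX.intervalIntegrable (hE.forcing hR hw.toWeighted) ⟨h0, ht.2⟩
    · exact (Lp.coeFn_add _ _).trans ((coeFn_heatSemigroup hN hk hp_top t u₀).add (ae_eq_refl _))
  · rw [← hq]
    have h1 := tendsto_iff_norm_sub_tendsto_zero.1 (hw.continuousOn t₀ ht₀)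
    have h2 := ENNReal.tendsto_ofReal h1
    rw [ENNReal.ofReal_zero] at h2
    refine h2.congr' ?_
    filter_upwards [self_mem_nhdsWithin] with t ht
    exact (eLpNorm_sub_eq_of_compatible (huw t ht) (huw t₀ ht₀)).symm

/-- The converse passage. The finite norm gives `L^{ρp}` representatives `w` of `u`, and uniqueness
of semigroup values identifies the Bochner integral in `L^p` with a Duhamel integral. The equation
in `L^{ρp}` follows by compatibility. -/
theorem exists_mildY_of_isSolution (hN : 1 ≤ N) (hk : 1 ≤ k) (hρ : 1 < ρ) (hp_top : p ≠ ∞)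
    (hp : ((N : ℝ) + 2 * k) / 2 * (ρ - 1) < p.toReal) (hq : q = ENNReal.ofReal ρ * p)
    (hR : 0 ≤ R) {u₀ : Lp ℝ p (volume : Measure (Space N k))}
    {u : ℝ → Lp ℝ p (volume : Measure (Space N k))} (hu : IsSolution ρ T u₀ u)
    (hx : xNorm ρ T u ≤ ENNReal.ofReal R) :
    ∃ w : ℝ → Lp ℝ q (volume : Measure (Space N k)),
      MildY (heatOp hN hk (ne_top_of_eq_mul hp_top hq) (le_of_eq_mul hρ hq))
        (powerMap (volume : Measure (Space N k)) hρ hq) (alpha N k ρ p) T u₀ w R ∧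
      ∀ t ∈ Ioc 0 T, u t = heatSemigroup hN hk hp_top t u₀ +
        duhamelInt (heatSemigroup hN hk hp_top) (fun s => powerMap volume hρ hq (w s)) t := by
  have hE := evolutionSystem hN hk hρ hp_top hp hq
  have hle : ∀ t ∈ Ioc 0 T,
      ENNReal.ofReal (t ^ alpha N k ρ p) * eLpNorm (u t) q volume ≤ ENNReal.ofReal R := by
    intro t ht
    rw [hq]
    exact (le_iSup₂ (f := fun t (_ : t ∈ Ioc 0 T) => ENNReal.ofReal (t ^ alpha N k ρ p) *
      eLpNorm (u t) (ENNReal.ofReal ρ * p) volume) t ht).trans hx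
  have hex : ∀ t, ∃ y : Lp ℝ q (volume : Measure (Space N k)), t ∈ Ioc 0 T → u t =ᵐ[volume] y := by
    intro t
    by_cases ht : t ∈ Ioc 0 T
    · have hfin : eLpNorm (u t) q volume < ∞ := by
        refine lt_top_iff_ne_top.2 fun h => ?_
        have h1 := hle t ht
        rw [h, ENNReal.mul_top (by simpa using Real.rpow_pos_of_pos ht.1 _)] at h1
        exact ENNReal.ofReal_ne_top (top_le_iff.1 h1)
      exact ⟨MemLp.toLp (u t) ⟨Lp.aestronglyMeasurable _, hfin⟩, fun _ => (MemLp.coeFn_toLp _).symm⟩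
    · exact ⟨0, fun h => absurd h ht⟩
  choose w huw using hex
  have hw : Weighted w (alpha N k ρ p) T R := by
    refine ⟨fun t₀ ht₀ => ?_, fun t ht => ?_⟩
    · refine tendsto_iff_norm_sub_tendsto_zero.2 ?_
      have h1 := hu.2.continuous t₀ ht₀
      rw [← hq] at h1
      have h2 := (ENNReal.tendsto_toReal ENNReal.zero_ne_top).comp h1
      rw [ENNReal.toReal_zero] at h2
      refine h2.congr' ?_
      filter_upwards [self_mem_nhdsWithin] with t ht
      rw [Function.comp_apply, eLpNorm_sub_eq_of_compatible (huw t ht) (huw t₀ ht₀),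
        ENNReal.toReal_ofReal (norm_nonneg _)]
    · have h1 := hle t ht
      rw [eLpNorm_eq_of_compatible (huw t ht), ← ENNReal.ofReal_mul (Real.rpow_nonneg ht.1.le _)] at h1
      exact (ENNReal.ofReal_le_ofReal_iff hR).1 h1
  have heq : ∀ t ∈ Ioc 0 T, u t = heatSemigroup hN hk hp_top t u₀ +
      duhamelInt (heatSemigroup hN hk hp_top) (fun s => powerMap volume hρ hq (w s)) t := by
    intro t ht
    obtain ⟨G, hG, -, hGu⟩ := hu.1.duhamel t ⟨ht.1.le, ht.2⟩
    have h1 : ∫ s in (0 : ℝ)..t, G s =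
        duhamelInt (heatSemigroup hN hk hp_top) (fun s => powerMap volume hρ hq (w s)) t := by
      refine intervalIntegral.integral_congr_ae ?_
      -- `G` is prescribed only on the open interval; the endpoint `s = t` is discarded as a null
      -- set.
      filter_upwards [hG, Measure.ae_ne volume t] with s hs hst hs0
      rw [uIoc_of_le ht.1.le] at hs0
      have hlt : s < t := lt_of_le_of_ne hs0.2 hst
      refine (isSemigroupValue_iff hN hk hp_top (sub_pos.2 hlt) ?_).1 (hs ⟨hs0.1, hlt⟩)
      exact nonlinearity_ae_eq_powerMap hρ hq (huw s ⟨hs0.1, hs0.2.trans ht.2⟩)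
    rw [← h1]
    refine Lp.ext (hGu.trans ?_)
    exact ((Lp.coeFn_add _ _).trans
      ((coeFn_heatSemigroup hN hk hp_top t u₀).add (ae_eq_refl _))).symm
  refine ⟨w, { hw with eq := fun t ht => ?_ }, heq⟩
  -- The right side of the equation in `L^q` and `w t` are both represented by `u t`, hence equal.
  have h1 := (compatible p q volume).add_mem (hE.mem t ht.1 u₀) (duhamelInt_mem hE.familyX hE.familyY
    hE.isClosed hE.mem (hE.forcing hR hw) ht)
  rw [Prod.mk_add_mk, ← heq t ht] at h1
  exact Lp.ext ((huw t ht).symm.trans (mem_compatible.1 h1))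

omit [Fact (1 ≤ q)] in
theorem IsSolution.apply_zero {u₀ : Lp ℝ p (volume : Measure (Space N k))}
    {u : ℝ → Lp ℝ p (volume : Measure (Space N k))} (hT : 0 ≤ T) (hu : IsSolution ρ T u₀ u) :
    u 0 = u₀ := by
  obtain ⟨G, -, -, h⟩ := hu.1.duhamel 0 ⟨le_rfl, hT⟩
  refine Lp.ext (h.trans ?_)
  rw [intervalIntegral.integral_same]
  filter_upwards [Lp.coeFn_zero ℝ p (volume : Measure (Space N k))] with a ha
  rw [ha, Pi.zero_apply, add_zero, semigroup, if_neg (lt_irrefl _)]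

omit [Fact (1 ≤ q)] in
theorem fact_one_le_mul (hρ : 1 < ρ) : Fact (1 ≤ ENNReal.ofReal ρ * p) :=
  ⟨(Fact.out : 1 ≤ p).trans (le_of_eq_mul hρ rfl)⟩

omit [Fact (1 ≤ q)] in
theorem exists_lipschitz (hN : 1 ≤ N) (hk : 1 ≤ k) (hρ : 1 < ρ) (hp_top : p ≠ ∞)
    (hp : ((N : ℝ) + 2 * k) / 2 * (ρ - 1) < p.toReal) (hT : 0 < T) (R : ℝ) : ∃ C : ℝ,
    ∀ (u₀ v₀ : Lp ℝ p (volume : Measure (Space N k)))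
      (u v : ℝ → Lp ℝ p (volume : Measure (Space N k))),
      IsSolution ρ T u₀ u → IsSolution ρ T v₀ v →
      xNorm ρ T u ≤ ENNReal.ofReal R → xNorm ρ T v ≤ ENNReal.ofReal R →
      ∀ t ∈ Icc 0 T, ‖u t - v t‖ ≤ C * ‖u₀ - v₀‖ := by
  have := fact_one_le_mul (p := p) hρ
  have hE := evolutionSystem hN hk hρ hp_top hp rfl
  -- A negative `R` counts as `0`, since `ENNReal.ofReal` truncates.
  have hR : ENNReal.ofReal R = ENNReal.ofReal (max R 0) := by simp
  obtain ⟨D, hD, h⟩ := hE.exists_lipschitz_X hT (le_max_right R 0)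
  -- The abstract estimate covers `t > 0`; at `t = 0` a constant at least `1` is needed.
  refine ⟨D + 1, fun u₀ v₀ u v hu hv hxu hxv t ht => ?_⟩
  rcases ht.1.eq_or_lt with rfl | h0
  · rw [hu.apply_zero hT.le, hv.apply_zero hT.le]
    exact le_mul_of_one_le_left (norm_nonneg _) (by linarith)
  · rw [hR] at hxu hxv
    obtain ⟨w, hw, hwu⟩ := exists_mildY_of_isSolution hN hk hρ hp_top hp rfl (le_max_right R 0) hu hxu
    obtain ⟨w', hw', hwv⟩ := exists_mildY_of_isSolution hN hk hρ hp_top hp rfl (le_max_right R 0) hv hxv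
    rw [hwu t ⟨h0, ht.2⟩, hwv t ⟨h0, ht.2⟩]
    refine (h u₀ v₀ w w' hw hw' t ⟨h0, ht.2⟩).trans ?_
    gcongr
    linarith

omit [Fact (1 ≤ q)] in
theorem eqOn_of_isSolution (hN : 1 ≤ N) (hk : 1 ≤ k) (hρ : 1 < ρ) (hp_top : p ≠ ∞)
    (hp : ((N : ℝ) + 2 * k) / 2 * (ρ - 1) < p.toReal) (hT : 0 < T)
    {u₀ : Lp ℝ p (volume : Measure (Space N k))} {u v : ℝ → Lp ℝ p (volume : Measure (Space N k))}
    (hu : IsSolution ρ T u₀ u) (hv : IsSolution ρ T u₀ v) : EqOn v u (Icc 0 T) := by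
  intro t ht
  obtain ⟨C, hC⟩ := exists_lipschitz (N := N) (k := k) hN hk hρ hp_top hp hT
    (max (xNorm ρ T u) (xNorm ρ T v)).toReal
  have hfin : max (xNorm ρ T u) (xNorm ρ T v) ≠ ∞ :=
    (max_lt hu.2.xNorm_lt_top hv.2.xNorm_lt_top).ne
  have h := hC u₀ u₀ v u hv hu (by rw [ENNReal.ofReal_toReal hfin]; exact le_max_right _ _)
    (by rw [ENNReal.ofReal_toReal hfin]; exact le_max_left _ _) t ht
  rw [sub_self, norm_zero, mul_zero] at h
  exact sub_eq_zero.1 (norm_le_zero_iff.1 h)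

omit [Fact (1 ≤ q)] in
theorem exists_isSolution (hN : 1 ≤ N) (hk : 1 ≤ k) (hρ : 1 < ρ) (hp_top : p ≠ ∞)
    (hp : ((N : ℝ) + 2 * k) / 2 * (ρ - 1) < p.toReal) (M : ℝ) : ∃ T R : ℝ, 0 < T ∧
    ∀ u₀ : Lp ℝ p (volume : Measure (Space N k)), ‖u₀‖ ≤ M →
      ∃ u : ℝ → Lp ℝ p (volume : Measure (Space N k)),
        IsSolution ρ T u₀ u ∧ xNorm ρ T u ≤ ENNReal.ofReal R := by
  have := fact_one_le_mul (p := p) hρ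
  have hE := evolutionSystem hN hk hρ hp_top hp rfl
  obtain ⟨T, R, hT, hR, h⟩ := hE.exists_mildY (le_max_right M 0)
  refine ⟨T, R, hT, fun u₀ hu₀ => ?_⟩
  obtain ⟨w, hw⟩ := h u₀ (hu₀.trans (le_max_left _ _))
  exact ⟨_, isSolution_of_mildY hN hk hρ hp_top hp rfl hR hw⟩

end Solution

end Grushin

theorem theorem3p2 (N k : ℕ) (hN : 1 ≤ N) (hk : 1 ≤ k) (ρ : ℝ) (hρ : 1 < ρ)
    (p : ℝ≥0∞) [Fact (1 ≤ p)] (hp_top : p ≠ ∞)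
    (hp : ((N : ℝ) + 2 * k) / 2 * (ρ - 1) < p.toReal) :
    (∀ M : ℝ, ∃ T : ℝ, 0 < T ∧ ∃ C : ℝ,
      (∀ u₀ : Lp ℝ p (volume : Measure (Grushin.Space N k)), ‖u₀‖ ≤ M →
        ∃ u : ℝ → Lp ℝ p (volume : Measure (Grushin.Space N k)),
          Grushin.IsSolution ρ T u₀ u ∧
          ∀ v : ℝ → Lp ℝ p (volume : Measure (Grushin.Space N k)),
            Grushin.IsSolution ρ T u₀ v → EqOn v u (Icc 0 T)) ∧
      (∀ (u₀ v₀ : Lp ℝ p (volume : Measure (Grushin.Space N k)))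
        (u v : ℝ → Lp ℝ p (volume : Measure (Grushin.Space N k))),
        ‖u₀‖ ≤ M → ‖v₀‖ ≤ M →
        Grushin.IsSolution ρ T u₀ u → Grushin.IsSolution ρ T v₀ v →
        ∀ t ∈ Icc 0 T, ‖u t - v t‖ ≤ C * ‖u₀ - v₀‖)) ∧
    (∀ T R : ℝ, 0 < T → ∃ C : ℝ,
      ∀ (u₀ v₀ : Lp ℝ p (volume : Measure (Grushin.Space N k)))
        (u v : ℝ → Lp ℝ p (volume : Measure (Grushin.Space N k))),
        Grushin.IsSolution ρ T u₀ u → Grushin.IsSolution ρ T v₀ v →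
        Grushin.xNorm ρ T u ≤ ENNReal.ofReal R → Grushin.xNorm ρ T v ≤ ENNReal.ofReal R →
        ∀ t ∈ Icc 0 T, ‖u t - v t‖ ≤ C * ‖u₀ - v₀‖) := by
  refine ⟨fun M => ?_, fun T R hT => Grushin.exists_lipschitz hN hk hρ hp_top hp hT R⟩
  obtain ⟨T, R, hT, hex⟩ := Grushin.exists_isSolution (N := N) (k := k) hN hk hρ hp_top hp M
  obtain ⟨C, hC⟩ := Grushin.exists_lipschitz (N := N) (k := k) hN hk hρ hp_top hp hT R
  refine ⟨T, hT, C, fun u₀ hu₀ => ?_, fun u₀ v₀ u v hu₀ hv₀ hu hv t ht => ?_⟩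
  · obtain ⟨u, hu, -⟩ := hex u₀ hu₀
    exact ⟨u, hu, fun v hv => Grushin.eqOn_of_isSolution hN hk hρ hp_top hp hT hu hv⟩
  -- No bound on the `X_α` norms of `u` and `v` is given. By uniqueness they agree with the
  -- constructed solutions, whose norms are at most `R`, and `R` depends only on `M` and the fixed
  -- parameters.
  · obtain ⟨u', hu', hxu⟩ := hex u₀ hu₀
    obtain ⟨v', hv', hxv⟩ := hex v₀ hv₀
    rw [Grushin.eqOn_of_isSolution hN hk hρ hp_top hp hT hu' hu ht,
      Grushin.eqOn_of_isSolution hN hk hρ hp_top hp hT hv' hv ht]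
    exact hC u₀ v₀ u' v' hu' hv' hxu hxv t ht
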